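/- All matroids are finite. For a matroid $M$ of rank $r$ with $f_i$ independent sets of cardinality $i$, the $h$-vector $h(M)=(h_0,\dots,h_r)$ is given by $\sum_j h_jx^j=\sum_{i=0}^{r} f_i x^i(1-x)^{r-i}$, and $h_j=0$ for $j>r$. An order ideal is a finite nonempty set of monomials closed under taking divisors; it is pure if all its maximal monomials (with respect to divisibility) have the same degree. A sequence $(a_0,a_1,\dots)$ is a pure $O$-sequence if, up to trailing zeros, some pure order ideal in finitely many variables has exactly $a_j$ monomials of degree $j$ for every $j$. A based matroid $(\Delta,B,<)$ of rank $d$ is a matroid $\Delta$ of rank $d$ on a ground set $E$, a basis $B$ and a strict total order $<$ on $E\setminus B$. An isomorphism of based matroids is a matroid isomorphism carrying basis to basis and preserving the orders. Call $I\subseteq E$ *outer* if $I$ is independent and $I\cap B=\emptyset$. For outer $I$, let $\Gamma_I$ be the matroid on $B$ whose independent sets are the $G\subseteq B$ with $G\cup I$ independent in $\Delta$; write $h_{xy}=h(\Gamma_{\{x,y\}})$, $h_{xyz}=h(\Gamma_{\{x,y,z\}})$, and let $b_x$ be the number of bases of $\Gamma_{\{x\}}$. **The algorithm.** Let $(\Delta,B,<)$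 have rank $4$. Define $x\prec y$ if $b_x<b_y$, or $b_x=b_y$ and $x<y$. Let $\mathcal F(\Delta,B,<)$ be the set consisting of the following monomials in the variables $x_i$, $i\in E\setminus B$ (an element and its variable are denoted by the same letter). 1. The monomial $1$. 2. For each outer $\{x\}$: $x^t$ for $1\le t\le b_x$. 3. For each outer $\{x,y\}$ with $x\prec y$: - if $h_{xy}=(1,0,0)$: $xy$; - if $h_{xy}=(1,1,0)$: $xy,\,xy^2$ when $b_x=1$, and $xy,\,x^2y$ otherwise; - if $h_{xy}=(1,1,1)$: $xy,\,xy^2,\,xy^3$ when $b_x=1$, and $xy,\,x^2y,\,x^3y$ otherwise; - if $h_{xy}=(1,2,0)$: $xy,\,x^2y,\,xy^2$; - if $h_{xy}=(1,2,1)$: $xy,\,x^2y,\,xy^2,\,x^2y^2$; - if $h_{xy}=(1,2,2)$: $xy,\,x^2y,\,xy^2,\,x^2y^2,\,xy^3$ when $b_x<3$, and $xy,\,x^2y,\,xy^2,\,x^3y,\,xy^3$ otherwise; - in all other cases: $xy,\,x^2y,\,xy^2,\,x^3y,\,x^2y^2,\,xy^3$. 4. For each outer $\{x,y,z\}$ with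 $x\prec y\prec z$: the monomial $xyz$, together with - if $h_{xyz}=(1,0)$: nothing more; - if $h_{xyz}=(1,1)$, according to the first applicable line: (a) $h_{xy}=(1,0,0)$: $xyz^2$; (b) $h_{xz}=(1,0,0)$: $xy^2z$; (c) $h_{yz}=(1,0,0)$: $x^2yz$; (d) $h_{xz}=(1,1,0)$: $xyz^2$ if $b_x=1$, and $x^2yz$ otherwise; (e) $h_{xy}\in\{(1,1,0),(1,1,1)\}$: $xy^2z$ if $b_x=1$, and $x^2yz$ otherwise; (f) $h_{yz}\in\{(1,1,0),(1,1,1)\}$: $xyz^2$ if $b_y=1$, and $xy^2z$ otherwise; (g) otherwise: $x^2yz$; - if $h_{xyz}=(1,2)$, according to the first applicable line: (a) $b_x=1$: $xy^2z,\,xyz^2$; (b) $b_y=1$: $x^2yz,\,xyz^2$; (c) $b_z=1$: $x^2yz,\,xy^2z$; (d) $h_{xy}\in\{(1,1,0),(1,1,1)\}$: $xy^2z,\,xyz^2$ if $b_x>b_y$, and $x^2yz,\,xyz^2$ otherwise; (e) $h_{xz}\in\{(1,1,0),(1,1,1)\}$: $xy^2z,\,xyz^2$ if $b_x>b_z$,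 and $x^2yz,\,xy^2z$ otherwise; (f) $h_{yz}\in\{(1,1,0),(1,1,1)\}$: $x^2yz,\,xyz^2$ if $b_y>b_z$, and $x^2yz,\,xy^2z$ otherwise; (g) $h_{xy}=(1,2,0)$: $x^2yz,\,xy^2z$; (h) $h_{xz}=(1,2,0)$: $x^2yz,\,xyz^2$; (i) $h_{yz}=(1,2,0)$: $xy^2z,\,xyz^2$; (j) otherwise: $x^2yz,\,xy^2z$; - if $h_{xyz}=(1,3)$: $x^2yz,\,xy^2z,\,xyz^2$. 5. For each outer $\{w,x,y,z\}$ with four elements: $wxyz$. **Theorem.** For every based matroid $(\Delta,B,<)$ of rank $4$, the set $\mathcal F(\Delta,B,<)$ is a pure order ideal, and: 1. its variables are indexed by $E\setminus B$; 2. the support of each of its monomials is $\{x_i: i\in I\}$ for some independent set $I$ disjoint from $B$; 3. for each independent $I$ disjoint from $B$ and each $j\ge 0$, it has exactly $h_j(\Gamma_I)$ monomials of degree $|I|+j$ and support $\{x_i: i\in I\}$; 4. for each independent $I$ disjoint from $B$, the set of its monomials involving only the variables $x_i$, $i\in I$, is $\mathcal F(\Delta|_{B\cup I},B,<)$; 5.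 for each isomorphism $f:(\Delta,B,<)\to(\Delta',B',<')$ of based matroids, renaming each $x_i$ to $x_{f(i)}$ carries $\mathcal F(\Delta,B,<)$ onto $\mathcal F(\Delta',B',<')$. Moreover $\mathcal F(\Delta,B,<)$ has exactly $h_j(\Delta)$ monomials of degree $j$ for every $j\ge0$. Consequently the $h$-vector of every matroid of rank $4$ is a pure $O$-sequence. -/

import Mathlib

universe u

open scoped Matroid

/-! ### Face numbers, h-vectors, order ideals -/

/-- The number of independent sets of cardinality `i` of a (finite) matroid. -/
noncomputable def fNumber {α : Type u} (M : Matroid α) (i : ℕ) : ℕ :=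
  {A : Set α | M.Indep A ∧ A.ncard = i}.ncard

/-- The rank of a (finite) matroid as a natural number. -/
noncomputable def rankNat {α : Type u} (M : Matroid α) : ℕ := M.eRank.toNat

/-- The `h`-polynomial `∑ᵢ fᵢ xⁱ (1 - x)^(r - i)` of the independence complex of a matroid
of rank `r`, where `fᵢ` is the number of independent sets of cardinality `i`. -/
noncomputable def hPoly {α : Type u} (M : Matroid α) : Polynomial ℤ :=
  ∑ i ∈ Finset.range (rankNat M + 1),
    Polynomial.C (fNumber M i : ℤ) * Polynomial.X ^ i * (1 - Polynomial.X) ^ (rankNat M - i)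

/-- The `j`-th entry of the `h`-vector (it is `0` beyond the rank). -/
noncomputable def hNumber {α : Type u} (M : Matroid α) (j : ℕ) : ℤ := (hPoly M).coeff j

/-- The `h`-vector `(h_0, …, h_r)` of a matroid of rank `r`. -/
noncomputable def hVector {α : Type u} (M : Matroid α) : List ℤ :=
  (List.range (rankNat M + 1)).map (hNumber M)

/-- Monomials in variables indexed by `σ` are exponent vectors `σ →₀ ℕ`; divisibility is `≤`.
A pure order ideal is a finite nonempty set of monomials that is closed under taking divisors
and whose maximal monomials all have the same degree. -/
structure IsPureOrderIdeal {σ : Type u} (O : Set (σ →₀ ℕ)) : Prop where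
  finite : O.Finite
  nonempty : O.Nonempty
  lower : ∀ m ∈ O, ∀ m' : σ →₀ ℕ, m' ≤ m → m' ∈ O
  pure : ∃ e : ℕ, ∀ m : σ →₀ ℕ, Maximal (fun m' => m' ∈ O) m → m.degree = e

/-- The number of monomials of degree `j` in a set of monomials. -/
noncomputable def fVectorEntry {σ : Type u} (O : Set (σ →₀ ℕ)) (j : ℕ) : ℕ :=
  {m : σ →₀ ℕ | m ∈ O ∧ m.degree = j}.ncard

/-- `a` is, up to trailing zeros, the vector of numbers of monomials of each degree of a pure
order ideal in finitely many variables. -/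
def IsPureOSequence (a : ℕ → ℤ) : Prop :=
  ∃ (n : ℕ) (O : Set (Fin n →₀ ℕ)), IsPureOrderIdeal O ∧ ∀ j, (fVectorEntry O j : ℤ) = a j

/-! ### Based matroids -/

/-- A based matroid: a finite matroid, a base `B`, and a strict total order on `E \ B`
(as a relation on the ambient type that only holds between elements of `E \ B`). -/
structure BasedMatroid (α : Type u) where
  M : Matroid α
  finite : M.E.Finite
  B : Set α
  isBase : M.IsBase B
  lt : α → α → Prop
  lt_mem : ∀ x y, lt x y → x ∈ M.E \ B ∧ y ∈ M.E \ B
  lt_irrefl : ∀ x, ¬ lt x x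
  lt_trans : ∀ x y z, lt x y → lt y z → lt x z
  lt_total : ∀ x ∈ M.E \ B, ∀ y ∈ M.E \ B, x ≠ y → lt x y ∨ lt y x

namespace BasedMatroid

variable {α : Type u}

/-- The independent sets disjoint from the base. -/
def Outer (Δ : BasedMatroid α) (I : Set α) : Prop := Δ.M.Indep I ∧ Disjoint I Δ.B

/-- For `I` independent and disjoint from `B`, the matroid on `B` whose independent sets are the
`G ⊆ B` with `G ∪ I` independent. -/
def Gam (Δ : BasedMatroid α) (I : Set α) : Matroid α := (Δ.M ／ I) ↾ Δ.B

theorem gam_indep_iff (Δ : BasedMatroid α) {I : Set α} (hI : Δ.Outer I) (G : Set α) :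
    (Δ.Gam I).Indep G ↔ G ⊆ Δ.B ∧ Δ.M.Indep (G ∪ I) := by
  unfold Gam
  rw [Matroid.restrict_indep_iff, hI.1.contract_indep_iff]
  constructor
  · rintro ⟨⟨-, h⟩, hG⟩
    exact ⟨hG, h⟩
  · rintro ⟨hG, h⟩
    exact ⟨⟨(hI.2.mono_right hG).symm, h⟩, hG⟩

/-- The number of bases of `Gam {x}`. -/
noncomputable def nb (Δ : BasedMatroid α) (x : α) : ℕ :=
  {G : Set α | (Δ.Gam {x}).IsBase G}.ncard

/-- The restriction of a based matroid to `B ∪ I`, with the induced order. -/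
def restrictTo (Δ : BasedMatroid α) (I : Set α) (hI : I ⊆ Δ.M.E) : BasedMatroid α where
  M := Δ.M ↾ (Δ.B ∪ I)
  finite := by
    rw [Matroid.restrict_ground_eq]
    exact Δ.finite.subset (Set.union_subset Δ.isBase.subset_ground hI)
  B := Δ.B
  isBase := by
    rw [Matroid.isBase_restrict_iff (Set.union_subset Δ.isBase.subset_ground hI)]
    exact Δ.isBase.isBasis_of_subset (Set.union_subset Δ.isBase.subset_ground hI)
      Set.subset_union_left
  lt x y := Δ.lt x y ∧ x ∈ I ∧ y ∈ I
  lt_mem x y h :=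
    ⟨⟨Or.inr h.2.1, (Δ.lt_mem x y h.1).1.2⟩, ⟨Or.inr h.2.2, (Δ.lt_mem x y h.1).2.2⟩⟩
  lt_irrefl x h := Δ.lt_irrefl x h.1
  lt_trans x y z h₁ h₂ := ⟨Δ.lt_trans x y z h₁.1 h₂.1, h₁.2.1, h₂.2.2⟩
  lt_total x hx y hy hxy := by
    have hx' : x ∈ I := hx.1.resolve_left hx.2
    have hy' : y ∈ I := hy.1.resolve_left hy.2
    rcases Δ.lt_total x ⟨hI hx', hx.2⟩ y ⟨hI hy', hy.2⟩ hxy with h | h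
    · exact Or.inl ⟨h, hx', hy'⟩
    · exact Or.inr ⟨h, hy', hx'⟩

/-- `f` is an isomorphism of based matroids: a bijection of the ground sets that preserves
independence in both directions, maps base to base, and preserves the orders. -/
structure IsIso {β : Type u} (Δ : BasedMatroid α) (Δ' : BasedMatroid β) (f : α → β) : Prop where
  bijOn : Set.BijOn f Δ.M.E Δ'.M.E
  indep_iff : ∀ A ⊆ Δ.M.E, (Δ.M.Indep A ↔ Δ'.M.Indep (f '' A))
  image_base : f '' Δ.B = Δ'.B
  lt_iff : ∀ x ∈ Δ.M.E \ Δ.B, ∀ y ∈ Δ.M.E \ Δ.B, (Δ.lt x y ↔ Δ'.lt (f x) (f y))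

end BasedMatroid

/-- The assignment `F` sends every based matroid of rank `d` to a pure order ideal and satisfies
the five conditions of the strengthened form of Stanley's conjecture in rank `d`. -/
structure SolvesStrongStanley (d : ℕ)
    (F : (α : Type u) → BasedMatroid α → Set (α →₀ ℕ)) : Prop where
  isPureOrderIdeal : ∀ (α : Type u) (Δ : BasedMatroid α), Δ.M.eRank = d →
    IsPureOrderIdeal (F α Δ)
  /-- the variables are indexed by `E \ B` -/
  variables_mem : ∀ (α : Type u) (Δ : BasedMatroid α), Δ.M.eRank = d →
    ∀ m ∈ F α Δ, (m.support : Set α) ⊆ Δ.M.E \ Δ.B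
  /-- supports are independent sets disjoint from `B` -/
  support_outer : ∀ (α : Type u) (Δ : BasedMatroid α), Δ.M.eRank = d →
    ∀ m ∈ F α Δ, Δ.Outer (m.support : Set α)
  /-- exactly `h_j(Γ_I)` monomials have support `I` and degree `|I| + j` -/
  count : ∀ (α : Type u) (Δ : BasedMatroid α), Δ.M.eRank = d →
    ∀ I : Set α, Δ.Outer I → ∀ j : ℕ,
      ({m : α →₀ ℕ | m ∈ F α Δ ∧ (m.support : Set α) = I ∧ m.degree = I.ncard + j}.ncard : ℤ)
        = hNumber (Δ.Gam I) j
  /-- compatibility with restriction to `B ∪ I` -/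
  restrict : ∀ (α : Type u) (Δ : BasedMatroid α), Δ.M.eRank = d →
    ∀ (I : Set α) (hI : Δ.Outer I),
      {m : α →₀ ℕ | m ∈ F α Δ ∧ (m.support : Set α) ⊆ I} =
        F α (Δ.restrictTo I hI.1.subset_ground)
  /-- compatibility with isomorphisms, by renaming the variables -/
  iso : ∀ (α β : Type u) (Δ : BasedMatroid α) (Δ' : BasedMatroid β) (f : α → β),
    Δ.M.eRank = d → Δ.IsIso Δ' f → F β Δ' = Finsupp.mapDomain f '' F α Δ

/-! ### The rank 4 algorithm -/

/-- Exponents `(a, b)` of the monomials `x^a y^b` added for an independent pair `x < y`: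
`h = h(Γ_{x,y})` and `nx = |B_x|`. -/
def pairExponents (h : List ℤ) (nx : ℕ) : List (ℕ × ℕ) :=
  if h = [1, 0, 0] then [(1, 1)]
  else if h = [1, 1, 0] then
    if nx = 1 then [(1, 1), (1, 2)]
    else [(1, 1), (2, 1)]
  else if h = [1, 1, 1] then
    if nx = 1 then [(1, 1), (1, 2), (1, 3)]
    else [(1, 1), (2, 1), (3, 1)]
  else if h = [1, 2, 0] then [(1, 1), (2, 1), (1, 2)]
  else if h = [1, 2, 1] then [(1, 1), (2, 1), (1, 2), (2, 2)]
  else if h = [1, 2, 2] then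
    if nx < 3 then [(1, 1), (2, 1), (1, 2), (2, 2), (1, 3)]
    else [(1, 1), (2, 1), (1, 2), (3, 1), (1, 3)]
  else [(1, 1), (2, 1), (1, 2), (3, 1), (2, 2), (1, 3)]

/-- Exponents `(a, b, c)` of the monomials `x^a y^b z^c` added for an independent triple
`x < y < z`: `h, hxy, hxz, hyz` are the `h`-vectors of `Γ_{x,y,z}, Γ_{x,y}, Γ_{x,z}, Γ_{y,z}`
and `nx, ny, nz` are `|B_x|, |B_y|, |B_z|`. -/
def tripleExponents (h hxy hxz hyz : List ℤ) (nx ny nz : ℕ) : List (ℕ × ℕ × ℕ) :=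
  if h = [1, 0] then [(1, 1, 1)]
  else if h = [1, 1] then
    if hxy = [1, 0, 0] then [(1, 1, 1), (1, 1, 2)]
    else if hxz = [1, 0, 0] then [(1, 1, 1), (1, 2, 1)]
    else if hyz = [1, 0, 0] then [(1, 1, 1), (2, 1, 1)]
    else if hxz = [1, 1, 0] then
      if nx = 1 then [(1, 1, 1), (1, 1, 2)]
      else [(1, 1, 1), (2, 1, 1)]
    else if hxy = [1, 1, 0] ∨ hxy = [1, 1, 1] then
      if nx = 1 then [(1, 1, 1), (1, 2, 1)]
      else [(1, 1, 1), (2, 1, 1)]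
    else if hyz = [1, 1, 0] ∨ hyz = [1, 1, 1] then
      if ny = 1 then [(1, 1, 1), (1, 1, 2)]
      else [(1, 1, 1), (1, 2, 1)]
    else [(1, 1, 1), (2, 1, 1)]
  else if h = [1, 2] then
    if nx = 1 then [(1, 1, 1), (1, 2, 1), (1, 1, 2)]
    else if ny = 1 then [(1, 1, 1), (2, 1, 1), (1, 1, 2)]
    else if nz = 1 then [(1, 1, 1), (2, 1, 1), (1, 2, 1)]
    else if hxy = [1, 1, 0] ∨ hxy = [1, 1, 1] then
      if nx > ny then [(1, 1, 1), (1, 2, 1), (1, 1, 2)]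
      else [(1, 1, 1), (2, 1, 1), (1, 1, 2)]
    else if hxz = [1, 1, 0] ∨ hxz = [1, 1, 1] then
      if nx > nz then [(1, 1, 1), (1, 2, 1), (1, 1, 2)]
      else [(1, 1, 1), (2, 1, 1), (1, 2, 1)]
    else if hyz = [1, 1, 0] ∨ hyz = [1, 1, 1] then
      if ny > nz then [(1, 1, 1), (2, 1, 1), (1, 1, 2)]
      else [(1, 1, 1), (2, 1, 1), (1, 2, 1)]
    else if hxy = [1, 2, 0] then [(1, 1, 1), (2, 1, 1), (1, 2, 1)]
    else if hxz = [1, 2, 0] then [(1, 1, 1), (2, 1, 1), (1, 1, 2)]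
    else if hyz = [1, 2, 0] then [(1, 1, 1), (1, 2, 1), (1, 1, 2)]
    else [(1, 1, 1), (2, 1, 1), (1, 2, 1)]
  else if h = [1, 3] then [(1, 1, 1), (2, 1, 1), (1, 2, 1), (1, 1, 2)]
  else []

namespace BasedMatroid

variable {α : Type u}

/-- The reordering of `E \ B` used by the algorithm: first by `|B_x|`, ties being broken by the
given order. -/
def prec (Δ : BasedMatroid α) (x y : α) : Prop :=
  Δ.nb x < Δ.nb y ∨ (Δ.nb x = Δ.nb y ∧ Δ.lt x y)

/-- The monomials with a one-element support. -/
def monomials₁ (Δ : BasedMatroid α) : Set (α →₀ ℕ) :=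
  {m | ∃ x : α, Δ.Outer {x} ∧ ∃ t : ℕ, 1 ≤ t ∧ t ≤ Δ.nb x ∧ m = Finsupp.single x t}

/-- The monomials with a two-element support. -/
def monomials₂ (Δ : BasedMatroid α) : Set (α →₀ ℕ) :=
  {m | ∃ x y : α, Δ.Outer {x, y} ∧ Δ.prec x y ∧
    ∃ e ∈ pairExponents (hVector (Δ.Gam {x, y})) (Δ.nb x),
      m = Finsupp.single x e.1 + Finsupp.single y e.2}

/-- The monomials with a three-element support. -/
def monomials₃ (Δ : BasedMatroid α) : Set (α →₀ ℕ) :=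
  {m | ∃ x y z : α, Δ.Outer {x, y, z} ∧ Δ.prec x y ∧ Δ.prec y z ∧
    ∃ e ∈ tripleExponents (hVector (Δ.Gam {x, y, z})) (hVector (Δ.Gam {x, y}))
        (hVector (Δ.Gam {x, z})) (hVector (Δ.Gam {y, z})) (Δ.nb x) (Δ.nb y) (Δ.nb z),
      m = Finsupp.single x e.1 + Finsupp.single y e.2.1 + Finsupp.single z e.2.2}

/-- The monomials with a four-element support. -/
def monomials₄ (Δ : BasedMatroid α) : Set (α →₀ ℕ) :=
  {m | ∃ w x y z : α, Δ.Outer {w, x, y, z} ∧ Δ.prec w x ∧ Δ.prec x y ∧ Δ.prec y z ∧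
    m = Finsupp.single w 1 + Finsupp.single x 1 + Finsupp.single y 1 + Finsupp.single z 1}

end BasedMatroid

/-- The output of the rank 4 algorithm on a based matroid. -/
def rankFourOutput (α : Type u) (Δ : BasedMatroid α) : Set (α →₀ ℕ) :=
  {0} ∪ Δ.monomials₁ ∪ Δ.monomials₂ ∪ Δ.monomials₃ ∪ Δ.monomials₄

/-! Enumerate `B` by `Fin 4` and record independence relative to it, as one would record the
nonvanishing minors of a matrix `[1 | A]`. The row of `x` is the set of `i` such that `x` can
replace the `i`-th base element; a pair `x, y` has the set of pairs of base elements that it can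
replace; a triple `x, y, z` has the set of base elements that complete it to a base. The numbers
`b_x` and the `h`-vectors of `Γ_I` for outer pairs and triples `I` are functions of these bits, so
the exponents that the algorithm chooses for a support of size two or three depend on finitely many
bits.

The bits satisfy relations that are shadows of identities between minors, but they follow from
augmentation of independent sets alone, so no representability is needed: `hexForced`, `hexTrans`,
`hexQuad`, `hexesTrans`, `hexesQuad`. An exhaustive check of all bit patterns with these relations
(`pairCheckAll_eq_true`, `tripleCheckAll_eq_true`) shows that the chosen exponents are closed under
division and have the degrees that purity requires (`PairGood`, `TripleGood`).

Purity is governed by `span I`, the union of the rows of the elements of `I`. Every monomial divides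
one whose degree is the size of the span of its support (`exists_ge_degree_eq`), and a monomial of
that degree can be multiplied by a power of `z` whenever the row of `z` is not contained in the span
(`exists_add_single_mem`). So the support of a maximal monomial spans as much as all of `E \ B`, and
its degree is the size of that span.

For the counts, the exponent lists have the right number of entries in each degree by inspection.
Cutting an independent set into its parts outside and inside `B` gives `h(Δ; t) = ∑ t^|I| h(Γ_I; t)`
over outer `I` (`hPoly_eq`), so the counts for each support add up to `h(Δ)`. Restriction and
isomorphism are formal: whatever the algorithm consults for a support `I` depends only on `Δ`
restricted to `B ∪ I` and on the order. -/

/-! ### Subsets of a four-element set and families of its two-element subsets, as bit vectors -/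

/-- The four bits of a subset of `Fin 4`. -/
structure Quad where
  a : Bool
  b : Bool
  c : Bool
  d : Bool

namespace Quad

def get (q : Quad) : Fin 4 → Bool
  | ⟨0, _⟩ => q.a
  | ⟨1, _⟩ => q.b
  | ⟨2, _⟩ => q.c
  | ⟨_, _⟩ => q.d

def of (f : Fin 4 → Bool) : Quad := ⟨f 0, f 1, f 2, f 3⟩

theorem get_of (f : Fin 4 → Bool) (i : Fin 4) : (of f).get i = f i := by
  fin_cases i <;> rfl

def count (q : Quad) : ℕ := q.a.toNat + q.b.toNat + q.c.toNat + q.d.toNat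

def union (q r : Quad) : Quad := ⟨q.a || r.a, q.b || r.b, q.c || r.c, q.d || r.d⟩

theorem get_union (q r : Quad) (i : Fin 4) : (q.union r).get i = (q.get i || r.get i) := by
  fin_cases i <;> rfl

theorem card_filter_get (q : Quad) :
    (Finset.univ.filter fun i => q.get i = true).card = q.count := by
  obtain ⟨a, b, c, d⟩ := q
  cases a <;> cases b <;> cases c <;> cases d <;> rfl

def nonzero (q : Quad) : Bool := q.a || q.b || q.c || q.d

theorem nonzero_of_get {q : Quad} {i : Fin 4} (h : q.get i = true) : q.nonzero = true := by
  obtain ⟨a, b, c, d⟩ := q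
  cases a <;> cases b <;> cases c <;> cases d <;> fin_cases i <;> first | rfl | exact h

/-- The `h`-vector of a matroid of rank `1` whose nonloops are the elements of the subset. -/
def hList (t : Quad) : List ℤ := [1, t.count - 1]

end Quad

/-- The six bits of a set of two-element subsets of `Fin 4`. -/
structure Hex where
  p01 : Bool
  p02 : Bool
  p03 : Bool
  p12 : Bool
  p13 : Bool
  p23 : Bool

namespace Hex

def get (h : Hex) : Fin 4 → Fin 4 → Bool
  | ⟨0, _⟩, ⟨1, _⟩ => h.p01
  | ⟨0, _⟩, ⟨2, _⟩ => h.p02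
  | ⟨0, _⟩, ⟨3, _⟩ => h.p03
  | ⟨1, _⟩, ⟨0, _⟩ => h.p01
  | ⟨1, _⟩, ⟨2, _⟩ => h.p12
  | ⟨1, _⟩, ⟨3, _⟩ => h.p13
  | ⟨2, _⟩, ⟨0, _⟩ => h.p02
  | ⟨2, _⟩, ⟨1, _⟩ => h.p12
  | ⟨2, _⟩, ⟨3, _⟩ => h.p23
  | ⟨3, _⟩, ⟨0, _⟩ => h.p03
  | ⟨3, _⟩, ⟨1, _⟩ => h.p13
  | ⟨3, _⟩, ⟨2, _⟩ => h.p23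
  | _, _ => false

def of (f : Fin 4 → Fin 4 → Bool) : Hex := ⟨f 0 1, f 0 2, f 0 3, f 1 2, f 1 3, f 2 3⟩

theorem get_of (f : Fin 4 → Fin 4 → Bool) (hs : ∀ i j, f i j = f j i) (h0 : ∀ i, f i i = false)
    (i j : Fin 4) : (of f).get i j = f i j := by
  fin_cases i <;> fin_cases j <;> first | rfl | exact hs _ _ | exact (h0 _).symm

def count (h : Hex) : ℕ :=
  h.p01.toNat + h.p02.toNat + h.p03.toNat + h.p12.toNat + h.p13.toNat + h.p23.toNat

/-- The number of indices avoided by some pair of the set. -/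
def avoided (h : Hex) : ℕ :=
  (h.p12 || h.p13 || h.p23).toNat + (h.p02 || h.p03 || h.p23).toNat +
    (h.p01 || h.p03 || h.p13).toNat + (h.p01 || h.p02 || h.p12).toNat

/-- The `h`-vector of a matroid of rank `2` on `Fin 4` whose bases are the complements of the
pairs of the set. -/
def hList (h : Hex) : List ℤ := [1, h.avoided - 2, h.count - h.avoided + 1]

end Hex

/-! ### Quantifiers that the kernel evaluates quickly -/

def allBool (f : Bool → Bool) : Bool := f false && f true

theorem allBool_iff (f : Bool → Bool) : allBool f = true ↔ ∀ b, f b = true := by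
  simp [allBool]

def allQuad (f : Quad → Bool) : Bool :=
  allBool fun a => allBool fun b => allBool fun c => allBool fun d => f ⟨a, b, c, d⟩

theorem allQuad_iff (f : Quad → Bool) : allQuad f = true ↔ ∀ b, f b = true := by
  simp only [allQuad, allBool_iff]
  exact ⟨fun h q => h _ _ _ _, fun h _ _ _ _ => h _⟩

def allIdx (f : Fin 4 → Bool) : Bool := f 0 && f 1 && f 2 && f 3

theorem allIdx_iff (f : Fin 4 → Bool) : allIdx f = true ↔ ∀ b, f b = true := by
  simp [allIdx, Fin.forall_fin_succ, and_assoc]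

def anyIdx (f : Fin 4 → Bool) : Bool := f 0 || f 1 || f 2 || f 3

theorem anyIdx_iff (f : Fin 4 → Bool) : anyIdx f = true ↔ ∃ b, f b = true := by
  simp [anyIdx, Fin.exists_fin_succ, or_assoc]

/-- The value of the bit `{i, j}` that is forced by the rows `n` and `m`. -/
def forcedBit (n m : Quad) (i j : Fin 4) : Bool :=
  (n.get i && m.get j) || (n.get j && m.get i)

/-- Quantify over the bit `{i, j}`, which is forced unless both rows contain `i` and `j`. -/
def allBit (n m : Quad) (i j : Fin 4) (f : Bool → Bool) : Bool :=
  bif n.get i && n.get j && m.get i && m.get j then allBool f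
  else bif forcedBit n m i j then f true else f false

theorem apply_of_allBit {n m : Quad} {i j : Fin 4} {f : Bool → Bool} (h : allBit n m i j f = true)
    (b : Bool)
    (hb : (n.get i && n.get j && m.get i && m.get j) = true ∨ b = forcedBit n m i j) :
    f b = true := by
  unfold allBit at h
  rcases hb with hb | hb
  · rw [hb, cond_true, allBool_iff] at h
    exact h b
  · cases hc : (n.get i && n.get j && m.get i && m.get j)
    · rw [hc, cond_false, ← hb] at h
      cases b <;> simpa using h
    · rw [hc, cond_true, allBool_iff] at h
      exact h b

/-- The pairs are the bases of a matroid of rank `2` whose nonloops belong to `n` or `m`. -/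
def hexTrans (n m : Quad) (p : Hex) : Bool :=
  (allIdx fun i => allIdx fun j => !p.get i j ||
      allIdx fun k => !(n.get k || m.get k) || p.get i k || p.get j k) &&
  anyIdx fun i => anyIdx fun j => p.get i j

/-- The pairs that are not forced by the two rows are nonforced only if both rows allow it. -/
def HexForced (n m : Quad) (p : Hex) : Prop :=
  ∀ i j, i ≠ j → (n.get i && n.get j && m.get i && m.get j) = true ∨
    p.get i j = forcedBit n m i j

/-- Only the bits that the two rows leave undetermined are branched on, which keeps the enumeration
over triples small. -/
def allHex (n m : Quad) (f : Hex → Bool) : Bool :=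
  allBit n m 0 1 fun a => allBit n m 0 2 fun b => allBit n m 0 3 fun c => allBit n m 1 2 fun d =>
    allBit n m 1 3 fun a' => allBit n m 2 3 fun b' =>
      !hexTrans n m ⟨a, b, c, d, a', b'⟩ || f ⟨a, b, c, d, a', b'⟩

theorem apply_of_allHex {n m : Quad} {f : Hex → Bool} (h : allHex n m f = true) (p : Hex)
    (hp : HexForced n m p) (hp' : hexTrans n m p = true) : f p = true := by
  have h1 := apply_of_allBit h p.p01 (hp 0 1 (by decide))
  have h2 := apply_of_allBit h1 p.p02 (hp 0 2 (by decide))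
  have h3 := apply_of_allBit h2 p.p03 (hp 0 3 (by decide))
  have h4 := apply_of_allBit h3 p.p12 (hp 1 2 (by decide))
  have h5 := apply_of_allBit h4 p.p13 (hp 1 3 (by decide))
  have h6 := apply_of_allBit h5 p.p23 (hp 2 3 (by decide))
  simpa [hp'] using h6

/-! ### The relations between the rows, pairs and triples -/

/-- No element of `t` is a coloop of the restriction to `t`. -/
def hexQuad (p : Hex) (t : Quad) : Bool :=
  allIdx fun i => !t.get i || allIdx fun j => !p.get i j ||
    anyIdx fun k => i != k && (t.get k && p.get k j)

/-- The shadow of a Laplace expansion: a nonzero `3 × 3` minor avoiding the index `i` has a nonzero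
`2 × 2` minor on any two of its indices `j`, `k`. -/
def hexesQuad (p q r : Hex) (t : Quad) : Bool :=
  allIdx fun i => !t.get i || allIdx fun j => allIdx fun k =>
    i == j || i == k || j == k || p.get j k || q.get j k || r.get j k

/-- Parallel pairs are transitive through the row `m`. -/
def hexesTrans (m : Quad) (p q r : Hex) : Bool :=
  allIdx fun i => allIdx fun j => !(m.get i && q.get i j) || p.get i j || r.get i j

/-! ### The properties of the exponents that make the output a pure order ideal -/

def pairMem (a b : ℕ) (E : List (ℕ × ℕ)) : Bool :=
  E.any fun e => e.1 == a && e.2 == b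

theorem pairMem_iff {a b : ℕ} {E : List (ℕ × ℕ)} : pairMem a b E = true ↔ (a, b) ∈ E := by
  simp [pairMem]

def tripleMem (a b c : ℕ) (E : List (ℕ × ℕ × ℕ)) : Bool :=
  E.any fun e => e.1 == a && (e.2.1 == b && e.2.2 == c)

theorem tripleMem_iff {a b c : ℕ} {E : List (ℕ × ℕ × ℕ)} :
    tripleMem a b c E = true ↔ (a, b, c) ∈ E := by
  simp [tripleMem]

/-- The exponents `P` of a pair with `nx` and `ny` powers of its variables are closed under
division, all divide exponents of total degree `N`, and extend the maximal powers. -/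
structure PairGood (N nx ny : ℕ) (P : List (ℕ × ℕ)) : Prop where
  pos : ∀ {a b}, (a, b) ∈ P → 1 ≤ a ∧ 1 ≤ b
  le_left : ∀ {a b}, (a, b) ∈ P → a ≤ nx
  le_right : ∀ {a b}, (a, b) ∈ P → b ≤ ny
  lower_left : ∀ {a b}, (a, b) ∈ P → a = 1 ∨ (a - 1, b) ∈ P
  lower_right : ∀ {a b}, (a, b) ∈ P → b = 1 ∨ (a, b - 1) ∈ P
  extend : ∀ {a b}, (a, b) ∈ P → ∃ a' b', (a', b') ∈ P ∧ a ≤ a' ∧ b ≤ b' ∧ a' + b' = N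
  extend_left : nx = N ∨ ∃ b, (nx, b) ∈ P
  extend_right : ny = N ∨ ∃ a, (a, ny) ∈ P

def pairGood (N nx ny : ℕ) (P : List (ℕ × ℕ)) : Bool :=
  (P.all fun e => Nat.ble 1 e.1 && (Nat.ble 1 e.2 && (Nat.ble e.1 nx && (Nat.ble e.2 ny &&
    ((e.1 == 1 || pairMem (e.1 - 1) e.2 P) && ((e.2 == 1 || pairMem e.1 (e.2 - 1) P) &&
    (P.any fun e' => Nat.ble e.1 e'.1 && (Nat.ble e.2 e'.2 && e'.1 + e'.2 == N)))))))) &&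
  ((nx == N || P.any fun e => e.1 == nx) && (ny == N || P.any fun e => e.2 == ny))

theorem PairGood.of_pairGood {N nx ny : ℕ} {P : List (ℕ × ℕ)} (h : pairGood N nx ny P = true) :
    PairGood N nx ny P := by
  simp only [pairGood, Bool.and_eq_true, List.all_eq_true, List.any_eq_true, Bool.or_eq_true,
    Nat.ble_eq, beq_iff_eq, pairMem_iff, Prod.forall, Prod.exists] at h
  obtain ⟨h, h1, h2⟩ := h
  refine ⟨fun hm => ⟨(h _ _ hm).1, (h _ _ hm).2.1⟩, fun hm => (h _ _ hm).2.2.1,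
    fun hm => (h _ _ hm).2.2.2.1, fun hm => (h _ _ hm).2.2.2.2.1,
    fun hm => (h _ _ hm).2.2.2.2.2.1, fun hm => ?_, ?_, ?_⟩
  · exact (h _ _ hm).2.2.2.2.2.2
  · rcases h1 with h1 | ⟨a, b, hab, rfl⟩
    exacts [Or.inl h1, Or.inr ⟨b, hab⟩]
  · rcases h2 with h2 | ⟨a, b, hab, rfl⟩
    exacts [Or.inl h2, Or.inr ⟨a, hab⟩]

/-- The exponents `E` of a triple are closed under division, all divide exponents of total degree
`N`, and extend those exponents of the pairs that have maximal total degree. -/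
structure TripleGood (N Nxy Nxz Nyz : ℕ) (E : List (ℕ × ℕ × ℕ)) (P Q R : List (ℕ × ℕ)) :
    Prop where
  one_mem : (1, 1, 1) ∈ E
  pos : ∀ {a b c}, (a, b, c) ∈ E → 1 ≤ a ∧ 1 ≤ b ∧ 1 ≤ c
  mem_xy : ∀ {a b c}, (a, b, c) ∈ E → (a, b) ∈ P
  mem_xz : ∀ {a b c}, (a, b, c) ∈ E → (a, c) ∈ Q
  mem_yz : ∀ {a b c}, (a, b, c) ∈ E → (b, c) ∈ R
  lower_x : ∀ {a b c}, (a, b, c) ∈ E → a = 1 ∨ (a - 1, b, c) ∈ E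
  lower_y : ∀ {a b c}, (a, b, c) ∈ E → b = 1 ∨ (a, b - 1, c) ∈ E
  lower_z : ∀ {a b c}, (a, b, c) ∈ E → c = 1 ∨ (a, b, c - 1) ∈ E
  extend : ∀ {a b c}, (a, b, c) ∈ E →
    ∃ a' b' c', (a', b', c') ∈ E ∧ a ≤ a' ∧ b ≤ b' ∧ c ≤ c' ∧ a' + b' + c' = N
  extend_xy : ∀ {a b}, (a, b) ∈ P → a + b = N ∨ a + b ≠ Nxy ∨ ∃ c, (a, b, c) ∈ E
  extend_xz : ∀ {a c}, (a, c) ∈ Q → a + c = N ∨ a + c ≠ Nxz ∨ ∃ b, (a, b, c) ∈ E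
  extend_yz : ∀ {b c}, (b, c) ∈ R → b + c = N ∨ b + c ≠ Nyz ∨ ∃ a, (a, b, c) ∈ E

def tripleGood (N Nxy Nxz Nyz : ℕ) (E : List (ℕ × ℕ × ℕ)) (P Q R : List (ℕ × ℕ)) : Bool :=
  tripleMem 1 1 1 E &&
  ((E.all fun e => Nat.ble 1 e.1 && (Nat.ble 1 e.2.1 && (Nat.ble 1 e.2.2 &&
    (pairMem e.1 e.2.1 P && (pairMem e.1 e.2.2 Q && (pairMem e.2.1 e.2.2 R &&
    ((e.1 == 1 || tripleMem (e.1 - 1) e.2.1 e.2.2 E) &&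
    ((e.2.1 == 1 || tripleMem e.1 (e.2.1 - 1) e.2.2 E) &&
    ((e.2.2 == 1 || tripleMem e.1 e.2.1 (e.2.2 - 1) E) &&
    (E.any fun e' => Nat.ble e.1 e'.1 && (Nat.ble e.2.1 e'.2.1 && (Nat.ble e.2.2 e'.2.2 &&
      e'.1 + e'.2.1 + e'.2.2 == N)))))))))))) &&
  ((P.all fun e => e.1 + e.2 == N || (e.1 + e.2 != Nxy ||
    E.any fun e' => e'.1 == e.1 && e'.2.1 == e.2)) &&
  ((Q.all fun e => e.1 + e.2 == N || (e.1 + e.2 != Nxz ||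
    E.any fun e' => e'.1 == e.1 && e'.2.2 == e.2)) &&
  (R.all fun e => e.1 + e.2 == N || (e.1 + e.2 != Nyz ||
    E.any fun e' => e'.2.1 == e.1 && e'.2.2 == e.2)))))

theorem TripleGood.of_tripleGood {N Nxy Nxz Nyz : ℕ} {E : List (ℕ × ℕ × ℕ)} {P Q R : List (ℕ × ℕ)}
    (h : tripleGood N Nxy Nxz Nyz E P Q R = true) : TripleGood N Nxy Nxz Nyz E P Q R := by
  simp only [tripleGood, Bool.and_eq_true, List.all_eq_true, List.any_eq_true, Bool.or_eq_true,
    Nat.ble_eq, beq_iff_eq, bne_iff_ne, pairMem_iff, tripleMem_iff, Prod.forall,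
    Prod.exists] at h
  obtain ⟨h0, h, h1, h2, h3⟩ := h
  refine ⟨h0, fun hm => ⟨(h _ _ _ hm).1, (h _ _ _ hm).2.1, (h _ _ _ hm).2.2.1⟩,
    fun hm => (h _ _ _ hm).2.2.2.1, fun hm => (h _ _ _ hm).2.2.2.2.1,
    fun hm => (h _ _ _ hm).2.2.2.2.2.1, fun hm => (h _ _ _ hm).2.2.2.2.2.2.1,
    fun hm => (h _ _ _ hm).2.2.2.2.2.2.2.1, fun hm => (h _ _ _ hm).2.2.2.2.2.2.2.2.1,
    fun hm => (h _ _ _ hm).2.2.2.2.2.2.2.2.2, fun hm => ?_, fun hm => ?_, fun hm => ?_⟩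
  · rcases h1 _ _ hm with h | h | ⟨a, b, c, hE, rfl, rfl⟩
    exacts [Or.inl h, Or.inr (Or.inl h), Or.inr (Or.inr ⟨_, hE⟩)]
  · rcases h2 _ _ hm with h | h | ⟨a, b, c, hE, rfl, rfl⟩
    exacts [Or.inl h, Or.inr (Or.inl h), Or.inr (Or.inr ⟨_, hE⟩)]
  · rcases h3 _ _ hm with h | h | ⟨a, b, c, hE, rfl, rfl⟩
    exacts [Or.inl h, Or.inr (Or.inl h), Or.inr (Or.inr ⟨_, hE⟩)]

/-! ### The finite verification -/

/-- Evaluate the argument before applying `f`, if it is at most `4`. -/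
def natCases (k : ℕ) (f : ℕ → Bool) : Bool :=
  match k with
  | 0 => f 0
  | 1 => f 1
  | 2 => f 2
  | 3 => f 3
  | 4 => f 4
  | k + 5 => f (k + 5)

theorem natCases_eq (k : ℕ) (f : ℕ → Bool) : natCases k f = f k := by
  match k with
  | 0 | 1 | 2 | 3 | 4 | k + 5 => rfl

/-- Evaluate the `h`-vector, which must be that of a matroid of rank `2` on four elements. -/
def Hex.hCases (p : Hex) (f : List ℤ → Bool) : Bool :=
  match p.avoided, p.count with
  | 2, 1 => f [1, 0, 0]
  | 3, 2 => f [1, 1, 0]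
  | 3, 3 => f [1, 1, 1]
  | 4, 3 => f [1, 2, 0]
  | 4, 4 => f [1, 2, 1]
  | 4, 5 => f [1, 2, 2]
  | 4, 6 => f [1, 2, 3]
  | _, _ => false

/-- The `h`-vectors of the matroids of rank `2` on four elements. -/
def pairHLists : List (List ℤ) :=
  [[1, 0, 0], [1, 1, 0], [1, 1, 1], [1, 2, 0], [1, 2, 1], [1, 2, 2], [1, 2, 3]]

/-- Since `hCases` falls back to `false`, a successful check also certifies that the `h`-vector is
one of the seven listed. -/
theorem Hex.hCases_spec {p : Hex} {f : List ℤ → Bool} (h : p.hCases f = true) :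
    f p.hList = true ∧ p.hList ∈ pairHLists := by
  obtain ⟨a, b, c, d, e, g⟩ := p
  cases a <;> cases b <;> cases c <;> cases d <;> cases e <;> cases g <;>
    first
    | exact ⟨h, by decide⟩
    | exact absurd h Bool.false_ne_true

/-- Evaluate the `h`-vector of a matroid of rank `1` on four elements. -/
def Quad.hCases (t : Quad) (f : List ℤ → Bool) : Bool :=
  match t.count with
  | 1 => f [1, 0]
  | 2 => f [1, 1]
  | 3 => f [1, 2]
  | 4 => f [1, 3]
  | _ => false

/-- The `h`-vectors of the matroids of rank `1` on four elements. -/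
def tripleHLists : List (List ℤ) := [[1, 0], [1, 1], [1, 2], [1, 3]]

theorem Quad.hList_mem {t : Quad} (h : t.nonzero = true) : t.hList ∈ tripleHLists := by
  obtain ⟨a, b, c, d⟩ := t
  cases a <;> cases b <;> cases c <;> cases d <;>
    first
    | decide
    | exact absurd h Bool.false_ne_true

theorem Quad.hCases_spec {t : Quad} {f : List ℤ → Bool} (h : t.hCases f = true) :
    f t.hList = true := by
  obtain ⟨a, b, c, d⟩ := t
  cases a <;> cases b <;> cases c <;> cases d <;>
    first
    | exact h
    | exact absurd h Bool.false_ne_true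

def pairCheck (n m : Quad) (p : Hex) : Bool :=
  natCases n.count fun nx => natCases m.count fun ny =>
  natCases (n.union m).count fun N => p.hCases fun hp =>
    pairGood N nx ny (pairExponents hp nx)

/-- The inequality between the counts reflects that `prec` sorts by `b_x` first; the tie-breaking
order plays no role in the check. -/
def pairCheckAll : Bool :=
  allQuad fun n => !n.nonzero || allQuad fun m =>
  !(m.nonzero && Nat.ble n.count m.count) || allHex n m fun p => pairCheck n m p

def tripleCheckAux (N Nxy Nxz Nyz : ℕ) (ht hp hq hr : List ℤ) (nx ny nz : ℕ) : Bool :=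
  tripleGood N Nxy Nxz Nyz (tripleExponents ht hp hq hr nx ny nz)
    (pairExponents hp nx) (pairExponents hq nx) (pairExponents hr ny)

def tripleCheck (n m l : Quad) (p q r : Hex) (t : Quad) : Bool :=
  natCases n.count fun nx => natCases m.count fun ny => natCases l.count fun nz =>
  natCases ((n.union m).union l).count fun N =>
  natCases (n.union m).count fun Nxy =>
  natCases (n.union l).count fun Nxz =>
  natCases (m.union l).count fun Nyz =>
  t.hCases fun ht => p.hCases fun hp => q.hCases fun hq => r.hCases fun hr =>
    tripleCheckAux N Nxy Nxz Nyz ht hp hq hr nx ny nz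

/-- The patterns need not come from matroids: they satisfy only the necessary relations. Those tying
two or three pairs together come after `tripleCheck` in the disjunction, so they matter only for
patterns where the exponents fail. -/
def tripleCheckAll : Bool :=
  allQuad fun t => !t.nonzero || allQuad fun n => !n.nonzero || allQuad fun m =>
  !(m.nonzero && Nat.ble n.count m.count) || allHex n m fun p => !hexQuad p t || allQuad fun l =>
  !(l.nonzero && Nat.ble m.count l.count) || allHex n l fun q => !hexQuad q t ||
  allHex m l fun r => !hexQuad r t || tripleCheck n m l p q r t ||
  !hexesTrans m p q r || !hexesTrans n p r q || !hexesTrans l q p r || !hexesQuad p q r t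

set_option maxRecDepth 100000 in
theorem pairCheckAll_eq_true : pairCheckAll = true := by decide +kernel

set_option maxRecDepth 100000 in
theorem tripleCheckAll_eq_true : tripleCheckAll = true := by decide +kernel

theorem pairGood_of_bits {n m : Quad} {p : Hex} (hn : n.nonzero = true) (hm : m.nonzero = true)
    (hle : n.count ≤ m.count) (hp : HexForced n m p) (hp' : hexTrans n m p = true) :
    PairGood (n.union m).count n.count m.count (pairExponents p.hList n.count) ∧
      p.hList ∈ pairHLists := by
  have h := pairCheckAll_eq_true
  have h1 := (allQuad_iff _).1 h n
  rw [hn, Bool.not_true, Bool.false_or] at h1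
  have h2 := (allQuad_iff _).1 h1 m
  rw [hm, Nat.ble_eq_true_of_le hle, Bool.and_true, Bool.not_true, Bool.false_or] at h2
  have h3 := apply_of_allHex h2 p hp hp'
  simp only [pairCheck, natCases_eq] at h3
  exact ⟨PairGood.of_pairGood (Hex.hCases_spec h3).1, (Hex.hCases_spec h3).2⟩

theorem tripleGood_of_bits {n m l : Quad} {p q r : Hex} {t : Quad}
    (hn : n.nonzero = true) (hm : m.nonzero = true) (hl : l.nonzero = true)
    (ht : t.nonzero = true) (hnm : n.count ≤ m.count) (hml : m.count ≤ l.count)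
    (hp : HexForced n m p) (hp' : hexTrans n m p = true) (hpt : hexQuad p t = true)
    (hq : HexForced n l q) (hq' : hexTrans n l q = true) (hqt : hexQuad q t = true)
    (hr : HexForced m l r) (hr' : hexTrans m l r = true) (hrt : hexQuad r t = true)
    (h₁ : hexesTrans m p q r = true) (h₂ : hexesTrans n p r q = true)
    (h₃ : hexesTrans l q p r = true) (h₄ : hexesQuad p q r t = true) :
    TripleGood ((n.union m).union l).count (n.union m).count (n.union l).count (m.union l).count
      (tripleExponents t.hList p.hList q.hList r.hList n.count m.count l.count)
      (pairExponents p.hList n.count) (pairExponents q.hList n.count)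
      (pairExponents r.hList m.count) := by
  have h := tripleCheckAll_eq_true
  replace h := (allQuad_iff _).1 h t
  rw [ht, Bool.not_true, Bool.false_or] at h
  replace h := (allQuad_iff _).1 h n
  rw [hn, Bool.not_true, Bool.false_or] at h
  replace h := (allQuad_iff _).1 h m
  rw [hm, Nat.ble_eq_true_of_le hnm, Bool.and_true, Bool.not_true, Bool.false_or] at h
  replace h := apply_of_allHex h p hp hp'
  rw [hpt, Bool.not_true, Bool.false_or] at h
  replace h := (allQuad_iff _).1 h l
  rw [hl, Nat.ble_eq_true_of_le hml, Bool.and_true, Bool.not_true, Bool.false_or] at h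
  replace h := apply_of_allHex h q hq hq'
  rw [hqt, Bool.not_true, Bool.false_or] at h
  replace h := apply_of_allHex h r hr hr'
  rw [hrt, h₁, h₂, h₃, h₄] at h
  simp only [Bool.not_true, Bool.false_or, Bool.or_false, tripleCheck, natCases_eq] at h
  have h' := (Hex.hCases_spec (Hex.hCases_spec (Hex.hCases_spec
    (Quad.hCases_spec h)).1).1).1
  exact TripleGood.of_tripleGood h'

/-! ### Independent sets of a based matroid of rank four in coordinates on the base -/

namespace BasedMatroid

variable {α : Type u}

/-- `e` enumerates the base of `Δ`. -/
structure IsEnum (Δ : BasedMatroid α) (e : Fin 4 → α) : Prop where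
  inj : Function.Injective e
  range : Set.range e = Δ.B

/-- `I` together with the base elements numbered by `G` is independent. -/
def Kept (Δ : BasedMatroid α) (e : Fin 4 → α) (G : Finset (Fin 4)) (I : Set α) : Prop :=
  Δ.M.Indep (I ∪ e '' G)

theorem exists_isEnum (Δ : BasedMatroid α) (hr : Δ.M.eRank = 4) : ∃ e, Δ.IsEnum e := by
  have hB : Δ.B.encard = 4 := by rw [Δ.isBase.encard_eq_eRank, hr]
  have hfin : Δ.B.Finite := Δ.finite.subset Δ.isBase.subset_ground
  have hcard : Nat.card Δ.B = 4 := by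
    rw [Nat.card_coe_set_eq, Set.ncard_def, hB]; rfl
  have : Finite Δ.B := hfin
  let f := Finite.equivFinOfCardEq hcard
  refine ⟨fun i => (f.symm i : α), ⟨Subtype.val_injective.comp f.symm.injective, ?_⟩⟩
  ext b
  constructor
  · rintro ⟨i, rfl⟩
    exact (f.symm i).2
  · intro hb
    exact ⟨f ⟨b, hb⟩, by simp⟩

variable {Δ : BasedMatroid α} {e : Fin 4 → α} {G H : Finset (Fin 4)} {I J : Set α} {x y z : α}

theorem Outer.finite (hI : Δ.Outer I) : I.Finite := Δ.finite.subset hI.1.subset_ground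

theorem Outer.subset (hI : Δ.Outer I) (hJ : J ⊆ I) : Δ.Outer J :=
  ⟨hI.1.subset hJ, hI.2.mono_left hJ⟩

theorem Outer.subset_diff (hI : Δ.Outer I) : I ⊆ Δ.M.E \ Δ.B :=
  fun _ hx => ⟨hI.1.subset_ground hx, Set.disjoint_left.1 hI.2 hx⟩

theorem Kept.indep (h : Δ.Kept e G I) : Δ.M.Indep I := h.subset Set.subset_union_left

theorem Kept.mono (h : Δ.Kept e G I) (hH : H ⊆ G) (hJ : J ⊆ I) : Δ.Kept e H J :=
  Matroid.Indep.subset h (Set.union_subset_union hJ (Set.image_mono (by exact_mod_cast hH)))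

theorem Outer.kept_empty (hI : Δ.Outer I) : Δ.Kept e ∅ I := by
  simpa [Kept] using hI.1

namespace IsEnum

theorem mem (he : Δ.IsEnum e) (i : Fin 4) : e i ∈ Δ.B := he.range ▸ Set.mem_range_self i

theorem image_subset (he : Δ.IsEnum e) (G : Finset (Fin 4)) : e '' G ⊆ Δ.B := by
  rintro _ ⟨i, -, rfl⟩
  exact he.mem i

theorem kept_univ (he : Δ.IsEnum e) : Δ.Kept e Finset.univ ∅ := by
  simpa [Kept, he.range] using Δ.isBase.indep

theorem encard_union (he : Δ.IsEnum e) (hI : Disjoint I Δ.B) (G : Finset (Fin 4)) :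
    (I ∪ e '' G).encard = I.encard + G.card := by
  rw [Set.encard_union_eq (hI.mono_right (he.image_subset G)), he.inj.encard_image,
    Set.encard_coe_eq_coe_finsetCard]

/-- The source of all relations between the bits. In the applications, the sets are chosen so that
the new element is confined to a few candidates. -/
theorem augment (he : Δ.IsEnum e) (hG : Δ.Kept e G I) (hH : Δ.Kept e H J) (hI : Disjoint I Δ.B)
    (hJ : Disjoint J Δ.B) (hlt : I.encard + G.card < J.encard + H.card) :
    (∃ h ∈ H, h ∉ G ∧ Δ.Kept e (insert h G) I) ∨ ∃ y ∈ J, y ∉ I ∧ Δ.Kept e G (insert y I) := by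
  rw [← he.encard_union hI, ← he.encard_union hJ] at hlt
  obtain ⟨b, ⟨hb | ⟨h, hh, rfl⟩, hbn⟩, hb'⟩ := hG.augment hH hlt
  · exact Or.inr ⟨b, hb, fun h => hbn (Or.inl h), by simpa [Kept, Set.insert_union] using hb'⟩
  · refine Or.inl ⟨h, hh, fun hG' => hbn (Or.inr ⟨h, hG', rfl⟩), ?_⟩
    simpa [Kept, Set.image_insert_eq, Set.union_insert] using hb'

theorem eq_image (he : Δ.IsEnum e) {S : Set α} (hS : S ⊆ Δ.B) :
    ∃ G : Finset (Fin 4), S = e '' G := by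
  classical
  refine ⟨Finset.univ.filter fun i => e i ∈ S, ?_⟩
  ext b
  constructor
  · intro hb
    obtain ⟨i, rfl⟩ := he.range.symm ▸ hS hb
    exact ⟨i, by simpa using hb, rfl⟩
  · rintro ⟨i, hi, rfl⟩
    simpa using hi

theorem gam_indep_image (he : Δ.IsEnum e) (hI : Δ.Outer I) :
    (Δ.Gam I).Indep (e '' G) ↔ Δ.Kept e G I := by
  rw [gam_indep_iff Δ hI, Set.union_comm, and_iff_right (he.image_subset G), Kept]

/-- An outer set extends to a base by elements of the given base. -/
theorem exists_kept (he : Δ.IsEnum e) (hr : Δ.M.eRank = 4) (hI : Δ.Outer I) :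
    ∃ G : Finset (Fin 4), Δ.Kept e G I ∧ I.encard + G.card = 4 ∧ Δ.M.IsBase (I ∪ e '' G) := by
  obtain ⟨B', hB', hIB', hB'I⟩ := hI.1.exists_isBase_subset_union_isBase Δ.isBase
  obtain ⟨G, hG⟩ := he.eq_image (S := B' \ I) fun b hb => (hB'I hb.1).resolve_left hb.2
  have hu : I ∪ e '' G = B' := by rw [← hG, Set.union_sdiff_cancel hIB']
  have hK : Δ.M.IsBase (I ∪ e '' G) := by rw [hu]; exact hB'
  refine ⟨G, hK.indep, ?_, hK⟩
  rw [← he.encard_union hI.2, hK.encard_eq_eRank, hr]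

theorem ncard_add (he : Δ.IsEnum e) (hr : Δ.M.eRank = 4) (hI : Δ.Outer I) :
    ∃ G : Finset (Fin 4), Δ.Kept e G I ∧ I.ncard + G.card = 4 := by
  obtain ⟨G, hG, hc, -⟩ := he.exists_kept hr hI
  refine ⟨G, hG, ?_⟩
  rw [← hI.finite.cast_ncard_eq] at hc
  exact_mod_cast hc

theorem card_le (he : Δ.IsEnum e) (hr : Δ.M.eRank = 4) (hI : Δ.Outer I) (hG : Δ.Kept e G I) :
    I.ncard + G.card ≤ 4 := by
  have h := Matroid.Indep.encard_le_eRank hG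
  rw [he.encard_union hI.2, hr, ← hI.finite.cast_ncard_eq] at h
  exact_mod_cast h

theorem rankNat_gam (he : Δ.IsEnum e) (hr : Δ.M.eRank = 4) (hI : Δ.Outer I) :
    I.ncard + rankNat (Δ.Gam I) = 4 := by
  obtain ⟨G, hG, hc⟩ := he.ncard_add hr hI
  obtain ⟨S, hS, hGS⟩ := ((he.gam_indep_image hI).2 hG).exists_isBase_superset
  have hSi := hS.indep
  obtain ⟨H, rfl⟩ := he.eq_image ((gam_indep_iff Δ hI _).1 hSi).1
  have h1 := he.card_le hr hI ((he.gam_indep_image hI).1 hSi)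
  have h2 : G.card ≤ H.card := by
    have := Set.encard_le_encard hGS
    rw [he.inj.encard_image, he.inj.encard_image, Set.encard_coe_eq_coe_finsetCard,
      Set.encard_coe_eq_coe_finsetCard] at this
    exact_mod_cast this
  have h3 : rankNat (Δ.Gam I) = H.card := by
    rw [rankNat, ← hS.encard_eq_eRank, he.inj.encard_image, Set.encard_coe_eq_coe_finsetCard]
    rfl
  omega

open scoped Classical in
theorem fNumber_gam (he : Δ.IsEnum e) (hI : Δ.Outer I) (k : ℕ) :
    fNumber (Δ.Gam I) k = ((Finset.powersetCard k Finset.univ).filter fun G => Δ.Kept e G I).card := by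
  rw [fNumber, ← Set.ncard_coe_finset, ← Set.ncard_image_of_injective _
    (f := fun G : Finset (Fin 4) => e '' (G : Set (Fin 4)))
    ((Set.image_injective.2 he.inj).comp Finset.coe_injective)]
  congr 1
  ext S
  constructor
  · rintro ⟨hS, hk⟩
    obtain ⟨G, rfl⟩ := he.eq_image ((gam_indep_iff Δ hI _).1 hS).1
    refine ⟨G, ?_, rfl⟩
    rw [Set.ncard_image_of_injective _ he.inj, Set.ncard_coe_finset] at hk
    simpa [hk] using (he.gam_indep_image hI).1 hS
  · rintro ⟨G, hG, rfl⟩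
    simp only [Finset.coe_filter, Finset.mem_powersetCard_univ, Set.mem_ofPred_eq] at hG
    refine ⟨(he.gam_indep_image hI).2 hG.2, ?_⟩
    rw [Set.ncard_image_of_injective _ he.inj, Set.ncard_coe_finset, hG.1]

theorem nb_eq_fNumber (he : Δ.IsEnum e) (hr : Δ.M.eRank = 4) (hx : Δ.Outer {x}) :
    Δ.nb x = fNumber (Δ.Gam {x}) 3 := by
  have hrk := he.rankNat_gam hr hx
  rw [Set.ncard_singleton] at hrk
  rw [nb, fNumber]
  congr 1
  ext S
  have hfin : ∀ S, (Δ.Gam {x}).Indep S → S.Finite := fun S hS =>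
    (Δ.finite.subset Δ.isBase.subset_ground).subset ((gam_indep_iff Δ hx _).1 hS).1
  have hrank : (Δ.Gam {x}).eRank = 3 := by
    obtain ⟨S, hS⟩ := (Δ.Gam {x}).exists_isBase
    have h := hS.encard_eq_eRank
    rw [← (hfin S hS.indep).cast_ncard_eq] at h
    have h' : rankNat (Δ.Gam {x}) = S.ncard := by rw [rankNat, ← h]; rfl
    rw [← h, ← h', show rankNat (Δ.Gam {x}) = 3 by omega]; rfl
  constructor
  · intro (hS : (Δ.Gam {x}).IsBase S)
    refine ⟨hS.indep, ?_⟩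
    rw [Set.ncard_def, hS.encard_eq_eRank, hrank]; rfl
  · rintro ⟨hS, hc⟩
    refine hS.isBase_of_eRk_ge (hfin S hS) ?_
    rw [hS.eRk_eq_encard, hrank, ← (hfin S hS).cast_ncard_eq, hc]; rfl

end IsEnum

/-! ### The bits of a based matroid -/

open scoped Classical in
/-- The base elements that can be exchanged for `x`. -/
noncomputable def rowBits (Δ : BasedMatroid α) (e : Fin 4 → α) (x : α) : Quad :=
  Quad.of fun i => decide (Δ.Kept e {i}ᶜ {x})

open scoped Classical in
/-- The pairs of base elements that can be exchanged for `x` and `y`. -/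
noncomputable def pairBits (Δ : BasedMatroid α) (e : Fin 4 → α) (x y : α) : Hex :=
  Hex.of fun i j => decide (i ≠ j ∧ Δ.Kept e {i, j}ᶜ {x, y})

open scoped Classical in
/-- The base elements that complete `x`, `y`, `z` to a base. -/
noncomputable def tripleBits (Δ : BasedMatroid α) (e : Fin 4 → α) (x y z : α) : Quad :=
  Quad.of fun i => decide (Δ.Kept e {i} {x, y, z})

theorem rowBits_get {i : Fin 4} : (Δ.rowBits e x).get i = true ↔ Δ.Kept e {i}ᶜ {x} := by
  simp [rowBits, Quad.get_of]

theorem tripleBits_get {i : Fin 4} :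
    (Δ.tripleBits e x y z).get i = true ↔ Δ.Kept e {i} {x, y, z} := by
  simp [tripleBits, Quad.get_of]

theorem pairBits_get {i j : Fin 4} :
    (Δ.pairBits e x y).get i j = true ↔ i ≠ j ∧ Δ.Kept e {i, j}ᶜ {x, y} := by
  rw [pairBits, Hex.get_of]
  · simp
  · intro i j
    exact decide_eq_decide.2 (by rw [ne_comm, Finset.pair_comm])
  · intro i
    simp

theorem pairBits_comm : Δ.pairBits e x y = Δ.pairBits e y x := by
  rw [pairBits, pairBits, Set.pair_comm]

end BasedMatroid

namespace Fin4

theorem card_compl_singleton (i : Fin 4) : ({i}ᶜ : Finset (Fin 4)).card = 3 := by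
  revert i; decide

theorem card_compl_pair {i j : Fin 4} (h : i ≠ j) : ({i, j}ᶜ : Finset (Fin 4)).card = 2 := by
  revert i j; decide

theorem card_compl_triple {i j k : Fin 4} (hij : i ≠ j) (hik : i ≠ k) (hjk : j ≠ k) :
    ({i, j, k}ᶜ : Finset (Fin 4)).card = 1 := by
  revert i j k; decide

theorem exists_eq_compl_singleton {G : Finset (Fin 4)} (h : G.card = 3) : ∃ i, G = {i}ᶜ := by
  revert G; decide

theorem exists_eq_compl_pair {G : Finset (Fin 4)} (h : G.card = 2) :
    ∃ i j, i ≠ j ∧ G = {i, j}ᶜ := by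
  revert G; decide

end Fin4

namespace BasedMatroid

variable {α : Type u} {Δ : BasedMatroid α} {e : Fin 4 → α} {x y z : α}

theorem Outer.notMem_of_mem {I : Set α} (hI : Δ.Outer I) (hx : x ∈ I) : Disjoint {x} Δ.B :=
  Set.disjoint_singleton_left.2 (Set.disjoint_left.1 hI.2 hx)

theorem Outer.pair_left (h : Δ.Outer {x, y}) : Δ.Outer {x} := h.subset (by simp)
theorem Outer.pair_right (h : Δ.Outer {x, y}) : Δ.Outer {y} := h.subset (by simp)

/-! ### Exchange relations between the bits -/

namespace IsEnum

theorem rowBits_nonzero (he : Δ.IsEnum e) (hr : Δ.M.eRank = 4) (hx : Δ.Outer {x}) :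
    (Δ.rowBits e x).nonzero = true := by
  obtain ⟨G, hG, hc⟩ := he.ncard_add hr hx
  rw [Set.ncard_singleton] at hc
  obtain ⟨i, rfl⟩ := Fin4.exists_eq_compl_singleton (by omega : G.card = 3)
  exact Quad.nonzero_of_get (rowBits_get.2 hG)

theorem tripleBits_nonzero (he : Δ.IsEnum e) (hr : Δ.M.eRank = 4) (h : Δ.Outer {x, y, z})
    (hxy : x ≠ y) (hxz : x ≠ z) (hyz : y ≠ z) : (Δ.tripleBits e x y z).nonzero = true := by
  obtain ⟨G, hG, hc⟩ := he.ncard_add hr h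
  rw [Set.ncard_eq_three.2 ⟨x, y, z, hxy, hxz, hyz, rfl⟩] at hc
  obtain ⟨i, rfl⟩ := Finset.card_eq_one.1 (by omega : G.card = 1)
  exact Quad.nonzero_of_get (tripleBits_get.2 hG)

/-- A minor `x_i y_j - x_j y_i` with a zero entry has at most one nonzero term, so it vanishes
exactly when both products do; cancellation requires all four entries to be nonzero. The three
auxiliary facts, applied with `x, y` and `i, j` exchanged as needed, decide every such case. -/
theorem hexForced (he : Δ.IsEnum e) (h : Δ.Outer {x, y}) (hxy : x ≠ y) :
    HexForced (Δ.rowBits e x) (Δ.rowBits e y) (Δ.pairBits e x y) := by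
  have key1 : ∀ {x y} (h : Δ.Outer {x, y}) (hxy : x ≠ y) (i j), i ≠ j → Δ.Kept e {i}ᶜ {x} →
      Δ.Kept e {j}ᶜ {y} → ¬ Δ.Kept e {j}ᶜ {x} → Δ.Kept e {i, j}ᶜ {x, y} := by
    intro x y h hxy i j hij hi hj hn
    have h1 : Δ.Kept e {i, j}ᶜ {x} := hi.mono (by simp) subset_rfl
    rcases he.augment h1 hj h.pair_left.2 h.pair_right.2
      (by
        rw [Fin4.card_compl_pair hij, Fin4.card_compl_singleton, Set.encard_singleton,
          Set.encard_singleton]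
        norm_num) with ⟨k, hk, hk', hK⟩ | ⟨w, rfl, -, hK⟩
    -- The added base element can only be the `i`-th one, which would put `j` into the row of `x`.
    · refine absurd hK ?_
      have : insert k ({i, j}ᶜ : Finset (Fin 4)) = {j}ᶜ := by
        clear hn hj hi hK h1; revert i j k; decide
      rwa [this]
    · rwa [Set.pair_comm] at hK
  -- A nonzero minor has no zero line: here for the entries of `x`, and in `key3` for the entries at
  -- `i`.
  have key2 : ∀ {x y} (h : Δ.Outer {x, y}) (hxy : x ≠ y) (i j), i ≠ j → Δ.Kept e {i, j}ᶜ {x, y} →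
      Δ.Kept e {i}ᶜ {x} ∨ Δ.Kept e {j}ᶜ {x} := by
    intro x y h hxy i j hij hK
    rcases he.augment (hK.mono subset_rfl (J := {x}) (by simp)) he.kept_univ h.pair_left.2
      (Set.empty_disjoint _)
      (by
        rw [Fin4.card_compl_pair hij, Set.encard_singleton, Set.encard_empty, Finset.card_univ,
          Fintype.card_fin]
        norm_num) with ⟨k, hk, hk', hK'⟩ | ⟨w, hw, -⟩
    · have : k = i ∧ insert k ({i, j}ᶜ : Finset (Fin 4)) = {j}ᶜ ∨
          k = j ∧ insert k ({i, j}ᶜ : Finset (Fin 4)) = {i}ᶜ := by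
        clear hK hK'; revert i j k; decide
      rcases this with ⟨-, h⟩ | ⟨-, h⟩ <;> rw [h] at hK'
      exacts [Or.inr hK', Or.inl hK']
    · exact absurd hw (by simp)
  have key3 : ∀ i j, i ≠ j → Δ.Kept e {i, j}ᶜ {x, y} →
      Δ.Kept e {i}ᶜ {x} ∨ Δ.Kept e {i}ᶜ {y} := by
    intro i j hij hK
    have h0 : Δ.Kept e {i}ᶜ ∅ := he.kept_univ.mono (by simp) subset_rfl
    rcases he.augment h0 hK (Set.empty_disjoint _) h.2
      (by
        rw [Fin4.card_compl_pair hij, Fin4.card_compl_singleton, Set.encard_empty,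
          Set.encard_pair hxy]
        norm_num) with ⟨k, hk, hk', -⟩ | ⟨w, hw, -, hK'⟩
    · exact absurd (Finset.compl_subset_compl.2 (by simp) hk) hk'
    · rcases hw with rfl | rfl
      · exact Or.inl (by rwa [insert_empty_eq] at hK')
      · exact Or.inr (by rwa [insert_empty_eq] at hK')
  intro i j hij
  have k1 := key1 h hxy i j hij
  have k1' := key1 h hxy j i hij.symm
  have h' := h
  rw [Set.pair_comm] at h'
  have k2 := key1 h' hxy.symm i j hij
  have k2' := key1 h' hxy.symm j i hij.symm
  have k3 := key2 h hxy i j hij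
  have k4 := key2 h' hxy.symm i j hij
  have k5 := key3 i j hij
  have k5' := key3 j i hij.symm
  rw [Set.pair_comm y x] at k2 k2' k4
  rw [Finset.pair_comm j i] at k1' k2' k5'
  have e1 := pairBits_get (Δ := Δ) (e := e) (x := x) (y := y) (i := i) (j := j)
  rw [and_iff_right hij] at e1
  rw [← e1] at k1 k1' k2 k2' k3 k4 k5 k5'
  simp only [← rowBits_get] at k1 k1' k2 k2' k3 k4 k5 k5'
  rw [forcedBit]
  revert k1 k1' k2 k2' k3 k4 k5 k5'
  generalize (Δ.rowBits e x).get i = a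
  generalize (Δ.rowBits e x).get j = b
  generalize (Δ.rowBits e y).get i = c
  generalize (Δ.rowBits e y).get j = d
  generalize (Δ.pairBits e x y).get i j = p
  cases a <;> cases b <;> cases c <;> cases d <;> cases p <;> simp

/-- The pairs are the bases of the dual of `Γ_{x,y}`, a matroid of rank two. An index `k` in either
row is a nonloop of it, hence not parallel to both members of a base. -/
theorem hexTrans (he : Δ.IsEnum e) (hr : Δ.M.eRank = 4) (h : Δ.Outer {x, y}) (hxy : x ≠ y) :
    hexTrans (Δ.rowBits e x) (Δ.rowBits e y) (Δ.pairBits e x y) = true := by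
  have key : ∀ {w} (_ : w ∈ ({x, y} : Set α)) (i j k), i ≠ j → Δ.Kept e {i, j}ᶜ {x, y} →
      Δ.Kept e {k}ᶜ {w} → (i ≠ k ∧ Δ.Kept e {i, k}ᶜ {x, y}) ∨ (j ≠ k ∧ Δ.Kept e {j, k}ᶜ {x, y}) := by
    intro w hw i j k hij hK hk
    by_cases hik : i = k
    · subst hik
      exact Or.inr ⟨hij.symm, by rwa [Finset.pair_comm]⟩
    by_cases hjk : j = k
    · subst hjk
      exact Or.inl ⟨hij, hK⟩
    -- Augmenting this set from the base in which `w` replaces `k` can only add `i` or `j`, since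
    -- `w` is already present and `k` is missing from that base.
    have h1 : Δ.Kept e {i, j, k}ᶜ {x, y} := hK.mono (by
      clear hK hk; revert i j k; decide) subset_rfl
    rcases he.augment h1 hk h.2 (h.notMem_of_mem hw)
      (by
        rw [Fin4.card_compl_triple hij hik hjk, Fin4.card_compl_singleton, Set.encard_singleton,
          Set.encard_pair hxy]
        norm_num) with ⟨l, hl, hl', hK'⟩ | ⟨v, rfl, hv, -⟩
    · have : insert l ({i, j, k}ᶜ : Finset (Fin 4)) = {i, k}ᶜ ∨
          insert l ({i, j, k}ᶜ : Finset (Fin 4)) = {j, k}ᶜ := by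
        clear hK hk h1 hK'; revert i j k l; decide
      rcases this with h | h <;> rw [h] at hK'
      exacts [Or.inl ⟨hik, hK'⟩, Or.inr ⟨hjk, hK'⟩]
    · exact absurd hw hv
  simp only [_root_.hexTrans, Bool.and_eq_true, allIdx_iff, anyIdx_iff, Bool.or_eq_true,
    Bool.not_eq_true', ← Bool.not_eq_true, pairBits_get, rowBits_get]
  refine ⟨fun i j => ?_, ?_⟩
  · by_cases hij : i ≠ j ∧ Δ.Kept e {i, j}ᶜ {x, y}
    · refine Or.inr fun k => ?_
      by_cases hk : Δ.Kept e {k}ᶜ {x} ∨ Δ.Kept e {k}ᶜ {y}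
      · rw [or_assoc]
        refine Or.inr ?_
        rcases hk with hk | hk
        · exact key (by simp) i j k hij.1 hij.2 hk
        · exact key (by simp) i j k hij.1 hij.2 hk
      · exact Or.inl (Or.inl hk)
    · exact Or.inl hij
  · obtain ⟨G, hG, hc⟩ := he.ncard_add hr h
    rw [Set.ncard_pair hxy] at hc
    obtain ⟨i, j, hij, rfl⟩ := Fin4.exists_eq_compl_pair (by omega : G.card = 2)
    exact ⟨i, j, hij, hG⟩

/-- After contraction of `x` and `y`, the base elements not in the triple bits are the loops and the
elements parallel to `z`, so they form a flat of `Γ_{x,y}`. The complement of a flat is a union of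
cocircuits, that is, of circuits of the dual, whose bases are the pairs. -/
theorem hexQuad (he : Δ.IsEnum e) (h : Δ.Outer {x, y, z})
    (hxy : x ≠ y) (hxz : x ≠ z) (hyz : y ≠ z) :
    hexQuad (Δ.pairBits e x y) (Δ.tripleBits e x y z) = true := by
  have h2 : Δ.Outer {x, y} := h.subset (by intro a; simp; tauto)
  have c3 : ({x, y, z} : Set α).encard = 3 := by
    rw [Set.encard_eq_three]; exact ⟨x, y, z, hxy, hxz, hyz, rfl⟩
  have c2 := Set.encard_pair hxy
  simp only [_root_.hexQuad, allIdx_iff, anyIdx_iff, Bool.or_eq_true, Bool.and_eq_true,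
    Bool.not_eq_true', ← Bool.not_eq_true, pairBits_get, tripleBits_get, bne_iff_ne]
  intro i
  by_cases hi : Δ.Kept e {i} {x, y, z}
  swap
  · exact Or.inl hi
  refine Or.inr fun j => ?_
  by_cases hij : i ≠ j ∧ Δ.Kept e {i, j}ᶜ {x, y}
  swap
  · exact Or.inl hij
  obtain ⟨hij, hP⟩ := hij
  refine Or.inr ?_
  obtain ⟨c, d, hic, hid, hjc, hjd, hcd, hcomp, hc1, hc2⟩ : ∃ c d, i ≠ c ∧ i ≠ d ∧ j ≠ c ∧ j ≠ d ∧ c ≠ d ∧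
      ({i, j}ᶜ : Finset (Fin 4)) = {c, d} ∧ ({i, d} : Finset (Fin 4)) = {c, j}ᶜ ∧
      ({i, c} : Finset (Fin 4)) = {d, j}ᶜ := by
    clear hP hi; revert i j; decide
  rw [hcomp] at hP
  have kz : Δ.Kept e {c} {x, y, z} ∨ Δ.Kept e {d} {x, y, z} := by
    rcases he.augment h.kept_empty hP h.2 h2.2 (by
      simp [c3, c2, Finset.card_pair hcd]; norm_num) with ⟨k, hk, -, hK⟩ | ⟨v, hv, hv', -⟩
    · rw [insert_empty_eq] at hK
      simp only [Finset.mem_insert, Finset.mem_singleton] at hk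
      rcases hk with rfl | rfl
      exacts [Or.inl hK, Or.inr hK]
    · exact absurd (by rcases hv with rfl | rfl <;> simp) hv'
  have ki : Δ.Kept e {i, c} {x, y} ∨ Δ.Kept e {i, d} {x, y} := by
    rcases he.augment (hi.mono subset_rfl (J := {x, y}) (by intro a; simp; tauto)) hP h2.2 h2.2 (by
      simp [c2, Finset.card_pair hcd]) with ⟨k, hk, -, hK⟩ | ⟨v, hv, hv', -⟩
    · rw [Finset.pair_comm] at hK
      simp only [Finset.mem_insert, Finset.mem_singleton] at hk
      rcases hk with rfl | rfl
      exacts [Or.inl hK, Or.inr hK]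
    · exact absurd hv hv'
  have kc : ∀ c, c ≠ i → Δ.Kept e {c} {x, y} → Δ.Kept e {c} {x, y, z} ∨ Δ.Kept e {i, c} {x, y} := by
    intro c hci hK
    rcases he.augment hK hi h2.2 h.2 (by simp [c2, c3]; norm_num) with
      ⟨k, hk, -, hK⟩ | ⟨v, hv, hv', hK⟩
    · rw [Finset.mem_singleton] at hk
      subst hk
      exact Or.inr hK
    · have : v = z := by
        simp only [Set.mem_insert_iff, Set.mem_singleton_iff] at hv hv'
        tauto
      subst this
      refine Or.inl (hK.mono subset_rfl ?_)
      intro a; simp; tauto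
  have kc1 := kc c hic.symm (hP.mono (by simp) subset_rfl)
  have kc2 := kc d hid.symm (hP.mono (by simp) subset_rfl)
  rw [hc1, hc2] at ki
  rw [hc2] at kc1
  rw [hc1] at kc2
  -- Modulo `x` and `y`, the elements `c` and `d` form a base, so one of them completes the triple.
  -- If `c` does but `i` is parallel to `d`, then `d` completes it too and `i`, `c` are independent;
  -- symmetrically for `d`.
  rcases kz with h1 | h1
  · rcases ki with h3 | h3
    · rcases kc2 with h4 | h4
      · exact ⟨d, hid, h4, hjd.symm, h3⟩
      · exact ⟨c, hic, h1, hjc.symm, h4⟩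
    · exact ⟨c, hic, h1, hjc.symm, h3⟩
  · rcases ki with h3 | h3
    · exact ⟨d, hid, h1, hjd.symm, h3⟩
    · rcases kc1 with h4 | h4
      · exact ⟨c, hic, h4, hjc.symm, h3⟩
      · exact ⟨d, hid, h1, hjd.symm, h4⟩

/-- Contract the base elements other than `i` and `j`. In rank two, `x` and `z` are independent and
`y` is not a loop, so `y` is not parallel to both. -/
theorem hexesTrans (he : Δ.IsEnum e) (h : Δ.Outer {x, y, z})
    (hxy : x ≠ y) (hxz : x ≠ z) (hyz : y ≠ z) :
    hexesTrans (Δ.rowBits e y) (Δ.pairBits e x y) (Δ.pairBits e x z) (Δ.pairBits e y z) = true := by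
  have h2 : Δ.Outer {x, z} := h.subset (by intro a; simp; tauto)
  have h1 : Δ.Outer {y} := h.subset (by simp)
  simp only [_root_.hexesTrans, allIdx_iff, Bool.or_eq_true, Bool.and_eq_true,
    Bool.not_eq_true', ← Bool.not_eq_true, pairBits_get, rowBits_get]
  intro i j
  by_cases hi : Δ.Kept e {i}ᶜ {y} ∧ i ≠ j ∧ Δ.Kept e {i, j}ᶜ {x, z}
  swap
  · exact Or.inl (Or.inl hi)
  obtain ⟨hi, hij, hP⟩ := hi
  rcases he.augment (hi.mono (H := {i, j}ᶜ) (by simp) subset_rfl) hP h1.2 h2.2 (by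
      rw [Fin4.card_compl_pair hij, Set.encard_pair hxz, Set.encard_singleton]
      norm_num) with ⟨k, hk, hk', -⟩ | ⟨v, hv, -, hK⟩
  · exact absurd hk hk'
  · rcases hv with rfl | rfl
    · exact Or.inl (Or.inr ⟨hij, hK⟩)
    · exact Or.inr ⟨hij, by rwa [Set.pair_comm] at hK⟩

/-- Augment the base elements other than `j` and `k` twice from the base formed by `x`, `y`, `z` and
the `i`-th base element. As `i` is already there, both new elements are among `x`, `y`, `z`. -/
theorem hexesQuad (he : Δ.IsEnum e) (h : Δ.Outer {x, y, z})
    (hxy : x ≠ y) (hxz : x ≠ z) (hyz : y ≠ z) :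
    hexesQuad (Δ.pairBits e x y) (Δ.pairBits e x z) (Δ.pairBits e y z)
      (Δ.tripleBits e x y z) = true := by
  have c3 : ({x, y, z} : Set α).encard = 3 := by
    rw [Set.encard_eq_three]; exact ⟨x, y, z, hxy, hxz, hyz, rfl⟩
  simp only [_root_.hexesQuad, allIdx_iff, Bool.or_eq_true,
    Bool.not_eq_true', ← Bool.not_eq_true, pairBits_get, tripleBits_get, beq_iff_eq]
  intro i
  by_cases hi : Δ.Kept e {i} {x, y, z}
  swap
  · exact Or.inl hi
  refine Or.inr fun j k => ?_
  by_cases hij : i = j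
  · tauto
  by_cases hik : i = k
  · tauto
  by_cases hjk : j = k
  · tauto
  have h0 : Δ.Kept e {j, k}ᶜ ∅ := he.kept_univ.mono (by simp) subset_rfl
  have hmem : ∀ l ∈ ({i} : Finset (Fin 4)), l ∈ ({j, k}ᶜ : Finset (Fin 4)) := by
    simp [hij, hik]
  rcases he.augment h0 hi (Set.empty_disjoint _) h.2 (by
      rw [Fin4.card_compl_pair hjk, c3, Set.encard_empty, Finset.card_singleton]; norm_num) with
    ⟨l, hl, hl', -⟩ | ⟨v, hv, -, hK⟩
  · exact absurd (hmem l hl) hl'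
  rw [insert_empty_eq] at hK
  rcases he.augment hK hi (h.notMem_of_mem hv) h.2 (by
      rw [Fin4.card_compl_pair hjk, c3, Set.encard_singleton, Finset.card_singleton]; norm_num) with
    ⟨l, hl, hl', -⟩ | ⟨w, hw, hwv, hK⟩
  · exact absurd (hmem l hl) hl'
  have hK' := hK
  rw [Set.pair_comm] at hK'
  rw [Set.mem_singleton_iff] at hwv
  rcases hv with rfl | rfl | rfl <;> rcases hw with rfl | rfl | rfl <;>
    first
    | exact absurd rfl hwv
    | simp only [hjk, hK, hK', ne_eq, not_false_eq_true, and_self, true_or, or_true]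

end IsEnum

end BasedMatroid

/-! ### `h`-vectors of matroids of small rank -/

section SmallRank

variable {α : Type u} {M : Matroid α}

open Polynomial in
theorem hPoly_natDegree_le (M : Matroid α) : (hPoly M).natDegree ≤ rankNat M := by
  refine natDegree_sum_le_of_forall_le _ _ fun i hi => ?_
  have h1 : (1 - X : ℤ[X]).natDegree ≤ 1 := (natDegree_sub_le _ _).trans (by simp)
  have h2 : ((1 - X : ℤ[X]) ^ (rankNat M - i)).natDegree ≤ rankNat M - i :=
    (natDegree_pow_le_of_le _ h1).trans (by simp)
  have h3 := natDegree_mul_le_of_le (natDegree_C_mul_X_pow_le (fNumber M i : ℤ) i) h2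
  have := Finset.mem_range.1 hi
  exact h3.trans (by omega)

theorem hNumber_eq_zero {j : ℕ} (h : rankNat M < j) : hNumber M j = 0 :=
  Polynomial.coeff_eq_zero_of_natDegree_lt ((hPoly_natDegree_le M).trans_lt h)

/-- The default value `0` is the convention that the `h`-numbers vanish beyond the rank. -/
theorem hNumber_eq_getD (M : Matroid α) (j : ℕ) : hNumber M j = (hVector M).getD j 0 := by
  rw [hVector]
  by_cases h : j ≤ rankNat M
  · rw [List.getD_eq_getElem _ _ (by simpa using h)]
    simp
  · rw [List.getD_eq_default _ _ (by simpa using h)]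
    exact hNumber_eq_zero (by omega)

-- Four coefficients suffice for `Γ_I` with `I` nonempty, whose rank is at most three.
open Polynomial in
theorem hVector_eq_of_hPoly_eq (a b c d : ℤ)
    (h : hPoly M = C a + C b * X + C c * X ^ 2 + C d * X ^ 3) :
    hVector M = (List.range (rankNat M + 1)).map fun j => [a, b, c, d].getD j 0 := by
  refine List.map_congr_left fun j _ => ?_
  rw [hNumber, h]
  simp only [coeff_add, coeff_C_mul, coeff_X_pow, coeff_X, coeff_C]
  rcases j with _ | _ | _ | _ | j <;> simp

open Polynomial in
theorem hVector_of_rankNat_zero (hr : rankNat M = 0) : hVector M = [(fNumber M 0 : ℤ)] := by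
  rw [hVector_eq_of_hPoly_eq (fNumber M 0) 0 0 0 (by simp [hPoly, hr]), hr]
  rfl

open Polynomial in
theorem hVector_of_rankNat_one (hr : rankNat M = 1) :
    hVector M = [(fNumber M 0 : ℤ), fNumber M 1 - fNumber M 0] := by
  rw [hVector_eq_of_hPoly_eq (fNumber M 0) (fNumber M 1 - fNumber M 0) 0 0 ?_, hr]
  · rfl
  · simp only [hPoly, hr, Finset.sum_range_succ, Finset.sum_range_zero, map_sub, map_zero]
    ring

open Polynomial in
theorem hVector_of_rankNat_two (hr : rankNat M = 2) :
    hVector M = [(fNumber M 0 : ℤ), fNumber M 1 - 2 * fNumber M 0,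
      fNumber M 2 - fNumber M 1 + fNumber M 0] := by
  rw [hVector_eq_of_hPoly_eq (fNumber M 0) (fNumber M 1 - 2 * fNumber M 0)
    (fNumber M 2 - fNumber M 1 + fNumber M 0) 0 ?_, hr]
  · rfl
  · simp only [hPoly, hr, Finset.sum_range_succ, Finset.sum_range_zero, map_sub, map_add, map_mul,
      map_ofNat, map_zero]
    ring

open Polynomial in
theorem hVector_of_rankNat_three (hr : rankNat M = 3) :
    hVector M = [(fNumber M 0 : ℤ), fNumber M 1 - 3 * fNumber M 0,
      fNumber M 2 - 2 * fNumber M 1 + 3 * fNumber M 0,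
      fNumber M 3 - fNumber M 2 + fNumber M 1 - fNumber M 0] := by
  rw [hVector_eq_of_hPoly_eq (fNumber M 0) (fNumber M 1 - 3 * fNumber M 0)
    (fNumber M 2 - 2 * fNumber M 1 + 3 * fNumber M 0)
    (fNumber M 3 - fNumber M 2 + fNumber M 1 - fNumber M 0) ?_, hr]
  · rfl
  · simp only [hPoly, hr, Finset.sum_range_succ, Finset.sum_range_zero, map_sub, map_add, map_mul,
      map_ofNat]
    ring

end SmallRank

/-! ### Counting the subsets of `Fin 4` of a given size -/

namespace Fin4

theorem card_filter_powersetCard_one (P : Finset (Fin 4) → Prop) [DecidablePred P] :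
    ((Finset.powersetCard 1 Finset.univ).filter P).card =
      (Finset.univ.filter fun i : Fin 4 => P {i}).card := by
  have : Finset.powersetCard 1 Finset.univ = Finset.univ.image fun i : Fin 4 => ({i} : Finset _) := by
    decide
  rw [this, Finset.filter_image, Finset.card_image_of_injective _ Finset.singleton_injective]

theorem card_filter_powersetCard_three (P : Finset (Fin 4) → Prop) [DecidablePred P] :
    ((Finset.powersetCard 3 Finset.univ).filter P).card =
      (Finset.univ.filter fun i : Fin 4 => P {i}ᶜ).card := by
  have : Finset.powersetCard 3 Finset.univ =
      Finset.univ.image fun i : Fin 4 => ({i}ᶜ : Finset _) := by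
    decide
  rw [this, Finset.filter_image, Finset.card_image_of_injective]
  exact compl_injective.comp Finset.singleton_injective

/-- Representatives of the two-element subsets. -/
def pairs : Finset (Fin 4 × Fin 4) := {(0, 1), (0, 2), (0, 3), (1, 2), (1, 3), (2, 3)}

theorem card_filter_powersetCard_two (P : Finset (Fin 4) → Prop) [DecidablePred P] :
    ((Finset.powersetCard 2 Finset.univ).filter P).card =
      (pairs.filter fun p => P {p.1, p.2}ᶜ).card := by
  have : Finset.powersetCard 2 Finset.univ =
      pairs.image fun p : Fin 4 × Fin 4 => ({p.1, p.2}ᶜ : Finset _) := by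
    decide
  rw [this, Finset.filter_image, Finset.card_image_of_injOn]
  have : Set.InjOn (fun p : Fin 4 × Fin 4 => ({p.1, p.2}ᶜ : Finset _)) pairs := by
    have : ∀ p ∈ pairs, ∀ q ∈ pairs, ({p.1, p.2}ᶜ : Finset (Fin 4)) = {q.1, q.2}ᶜ → p = q := by
      decide
    exact fun p hp q hq h => this p hp q hq h
  exact this.mono (Finset.coe_subset.2 (Finset.filter_subset _ _))

end Fin4

namespace Hex

theorem card_filter_get (h : Hex) :
    (Fin4.pairs.filter fun p => h.get p.1 p.2 = true).card = h.count := by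
  obtain ⟨a, b, c, d, e, f⟩ := h
  cases a <;> cases b <;> cases c <;> cases d <;> cases e <;> cases f <;> rfl

/-- The indices avoided by some pair of the set. -/
def avoidedBits (h : Hex) : Quad :=
  ⟨h.p12 || h.p13 || h.p23, h.p02 || h.p03 || h.p23, h.p01 || h.p03 || h.p13,
    h.p01 || h.p02 || h.p12⟩

theorem avoidedBits_get (h : Hex) (i : Fin 4) :
    h.avoidedBits.get i = true ↔ ∃ j k, h.get j k = true ∧ i ≠ j ∧ i ≠ k := by
  obtain ⟨a, b, c, d, e, f⟩ := h
  cases a <;> cases b <;> cases c <;> cases d <;> cases e <;> cases f <;> revert i <;> decide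

end Hex

namespace BasedMatroid

variable {α : Type u} {Δ : BasedMatroid α} {e : Fin 4 → α} {x y z : α} {I : Set α}

/-- The total order of the algorithm makes distinct outer elements comparable. -/
theorem prec_total (hx : Δ.Outer {x}) (hy : Δ.Outer {y}) (hxy : x ≠ y) :
    Δ.prec x y ∨ Δ.prec y x := by
  have h := Δ.lt_total x (hx.subset_diff rfl) y (hy.subset_diff rfl) hxy
  rcases lt_trichotomy (Δ.nb x) (Δ.nb y) with h' | h' | h'
  · exact Or.inl (Or.inl h')
  · exact h.imp (fun h => Or.inr ⟨h', h⟩) fun h => Or.inr ⟨h'.symm, h⟩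
  · exact Or.inr (Or.inl h')

theorem prec_irrefl : ¬ Δ.prec x x := by
  rintro (h | ⟨-, h⟩)
  exacts [h.ne rfl, Δ.lt_irrefl x h]

theorem prec_trans (h₁ : Δ.prec x y) (h₂ : Δ.prec y z) : Δ.prec x z := by
  rcases h₁ with h₁ | ⟨h₁, h₁'⟩ <;> rcases h₂ with h₂ | ⟨h₂, h₂'⟩
  · exact Or.inl (h₁.trans h₂)
  · exact Or.inl (h₁.trans_eq h₂)
  · exact Or.inl (h₁.trans_lt h₂)
  · exact Or.inr ⟨h₁.trans h₂, Δ.lt_trans x y z h₁' h₂'⟩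

theorem prec.ne (h : Δ.prec x y) : x ≠ y := fun hxy => prec_irrefl (hxy ▸ h)

theorem prec.asymm (h : Δ.prec x y) : ¬ Δ.prec y x := fun h' => prec_irrefl (prec_trans h h')

theorem prec.nb_le (h : Δ.prec x y) : Δ.nb x ≤ Δ.nb y := by
  unfold prec at h
  omega

/-! ### The `h`-vectors of `Γ_I` in terms of the bits -/

namespace IsEnum

theorem fNumber_gam_zero (he : Δ.IsEnum e) (hI : Δ.Outer I) : fNumber (Δ.Gam I) 0 = 1 := by
  rw [he.fNumber_gam hI, Finset.powersetCard_zero, Finset.filter_singleton, if_pos hI.kept_empty,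
    Finset.card_singleton]

theorem nb_eq (he : Δ.IsEnum e) (hr : Δ.M.eRank = 4) (hx : Δ.Outer {x}) :
    Δ.nb x = (Δ.rowBits e x).count := by
  classical
  rw [he.nb_eq_fNumber hr hx, he.fNumber_gam hx, ← Quad.card_filter_get,
    Fin4.card_filter_powersetCard_three]
  simp only [rowBits_get]

theorem hVector_triple (he : Δ.IsEnum e) (hr : Δ.M.eRank = 4) (h : Δ.Outer {x, y, z})
    (hxy : x ≠ y) (hxz : x ≠ z) (hyz : y ≠ z) :
    hVector (Δ.Gam {x, y, z}) = (Δ.tripleBits e x y z).hList := by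
  classical
  have hrk := he.rankNat_gam hr h
  rw [Set.ncard_eq_three.2 ⟨x, y, z, hxy, hxz, hyz, rfl⟩] at hrk
  rw [hVector_of_rankNat_one (by omega), he.fNumber_gam_zero h, Quad.hList, he.fNumber_gam h,
    ← Quad.card_filter_get, Fin4.card_filter_powersetCard_one]
  simp only [tripleBits_get, Nat.cast_one]

theorem hVector_pair (he : Δ.IsEnum e) (hr : Δ.M.eRank = 4) (h : Δ.Outer {x, y}) (hxy : x ≠ y) :
    hVector (Δ.Gam {x, y}) = (Δ.pairBits e x y).hList := by
  classical
  have hrk := he.rankNat_gam hr h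
  have hnc := Set.ncard_pair hxy
  -- A base element is a nonloop of `Γ_{x,y}` exactly when it lies in a base, that is, when the
  -- complementary pair of some base avoids it.
  have h1 : fNumber (Δ.Gam {x, y}) 1 = (Δ.pairBits e x y).avoided := by
    change _ = (Δ.pairBits e x y).avoidedBits.count
    rw [he.fNumber_gam h, Fin4.card_filter_powersetCard_one, ← Quad.card_filter_get]
    congr 1
    refine Finset.filter_congr fun i _ => ?_
    rw [Hex.avoidedBits_get]
    simp only [pairBits_get]
    constructor
    · intro hi
      obtain ⟨G, hG, hc⟩ := he.ncard_add hr h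
      have hG2 : G.card = 2 := by omega
      rcases he.augment hi hG h.2 h.2 (by
        rw [hG2, Set.encard_pair hxy, Finset.card_singleton]; norm_num) with
        ⟨l, -, hl', hK⟩ | ⟨v, hv, hv', -⟩
      · obtain ⟨j, k, hjk, heq⟩ := Fin4.exists_eq_compl_pair
          (Finset.card_pair (Finset.notMem_singleton.1 hl'))
        have hi' : i ∈ ({j, k}ᶜ : Finset (Fin 4)) := by rw [← heq]; simp
        simp only [Finset.mem_compl, Finset.mem_insert, Finset.mem_singleton, not_or] at hi'
        exact ⟨j, k, ⟨hjk, heq ▸ hK⟩, hi'⟩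
      · exact absurd hv hv'
    · rintro ⟨j, k, ⟨-, hK⟩, hij, hik⟩
      exact hK.mono (by simp [hij, hik]) subset_rfl
  have h2 : fNumber (Δ.Gam {x, y}) 2 = (Δ.pairBits e x y).count := by
    rw [he.fNumber_gam h, Fin4.card_filter_powersetCard_two, ← Hex.card_filter_get]
    congr 1
    refine Finset.filter_congr fun p hp => ?_
    have : p.1 ≠ p.2 := by revert p; decide
    rw [pairBits_get, and_iff_right this]
  rw [hVector_of_rankNat_two (by omega), h1, h2, he.fNumber_gam_zero h, Hex.hList]
  simp

/-! ### The span of a set, and the exponents for actual pairs and triples -/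

/-- The base elements that can be exchanged for an element of `I`. -/
noncomputable def span (_ : Δ.IsEnum e) (I : Set α) : Finset (Fin 4) :=
  open scoped Classical in Finset.univ.filter fun i => ∃ x ∈ I, Δ.Kept e {i}ᶜ {x}

theorem mem_span {he : Δ.IsEnum e} {i : Fin 4} :
    i ∈ he.span I ↔ ∃ x ∈ I, Δ.Kept e {i}ᶜ {x} := by
  simp [span]

theorem card_span_singleton (he : Δ.IsEnum e) :
    (he.span {x}).card = (Δ.rowBits e x).count := by
  rw [← Quad.card_filter_get]
  congr 1
  ext i
  simp [mem_span, rowBits_get]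

theorem card_span_pair (he : Δ.IsEnum e) :
    (he.span {x, y}).card = ((Δ.rowBits e x).union (Δ.rowBits e y)).count := by
  rw [← Quad.card_filter_get]
  congr 1
  ext i
  simp [mem_span, Quad.get_union, rowBits_get]

theorem card_span_triple (he : Δ.IsEnum e) :
    (he.span {x, y, z}).card =
      (((Δ.rowBits e x).union (Δ.rowBits e y)).union (Δ.rowBits e z)).count := by
  rw [← Quad.card_filter_get]
  congr 1
  ext i
  simp [mem_span, Quad.get_union, rowBits_get, or_assoc]

/-- An element that can be exchanged for a base element outside the span is independent of `I`. -/
theorem outer_insert (he : Δ.IsEnum e) (hI : Δ.Outer I) (hz : Δ.Outer {z}) {i : Fin 4}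
    (hi : Δ.Kept e {i}ᶜ {z}) (hi' : i ∉ he.span I) : z ∉ I ∧ Δ.Outer (insert z I) := by
  have hzI : z ∉ I := fun h => hi' (mem_span.2 ⟨z, h, hi⟩)
  refine ⟨hzI, ?_, ?_⟩
  · have hb : Δ.M.Indep (e '' ({i}ᶜ : Finset (Fin 4))) := hi.subset Set.subset_union_right
    -- The base without its `i`-th element spans a hyperplane. It contains `I`, as `i` lies in no
    -- row of `I`, but not `z`; hence `z` is not in the closure of `I`.
    have hcl : I ⊆ Δ.M.closure (e '' ({i}ᶜ : Finset (Fin 4))) := by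
      intro x hx
      by_contra hn
      rw [hb.notMem_closure_iff (hI.1.subset_ground hx)] at hn
      refine hi' (mem_span.2 ⟨x, hx, ?_⟩)
      rw [Kept, Set.singleton_union]
      exact hn.1
    have hzn : z ∉ e '' ({i}ᶜ : Finset (Fin 4)) := fun h =>
      (Set.disjoint_singleton_left.1 hz.2) (he.image_subset _ h)
    have hzc : z ∉ Δ.M.closure (e '' ({i}ᶜ : Finset (Fin 4))) := by
      rw [hb.notMem_closure_iff (hz.1.subset_ground rfl)]
      exact ⟨by rwa [Kept, Set.singleton_union] at hi, hzn⟩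
    rw [hI.1.insert_indep_iff_of_notMem hzI]
    exact ⟨hz.1.subset_ground rfl, fun h =>
      hzc (Δ.M.closure_subset_closure_of_subset_closure hcl h)⟩
  · rw [Set.insert_eq, Set.disjoint_union_left]
    exact ⟨hz.2, hI.2⟩

theorem pairGood (he : Δ.IsEnum e) (hr : Δ.M.eRank = 4) (h : Δ.Outer {x, y}) (hxy : Δ.prec x y) :
    PairGood (he.span {x, y}).card (Δ.nb x) (Δ.nb y)
      (pairExponents (hVector (Δ.Gam {x, y})) (Δ.nb x)) ∧
      hVector (Δ.Gam {x, y}) ∈ pairHLists := by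
  have hle := hxy.nb_le
  rw [he.nb_eq hr h.pair_left, he.nb_eq hr h.pair_right] at hle ⊢
  rw [he.card_span_pair, he.hVector_pair hr h hxy.ne]
  exact pairGood_of_bits (he.rowBits_nonzero hr h.pair_left) (he.rowBits_nonzero hr h.pair_right)
    hle (he.hexForced h hxy.ne) (he.hexTrans hr h hxy.ne)

theorem tripleGood (he : Δ.IsEnum e) (hr : Δ.M.eRank = 4) (h : Δ.Outer {x, y, z})
    (hxy : Δ.prec x y) (hyz : Δ.prec y z) :
    TripleGood (he.span {x, y, z}).card (he.span {x, y}).card (he.span {x, z}).card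
      (he.span {y, z}).card
      (tripleExponents (hVector (Δ.Gam {x, y, z})) (hVector (Δ.Gam {x, y}))
        (hVector (Δ.Gam {x, z})) (hVector (Δ.Gam {y, z})) (Δ.nb x) (Δ.nb y) (Δ.nb z))
      (pairExponents (hVector (Δ.Gam {x, y})) (Δ.nb x))
      (pairExponents (hVector (Δ.Gam {x, z})) (Δ.nb x))
      (pairExponents (hVector (Δ.Gam {y, z})) (Δ.nb y)) ∧
      hVector (Δ.Gam {x, y, z}) ∈ tripleHLists := by
  have hxy' : Δ.Outer {x, y} := h.subset (by intro a; simp; tauto)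
  have hxz' : Δ.Outer {x, z} := h.subset (by intro a; simp; tauto)
  have hyz' : Δ.Outer {y, z} := h.subset (by intro a; simp; tauto)
  have hxz := prec_trans hxy hyz
  have hle := hxy.nb_le
  have hle' := hyz.nb_le
  rw [he.nb_eq hr hxy'.pair_left, he.nb_eq hr hxy'.pair_right] at hle
  rw [he.nb_eq hr hyz'.pair_left, he.nb_eq hr hyz'.pair_right] at hle'
  rw [he.nb_eq hr hxy'.pair_left, he.nb_eq hr hyz'.pair_left, he.nb_eq hr hyz'.pair_right,
    he.card_span_pair, he.card_span_pair, he.card_span_pair, he.card_span_triple,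
    he.hVector_pair hr hxy' hxy.ne, he.hVector_pair hr hxz' hxz.ne, he.hVector_pair hr hyz' hyz.ne,
    he.hVector_triple hr h hxy.ne hxz.ne hyz.ne]
  have nt := he.tripleBits_nonzero hr h hxy.ne hxz.ne hyz.ne
  -- `hexQuad` and `hexesTrans` single out one of the three elements, so they are also applied to
  -- reorderings of the triple.
  have e1 : ({x, z, y} : Set α) = {x, y, z} := by rw [Set.pair_comm]
  have e2 : ({y, z, x} : Set α) = {x, y, z} := by ext; simp; tauto
  have e3 : ({y, x, z} : Set α) = {x, y, z} := Set.insert_comm _ _ _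
  have t1 : Δ.tripleBits e x z y = Δ.tripleBits e x y z := by rw [tripleBits, tripleBits, e1]
  have t2 : Δ.tripleBits e y z x = Δ.tripleBits e x y z := by rw [tripleBits, tripleBits, e2]
  have q1 := he.hexQuad (e1 ▸ h) hxz.ne hxy.ne hyz.ne.symm
  have q2 := he.hexQuad (e2 ▸ h) hyz.ne hxy.ne.symm hxz.ne.symm
  have s1 := he.hexesTrans (e3 ▸ h) hxy.ne.symm hyz.ne hxz.ne
  have s2 := he.hexesTrans (e1 ▸ h) hxz.ne hxy.ne hyz.ne.symm
  rw [pairBits_comm (x := y) (y := x)] at s1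
  rw [pairBits_comm (x := z) (y := y)] at s2
  rw [t1] at q1
  rw [t2] at q2
  exact ⟨tripleGood_of_bits (he.rowBits_nonzero hr hxy'.pair_left)
    (he.rowBits_nonzero hr hyz'.pair_left) (he.rowBits_nonzero hr hyz'.pair_right) nt hle hle'
    (he.hexForced hxy' hxy.ne) (he.hexTrans hr hxy' hxy.ne) (he.hexQuad h hxy.ne hxz.ne hyz.ne)
    (he.hexForced hxz' hxz.ne) (he.hexTrans hr hxz' hxz.ne) q1
    (he.hexForced hyz' hyz.ne) (he.hexTrans hr hyz' hyz.ne) q2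
    (he.hexesTrans h hxy.ne hxz.ne hyz.ne) s1 s2 (he.hexesQuad h hxy.ne hxz.ne hyz.ne),
    Quad.hList_mem nt⟩

end IsEnum

end BasedMatroid

/-! ### The monomials of the output -/

section Support

variable {α : Type u}

theorem coe_support_single {x : α} {t : ℕ} (ht : 1 ≤ t) :
    ((Finsupp.single x t).support : Set α) = {x} := by
  rw [Finsupp.support_single _ (by omega), Finset.coe_singleton]

theorem coe_support_add (m n : α →₀ ℕ) :
    ((m + n).support : Set α) = (m.support : Set α) ∪ n.support := by
  ext i
  simp only [Finset.mem_coe, Finsupp.mem_support_iff, Finsupp.add_apply, Set.mem_union]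
  omega

theorem coe_support_pair {x y : α} {a b : ℕ} (ha : 1 ≤ a) (hb : 1 ≤ b) :
    ((Finsupp.single x a + Finsupp.single y b).support : Set α) = {x, y} := by
  rw [coe_support_add, coe_support_single ha, coe_support_single hb]
  rfl

theorem coe_support_triple {x y z : α} {a b c : ℕ} (ha : 1 ≤ a) (hb : 1 ≤ b) (hc : 1 ≤ c) :
    ((Finsupp.single x a + Finsupp.single y b + Finsupp.single z c).support : Set α) =
      {x, y, z} := by
  rw [coe_support_add, coe_support_pair ha hb, coe_support_single hc]
  ext i
  simp
  tauto

theorem coe_support_quad {w x y z : α} :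
    ((Finsupp.single w 1 + Finsupp.single x 1 + Finsupp.single y 1 + Finsupp.single z 1).support :
      Set α) = {w, x, y, z} := by
  rw [coe_support_add, coe_support_triple le_rfl le_rfl le_rfl, coe_support_single le_rfl]
  ext i
  simp
  tauto

theorem eq_of_add_single_eq {m r : α →₀ ℕ} {x : α} {a : ℕ} (ha : 1 ≤ a)
    (h : m + Finsupp.single x 1 = Finsupp.single x a + r) :
    m = Finsupp.single x (a - 1) + r := by
  refine add_right_cancel (b := Finsupp.single x 1) ?_
  rw [h, add_right_comm, ← Finsupp.single_add, Nat.sub_add_cancel ha]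

theorem mem_coe_support_of_add_single_eq {m n : α →₀ ℕ} {x : α}
    (h : m + Finsupp.single x 1 = n) : x ∈ (n.support : Set α) := by
  rw [← h, coe_support_add, coe_support_single le_rfl]
  exact Or.inr rfl

end Support

namespace BasedMatroid

variable {α : Type u} {Δ : BasedMatroid α} {e : Fin 4 → α} {w x y z : α} {I : Set α}

/-- The exponents used for an outer pair `x < y`. -/
noncomputable def pairExps (Δ : BasedMatroid α) (x y : α) : List (ℕ × ℕ) :=
  pairExponents (hVector (Δ.Gam {x, y})) (Δ.nb x)

/-- The exponents used for an outer triple `x < y < z`. -/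
noncomputable def tripleExps (Δ : BasedMatroid α) (x y z : α) : List (ℕ × ℕ × ℕ) :=
  tripleExponents (hVector (Δ.Gam {x, y, z})) (hVector (Δ.Gam {x, y}))
    (hVector (Δ.Gam {x, z})) (hVector (Δ.Gam {y, z})) (Δ.nb x) (Δ.nb y) (Δ.nb z)

theorem zero_mem : (0 : α →₀ ℕ) ∈ rankFourOutput α Δ :=
  Or.inl (Or.inl (Or.inl (Or.inl rfl)))

theorem single_mem (hx : Δ.Outer {x}) {t : ℕ} (ht : 1 ≤ t) (ht' : t ≤ Δ.nb x) :
    Finsupp.single x t ∈ rankFourOutput α Δ :=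
  Or.inl (Or.inl (Or.inl (Or.inr ⟨x, hx, t, ht, ht', rfl⟩)))

theorem pair_mem (h : Δ.Outer {x, y}) (hxy : Δ.prec x y) {a b : ℕ} (hab : (a, b) ∈ Δ.pairExps x y) :
    Finsupp.single x a + Finsupp.single y b ∈ rankFourOutput α Δ :=
  Or.inl (Or.inl (Or.inr ⟨x, y, h, hxy, _, hab, rfl⟩))

theorem triple_mem (h : Δ.Outer {x, y, z}) (hxy : Δ.prec x y) (hyz : Δ.prec y z) {a b c : ℕ}
    (habc : (a, b, c) ∈ Δ.tripleExps x y z) :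
    Finsupp.single x a + Finsupp.single y b + Finsupp.single z c ∈ rankFourOutput α Δ :=
  Or.inl (Or.inr ⟨x, y, z, h, hxy, hyz, _, habc, rfl⟩)

theorem quad_mem (h : Δ.Outer {w, x, y, z}) (hwx : Δ.prec w x) (hxy : Δ.prec x y)
    (hyz : Δ.prec y z) :
    Finsupp.single w 1 + Finsupp.single x 1 + Finsupp.single y 1 + Finsupp.single z 1 ∈
      rankFourOutput α Δ :=
  Or.inr ⟨w, x, y, z, h, hwx, hxy, hyz, rfl⟩

theorem output_cases {P : (α →₀ ℕ) → Prop} (h0 : P 0)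
    (h1 : ∀ x, Δ.Outer {x} → ∀ t, 1 ≤ t → t ≤ Δ.nb x → P (Finsupp.single x t))
    (h2 : ∀ x y, Δ.Outer {x, y} → Δ.prec x y → ∀ a b, (a, b) ∈ Δ.pairExps x y →
      P (Finsupp.single x a + Finsupp.single y b))
    (h3 : ∀ x y z, Δ.Outer {x, y, z} → Δ.prec x y → Δ.prec y z → ∀ a b c,
      (a, b, c) ∈ Δ.tripleExps x y z →
      P (Finsupp.single x a + Finsupp.single y b + Finsupp.single z c))
    (h4 : ∀ w x y z, Δ.Outer {w, x, y, z} → Δ.prec w x → Δ.prec x y → Δ.prec y z →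
      P (Finsupp.single w 1 + Finsupp.single x 1 + Finsupp.single y 1 + Finsupp.single z 1)) :
    ∀ m ∈ rankFourOutput α Δ, P m := by
  rintro m ((((rfl | ⟨x, hx, t, ht, ht', rfl⟩) | ⟨x, y, h, hxy, ⟨a, b⟩, hab, rfl⟩) |
    ⟨x, y, z, h, hxy, hyz, ⟨a, b, c⟩, habc, rfl⟩) | ⟨w, x, y, z, h, hwx, hxy, hyz, rfl⟩)
  exacts [h0, h1 x hx t ht ht', h2 x y h hxy a b hab, h3 x y z h hxy hyz a b c habc,
    h4 w x y z h hwx hxy hyz]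

theorem Outer.xy (h : Δ.Outer {x, y, z}) : Δ.Outer {x, y} :=
  h.subset (by intro a; simp; tauto)
theorem Outer.xz (h : Δ.Outer {x, y, z}) : Δ.Outer {x, z} :=
  h.subset (by intro a; simp; tauto)
theorem Outer.yz (h : Δ.Outer {x, y, z}) : Δ.Outer {y, z} :=
  h.subset (by intro a; simp; tauto)

namespace IsEnum

theorem pairGood' (he : Δ.IsEnum e) (hr : Δ.M.eRank = 4) (h : Δ.Outer {x, y})
    (hxy : Δ.prec x y) :
    PairGood (he.span {x, y}).card (Δ.nb x) (Δ.nb y) (Δ.pairExps x y) :=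
  (he.pairGood hr h hxy).1

theorem tripleGood' (he : Δ.IsEnum e) (hr : Δ.M.eRank = 4) (h : Δ.Outer {x, y, z})
    (hxy : Δ.prec x y) (hyz : Δ.prec y z) :
    TripleGood (he.span {x, y, z}).card (he.span {x, y}).card (he.span {x, z}).card
      (he.span {y, z}).card (Δ.tripleExps x y z) (Δ.pairExps x y) (Δ.pairExps x z)
      (Δ.pairExps y z) :=
  (he.tripleGood hr h hxy hyz).1

theorem output_support (he : Δ.IsEnum e) (hr : Δ.M.eRank = 4) :
    ∀ m ∈ rankFourOutput α Δ, Δ.Outer (m.support : Set α) := by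
  refine output_cases ?_ (fun x hx t ht _ => ?_) (fun x y h hxy a b hab => ?_)
    (fun x y z h hxy hyz a b c habc => ?_) (fun w x y z h _ _ _ => ?_)
  · simp [Outer]
  · rwa [coe_support_single ht]
  · obtain ⟨ha, hb⟩ := (he.pairGood' hr h hxy).pos hab
    rwa [coe_support_pair ha hb]
  · obtain ⟨ha, hb, hc⟩ := (he.tripleGood' hr h hxy hyz).pos habc
    rwa [coe_support_triple ha hb hc]
  · rwa [coe_support_quad]

/-! ### Closure under division -/

/-- Closure under division needs only division by one variable. If the exponent was `1`, the support
shrinks, and membership comes from the compatibility of the exponents with those of the smaller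
support. -/
theorem mem_of_add_single_mem (he : Δ.IsEnum e) (hr : Δ.M.eRank = 4) (i : α) :
    ∀ n ∈ rankFourOutput α Δ, ∀ m, m + Finsupp.single i 1 = n → m ∈ rankFourOutput α Δ := by
  refine output_cases ?_ (fun x hx t ht ht' => ?_) (fun x y h hxy a b hab => ?_)
    (fun x y z h hxy hyz a b c habc => ?_) (fun w x y z h hwx hxy hyz => ?_) <;> intro m hm <;>
    have hi := mem_coe_support_of_add_single_eq hm
  · simp at hi
  · rw [coe_support_single ht] at hi
    obtain rfl := hi
    obtain rfl := eq_of_add_single_eq (r := 0) ht (by rw [hm, add_zero])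
    rw [add_zero]
    rcases Nat.eq_or_lt_of_le ht with rfl | ht
    · simpa using zero_mem
    · exact single_mem hx (by omega) (by omega)
  · have g := he.pairGood' hr h hxy
    obtain ⟨ha, hb⟩ := g.pos hab
    rw [coe_support_pair ha hb] at hi
    rcases hi with rfl | rfl
    · obtain rfl := eq_of_add_single_eq ha hm
      rcases g.lower_left hab with rfl | hab'
      · simpa using single_mem h.pair_right hb (g.le_right hab)
      · exact pair_mem h hxy hab'
    · rw [add_comm (Finsupp.single x a)] at hm
      obtain rfl := eq_of_add_single_eq hb hm
      rw [add_comm]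
      rcases g.lower_right hab with rfl | hab'
      · simpa using single_mem h.pair_left ha (g.le_left hab)
      · exact pair_mem h hxy hab'
  · have g := he.tripleGood' hr h hxy hyz
    obtain ⟨ha, hb, hc⟩ := g.pos habc
    rw [coe_support_triple ha hb hc] at hi
    rcases hi with rfl | rfl | rfl
    · rw [add_assoc] at hm
      obtain rfl := eq_of_add_single_eq ha hm
      rcases g.lower_x habc with rfl | h'
      · simpa using pair_mem h.yz hyz (g.mem_yz habc)
      · rw [← add_assoc]
        exact triple_mem h hxy hyz h'
    · rw [add_comm (Finsupp.single x a), add_assoc] at hm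
      obtain rfl := eq_of_add_single_eq hb hm
      rw [← add_assoc, add_comm (Finsupp.single _ (b - 1))]
      rcases g.lower_y habc with rfl | h'
      · simpa using pair_mem h.xz (prec_trans hxy hyz) (g.mem_xz habc)
      · exact triple_mem h hxy hyz h'
    · obtain rfl := eq_of_add_single_eq hc (hm.trans (add_comm _ _))
      rw [add_comm]
      rcases g.lower_z habc with rfl | h'
      · simpa using pair_mem h.xy hxy (g.mem_xy habc)
      · exact triple_mem h hxy hyz h'
  · have o1 : Δ.Outer {x, y, z} := h.subset (by intro a; simp; tauto)
    have o2 : Δ.Outer {w, y, z} := h.subset (by intro a; simp; tauto)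
    have o3 : Δ.Outer {w, x, z} := h.subset (by intro a; simp; tauto)
    have o4 : Δ.Outer {w, x, y} := h.subset (by intro a; simp; tauto)
    rw [coe_support_quad] at hi
    rcases hi with rfl | rfl | rfl | rfl
    · obtain rfl : m = Finsupp.single x 1 + Finsupp.single y 1 + Finsupp.single z 1 :=
        add_right_cancel (hm.trans (by abel))
      exact triple_mem o1 hxy hyz (he.tripleGood' hr o1 hxy hyz).one_mem
    · obtain rfl : m = Finsupp.single w 1 + Finsupp.single y 1 + Finsupp.single z 1 :=
        add_right_cancel (hm.trans (by abel))
      exact triple_mem o2 (prec_trans hwx hxy) hyz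
        (he.tripleGood' hr o2 (prec_trans hwx hxy) hyz).one_mem
    · obtain rfl : m = Finsupp.single w 1 + Finsupp.single x 1 + Finsupp.single z 1 :=
        add_right_cancel (hm.trans (by abel))
      exact triple_mem o3 hwx (prec_trans hxy hyz)
        (he.tripleGood' hr o3 hwx (prec_trans hxy hyz)).one_mem
    · obtain rfl := add_right_cancel hm
      exact triple_mem o4 hwx hxy (he.tripleGood' hr o4 hwx hxy).one_mem

theorem output_lower (he : Δ.IsEnum e) (hr : Δ.M.eRank = 4) {m m' : α →₀ ℕ}
    (hm : m ∈ rankFourOutput α Δ) (h : m' ≤ m) : m' ∈ rankFourOutput α Δ := by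
  obtain ⟨d, rfl⟩ := exists_add_of_le h
  clear h
  induction d using Finsupp.induction_linear generalizing m' with
  | zero => simpa using hm
  | add d d' hd hd' => exact hd (hd' (by rwa [add_assoc]))
  | single i n =>
    induction n with
    | zero => simpa using hm
    | succ n ih =>
      rw [Finsupp.single_add, ← add_assoc] at hm
      exact ih (he.mem_of_add_single_mem hr i _ hm _ rfl)

/-! ### Purity -/

theorem span_mono (he : Δ.IsEnum e) {J : Set α} (h : I ⊆ J) : he.span I ⊆ he.span J := by
  intro i hi
  obtain ⟨x, hx, hK⟩ := mem_span.1 hi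
  exact mem_span.2 ⟨x, h hx, hK⟩

theorem card_span_lt (he : Δ.IsEnum e) {J : Set α} (h : I ⊆ J) (hz : z ∈ J) {i : Fin 4}
    (hi : Δ.Kept e {i}ᶜ {z}) (hi' : i ∉ he.span I) : (he.span I).card < (he.span J).card :=
  Finset.card_lt_card (Finset.ssubset_iff_of_subset (he.span_mono h) |>.2
    ⟨i, mem_span.2 ⟨z, hz, hi⟩, hi'⟩)

/-- Four independent outer elements form a base, so they are not all contained in the hyperplane
spanned by three base elements. -/
theorem card_span_quad (he : Δ.IsEnum e) (h : Δ.Outer {w, x, y, z}) (hwx : Δ.prec w x)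
    (hxy : Δ.prec x y) (hyz : Δ.prec y z) : (he.span {w, x, y, z}).card = 4 := by
  have hc : ({w, x, y, z} : Set α).encard = 4 := by
    have hwy := prec_trans hwx hxy
    have hxz := prec_trans hxy hyz
    have hwz := prec_trans hwx hxz
    rw [Set.encard_insert_of_notMem, Set.encard_insert_of_notMem, Set.encard_pair hyz.ne]
    · norm_num
    · simp [hxy.ne, hxz.ne]
    · simp [hwx.ne, hwy.ne, hwz.ne]
  have : he.span {w, x, y, z} = Finset.univ := by
    refine Finset.eq_univ_of_forall fun i => ?_
    have h0 : Δ.Kept e {i}ᶜ ∅ := he.kept_univ.mono (by simp) subset_rfl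
    rcases he.augment h0 h.kept_empty (Set.empty_disjoint _) h.2 (by
      rw [Fin4.card_compl_singleton, hc, Set.encard_empty, Finset.card_empty]; norm_num) with
      ⟨l, hl, -⟩ | ⟨v, hv, -, hK⟩
    · exact absurd hl (Finset.notMem_empty l)
    · rw [insert_empty_eq] at hK
      exact mem_span.2 ⟨v, hv, hK⟩
  rw [this, Finset.card_univ, Fintype.card_fin]

/-- The first half of purity: a monomial is enlarged without changing its support, through the
`extend` fields when the support has two or three elements. -/
theorem exists_ge_degree_eq (he : Δ.IsEnum e) (hr : Δ.M.eRank = 4) :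
    ∀ m ∈ rankFourOutput α Δ, ∃ m' ∈ rankFourOutput α Δ, m ≤ m' ∧
      m'.degree = (he.span (m'.support : Set α)).card := by
  refine output_cases ?_ (fun x hx t ht ht' => ?_) (fun x y h hxy a b hab => ?_)
    (fun x y z h hxy hyz a b c habc => ?_) (fun w x y z h hwx hxy hyz => ?_)
  · exact ⟨0, zero_mem, le_rfl, by simp [span]⟩
  · refine ⟨Finsupp.single x (Δ.nb x), single_mem hx (ht.trans ht') le_rfl, ?_, ?_⟩
    · exact Finsupp.single_le_single.2 ht'
    · rw [coe_support_single (ht.trans ht'), he.card_span_singleton, Finsupp.degree_single,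
        he.nb_eq hr hx]
  · have g := he.pairGood' hr h hxy
    obtain ⟨a', b', hab', ha, hb, hN⟩ := g.extend hab
    refine ⟨_, pair_mem h hxy hab',
      add_le_add (Finsupp.single_le_single.2 ha) (Finsupp.single_le_single.2 hb), ?_⟩
    obtain ⟨ha', hb'⟩ := g.pos hab'
    rw [coe_support_pair ha' hb', map_add, Finsupp.degree_single, Finsupp.degree_single, hN]
  · have g := he.tripleGood' hr h hxy hyz
    obtain ⟨a', b', c', habc', ha, hb, hc, hN⟩ := g.extend habc
    refine ⟨_, triple_mem h hxy hyz habc',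
      add_le_add (add_le_add (Finsupp.single_le_single.2 ha) (Finsupp.single_le_single.2 hb))
        (Finsupp.single_le_single.2 hc), ?_⟩
    obtain ⟨ha', hb', hc'⟩ := g.pos habc'
    rw [coe_support_triple ha' hb' hc', map_add, map_add, Finsupp.degree_single,
      Finsupp.degree_single, Finsupp.degree_single, hN]
  · refine ⟨_, quad_mem h hwx hxy hyz, le_rfl, ?_⟩
    rw [coe_support_quad, he.card_span_quad h hwx hxy hyz]
    simp only [map_add, Finsupp.degree_single]

/-- A maximal monomial with a given support extends to every element that enlarges the span. -/
theorem exists_add_single_mem (he : Δ.IsEnum e) (hr : Δ.M.eRank = 4) {i : Fin 4}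
    (hz : Δ.Outer {z}) (hi : Δ.Kept e {i}ᶜ {z}) :
    ∀ m ∈ rankFourOutput α Δ, m.degree = (he.span (m.support : Set α)).card →
      i ∉ he.span (m.support : Set α) → ∃ k, 1 ≤ k ∧ m + Finsupp.single z k ∈ rankFourOutput α Δ := by
  refine output_cases ?_ (fun x hx t ht ht' => ?_) (fun x y h hxy a b hab => ?_)
    (fun x y w h hxy hyw a b c habc => ?_) (fun w x y v h hwx hxy hyv => ?_) <;> intro hm hi'
  · refine ⟨1, le_rfl, ?_⟩
    rw [zero_add]
    refine single_mem hz le_rfl ?_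
    rw [he.nb_eq hr hz, ← he.card_span_singleton]
    exact Finset.card_pos.2 ⟨i, mem_span.2 ⟨z, rfl, hi⟩⟩
  · rw [coe_support_single ht] at hm hi'
    rw [Finsupp.degree_single] at hm
    obtain ⟨hzx, ho⟩ := he.outer_insert hx hz hi hi'
    have hlt := he.card_span_lt (Set.subset_insert z {x}) (Set.mem_insert _ _) hi hi'
    have hnb : Δ.nb x = t := by rw [he.nb_eq hr hx, ← he.card_span_singleton, hm]
    rcases prec_total hx hz (fun h => hzx h.symm) with hp | hp
    · rw [Set.pair_comm] at ho hlt
      have g := he.pairGood' hr ho hp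
      -- The power of `x` has degree `|span {x}|`, which is strictly below the span size of the
      -- pair, so the first alternative is impossible.
      obtain ⟨b, hb⟩ := g.extend_left.resolve_left (by omega)
      rw [hnb] at hb
      exact ⟨b, (g.pos hb).2, pair_mem ho hp hb⟩
    · have g := he.pairGood' hr ho hp
      obtain ⟨b, hb⟩ := g.extend_right.resolve_left (by omega)
      rw [hnb] at hb
      exact ⟨b, (g.pos hb).1, by rw [add_comm]; exact pair_mem ho hp hb⟩
  · obtain ⟨ha, hb⟩ := (he.pairGood' hr h hxy).pos hab
    rw [coe_support_pair ha hb] at hm hi'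
    simp only [map_add, Finsupp.degree_single] at hm
    obtain ⟨hn, ho⟩ := he.outer_insert h hz hi hi'
    have hlt := he.card_span_lt (Set.subset_insert z {x, y}) (Set.mem_insert _ _) hi hi'
    have hzx : z ≠ x := fun h => hn (Or.inl h)
    have hzy : z ≠ y := fun h => hn (Or.inr h)
    rcases prec_total hz h.pair_left hzx with h1 | h1
    · have g := he.tripleGood' hr ho h1 hxy
      -- The degree is the span size of the pair, hence smaller than that of the triple; this
      -- excludes the first two alternatives.
      obtain ⟨c, hc⟩ := ((g.extend_yz hab).resolve_left (by omega)).resolve_left (by omega)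
      refine ⟨c, (g.pos hc).1, ?_⟩
      have := triple_mem ho h1 hxy hc
      rwa [add_assoc, add_comm] at this
    rcases prec_total hz h.pair_right hzy with h2 | h2
    · rw [Set.insert_comm] at ho hlt
      have g := he.tripleGood' hr ho h1 h2
      obtain ⟨c, hc⟩ := ((g.extend_xz hab).resolve_left (by omega)).resolve_left (by omega)
      refine ⟨c, (g.pos hc).2.1, ?_⟩
      have := triple_mem ho h1 h2 hc
      rwa [add_right_comm] at this
    · have heq : (insert z {x, y} : Set α) = {x, y, z} := by ext; simp; tauto
      rw [heq] at ho hlt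
      have g := he.tripleGood' hr ho hxy h2
      obtain ⟨c, hc⟩ := ((g.extend_xy hab).resolve_left (by omega)).resolve_left (by omega)
      exact ⟨c, (g.pos hc).2.2, triple_mem ho hxy h2 hc⟩
  · obtain ⟨ha, hb, hc⟩ := (he.tripleGood' hr h hxy hyw).pos habc
    rw [coe_support_triple ha hb hc] at hm hi'
    simp only [map_add, Finsupp.degree_single] at hm
    obtain ⟨hn, ho⟩ := he.outer_insert h hz hi hi'
    have hlt := he.card_span_lt (Set.subset_insert z {x, y, w}) (Set.mem_insert _ _) hi hi'
    -- The span grows and has at most four elements, so the degree is at most three and all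
    -- exponents are `1`.
    have hle := (he.span (insert z {x, y, w})).card_le_univ
    rw [Fintype.card_fin] at hle
    obtain rfl : a = 1 := by omega
    obtain rfl : b = 1 := by omega
    obtain rfl : c = 1 := by omega
    refine ⟨1, le_rfl, ?_⟩
    have hzx : z ≠ x := fun h => hn (Or.inl h)
    have hzy : z ≠ y := fun h => hn (Or.inr (Or.inl h))
    have hzw : z ≠ w := fun h => hn (Or.inr (Or.inr h))
    rcases prec_total hz h.xy.pair_left hzx with h1 | h1
    · have := quad_mem ho h1 hxy hyw
      rwa [add_assoc, add_assoc, add_comm, ← add_assoc] at this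
    rcases prec_total hz h.yz.pair_left hzy with h2 | h2
    · have heq : (insert z {x, y, w} : Set α) = {x, z, y, w} := by ext; simp; tauto
      have := quad_mem (heq ▸ ho) h1 h2 hyw
      rwa [add_right_comm _ _ (Finsupp.single y 1), add_right_comm _ _ (Finsupp.single w 1)] at this
    rcases prec_total hz h.yz.pair_right hzw with h3 | h3
    · have heq : (insert z {x, y, w} : Set α) = {x, y, z, w} := by ext; simp; tauto
      have := quad_mem (heq ▸ ho) hxy h2 h3
      rwa [add_right_comm _ _ (Finsupp.single w 1)] at this
    · have heq : (insert z {x, y, w} : Set α) = {x, y, w, z} := by ext; simp; tauto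
      exact quad_mem (heq ▸ ho) hxy hyw h3
  · rw [coe_support_quad] at hm hi'
    have hlt := he.card_span_lt (Set.subset_insert z {w, x, y, v}) (Set.mem_insert _ _) hi hi'
    have hle := (he.span (insert z {w, x, y, v})).card_le_univ
    rw [Fintype.card_fin] at hle
    rw [he.card_span_quad h hwx hxy hyv] at hlt
    omega

theorem degree_le_four (he : Δ.IsEnum e) (hr : Δ.M.eRank = 4) {m : α →₀ ℕ}
    (hm : m ∈ rankFourOutput α Δ) : m.degree ≤ 4 := by
  obtain ⟨m', -, hle, hd⟩ := he.exists_ge_degree_eq hr m hm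
  have := (he.span (m'.support : Set α)).card_le_univ
  rw [Fintype.card_fin] at this
  exact (Finsupp.degree_mono hle).trans (hd ▸ this)

theorem output_finite (he : Δ.IsEnum e) (hr : Δ.M.eRank = 4) : (rankFourOutput α Δ).Finite := by
  classical
  refine (Set.finite_Iic (∑ x ∈ Δ.finite.toFinset, Finsupp.single x 4)).subset fun m hm => ?_
  intro x
  rw [Finsupp.finsetSum_apply]
  by_cases hx : x ∈ m.support
  · have hxE : x ∈ Δ.finite.toFinset :=
      Δ.finite.mem_toFinset.2 ((he.output_support hr m hm).1.subset_ground hx)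
    refine le_trans ?_ (Finset.single_le_sum (fun _ _ => Nat.zero_le _) hxE)
    rw [Finsupp.single_eq_same]
    exact (Finsupp.le_degree x m).trans (he.degree_le_four hr hm)
  · rw [Finsupp.notMem_support_iff.1 hx]
    exact Nat.zero_le _

theorem output_isPureOrderIdeal (he : Δ.IsEnum e) (hr : Δ.M.eRank = 4) :
    IsPureOrderIdeal (rankFourOutput α Δ) where
  finite := he.output_finite hr
  nonempty := ⟨0, zero_mem⟩
  lower m hm m' h := he.output_lower hr hm h
  pure := by
    -- The common degree is the number of elements of `B` that are not coloops.
    refine ⟨(he.span (Δ.M.E \ Δ.B)).card, fun m hm => ?_⟩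
    have hd : m.degree = (he.span (m.support : Set α)).card := by
      obtain ⟨m', hm', hle, hd⟩ := he.exists_ge_degree_eq hr m hm.prop
      rwa [hm.eq_of_le hm' hle]
    have hs := he.span_mono (he.output_support hr m hm.prop).subset_diff
    rw [hd]
    congr 1
    refine hs.antisymm fun i hi => ?_
    by_contra hi'
    obtain ⟨z, hz, hK⟩ := mem_span.1 hi
    obtain ⟨k, hk, hmem⟩ := he.exists_add_single_mem hr
      ⟨hK.indep, Set.disjoint_singleton_left.2 hz.2⟩ hK m hm.prop hd hi'
    have := DFunLike.congr_fun (hm.eq_of_le hmem le_self_add) z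
    rw [Finsupp.add_apply, Finsupp.single_eq_same] at this
    omega

end IsEnum

end BasedMatroid

/-! ### The number of exponents of each degree -/

/-- The algorithm only asks whether `nx` is `1` and whether it is less than `3`, so three values
represent all of them. -/
theorem pairExponents_eq (h : List ℤ) (nx : ℕ) :
    ∃ k ∈ [1, 2, 3], pairExponents h nx = pairExponents h k := by
  by_cases h1 : nx = 1
  · exact ⟨1, by simp, by rw [h1]⟩
  by_cases h3 : nx < 3
  · exact ⟨2, by simp, by simp [pairExponents, h1, h3]⟩
  · exact ⟨3, by simp, by simp [pairExponents, h1, h3]⟩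

theorem pairExponents_card {h : List ℤ} (hh : h ∈ pairHLists) (nx j : ℕ) :
    (((pairExponents h nx).toFinset.filter fun e => e.1 + e.2 = 2 + j).card : ℤ) =
      h.getD j 0 := by
  obtain ⟨k, hk, heq⟩ := pairExponents_eq h nx
  rw [heq]
  have key : ∀ h ∈ pairHLists, ∀ k ∈ [1, 2, 3], (∀ j ∈ List.range 3,
      (((pairExponents h k).toFinset.filter fun e => e.1 + e.2 = 2 + j).card : ℤ) =
        h.getD j 0) ∧ (∀ e ∈ pairExponents h k, e.1 + e.2 < 5) ∧ h.length = 3 := by decide +kernel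
  obtain ⟨h1, h2, h3⟩ := key h hh k hk
  by_cases hj : j < 3
  · exact h1 j (List.mem_range.2 hj)
  · rw [List.getD_eq_default _ _ (by omega), Finset.filter_eq_empty_iff.2]
    · rfl
    · intro e he
      have := h2 e (List.mem_toFinset.1 he)
      omega

/-- The possible exponents of a triple whose `h`-vector is given. -/
def tripleLists (h : List ℤ) : List (List (ℕ × ℕ × ℕ)) :=
  if h = [1, 0] then [[(1, 1, 1)]]
  else if h = [1, 1] then
    [[(1, 1, 1), (2, 1, 1)], [(1, 1, 1), (1, 2, 1)], [(1, 1, 1), (1, 1, 2)]]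
  else if h = [1, 2] then
    [[(1, 1, 1), (2, 1, 1), (1, 2, 1)], [(1, 1, 1), (2, 1, 1), (1, 1, 2)],
      [(1, 1, 1), (1, 2, 1), (1, 1, 2)]]
  else [[(1, 1, 1), (2, 1, 1), (1, 2, 1), (1, 1, 2)]]

/-- The case distinctions decide only which variables get squared; how many do is determined by `h`.
-/
theorem tripleExponents_mem {h : List ℤ} (hh : h ∈ tripleHLists) (hxy hxz hyz : List ℤ)
    (nx ny nz : ℕ) : tripleExponents h hxy hxz hyz nx ny nz ∈ tripleLists h := by
  simp only [tripleHLists, List.mem_cons, List.not_mem_nil, or_false] at hh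
  unfold tripleExponents tripleLists
  rcases hh with rfl | rfl | rfl | rfl
  · rw [if_pos rfl, if_pos rfl]
    exact List.mem_singleton_self _
  · rw [if_neg (by decide), if_pos rfl, if_neg (by decide), if_pos rfl]
    split_ifs <;> simp only [List.mem_cons, true_or, or_true]
  · rw [if_neg (by decide), if_neg (by decide), if_pos rfl, if_neg (by decide),
      if_neg (by decide), if_pos rfl]
    split_ifs <;> simp only [List.mem_cons, true_or, or_true]
  · rw [if_neg (by decide), if_neg (by decide), if_neg (by decide), if_pos rfl,
      if_neg (by decide), if_neg (by decide), if_neg (by decide)]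
    exact List.mem_singleton_self _

theorem tripleExponents_card {h : List ℤ} (hh : h ∈ tripleHLists) (hxy hxz hyz : List ℤ)
    (nx ny nz j : ℕ) :
    (((tripleExponents h hxy hxz hyz nx ny nz).toFinset.filter
      fun e => e.1 + e.2.1 + e.2.2 = 3 + j).card : ℤ) = h.getD j 0 := by
  obtain ⟨L, hL, hE⟩ : ∃ L ∈ tripleLists h, tripleExponents h hxy hxz hyz nx ny nz = L :=
    ⟨_, tripleExponents_mem hh hxy hxz hyz nx ny nz, rfl⟩
  rw [hE]
  have key : ∀ h ∈ tripleHLists, ∀ L ∈ tripleLists h, (∀ j ∈ List.range 2,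
      ((L.toFinset.filter fun e => e.1 + e.2.1 + e.2.2 = 3 + j).card : ℤ) = h.getD j 0) ∧
      (∀ e ∈ L, e.1 + e.2.1 + e.2.2 < 5) ∧ h.length = 2 := by decide +kernel
  obtain ⟨h1, h2, h3⟩ := key h hh L hL
  by_cases hj : j < 2
  · exact h1 j (List.mem_range.2 hj)
  · rw [List.getD_eq_default _ _ (by omega), Finset.filter_eq_empty_iff.2]
    · rfl
    · intro e he
      have := h2 e (List.mem_toFinset.1 he)
      omega

/-! ### The `h`-vectors for supports with at most one element -/

namespace Quad

/-- `G` avoids some element of the subset. -/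
def avoids (q : Quad) (G : Finset (Fin 4)) : Bool := anyIdx fun i => decide (i ∉ G) && q.get i

theorem avoids_iff {q : Quad} {G : Finset (Fin 4)} :
    q.avoids G = true ↔ ∃ i, i ∉ G ∧ q.get i = true := by
  simp [avoids, anyIdx_iff]

/-- The number of subsets of cardinality `k` that avoid some element of the subset. -/
def faces (q : Quad) (k : ℕ) : ℕ :=
  ((Finset.powersetCard k Finset.univ).filter fun G => q.avoids G = true).card

/-- The sets missing a point of `q` form the join of the boundary of the simplex on `q` with a full
simplex, whose `h`-vector consists of `q.count` ones. -/
theorem hVector_faces {q : Quad} (h : q.nonzero = true) :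
    [(q.faces 0 : ℤ), q.faces 1 - 3 * q.faces 0, q.faces 2 - 2 * q.faces 1 + 3 * q.faces 0,
      q.faces 3 - q.faces 2 + q.faces 1 - q.faces 0] =
      (List.range 4).map fun j => if j < q.count then 1 else 0 := by
  obtain ⟨a, b, c, d⟩ := q
  cases a <;> cases b <;> cases c <;> cases d <;>
    first
    | exact absurd h Bool.false_ne_true
    | decide +kernel

end Quad

namespace BasedMatroid

variable {α : Type u} {Δ : BasedMatroid α} {e : Fin 4 → α} {w x y z : α} {I : Set α}

namespace IsEnum

theorem exists_kept_superset (he : Δ.IsEnum e) (hr : Δ.M.eRank = 4) (hI : Δ.Outer I)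
    {G : Finset (Fin 4)} (hG : Δ.Kept e G I) :
    ∃ H, G ⊆ H ∧ Δ.Kept e H I ∧ I.ncard + H.card = 4 := by
  have hrk := he.rankNat_gam hr hI
  obtain ⟨S, hS, hGS⟩ := ((he.gam_indep_image hI).2 hG).exists_isBase_superset
  obtain ⟨H, rfl⟩ := he.eq_image ((gam_indep_iff Δ hI _).1 hS.indep).1
  refine ⟨H, ?_, (he.gam_indep_image hI).1 hS.indep, ?_⟩
  · exact_mod_cast (Set.image_subset_image_iff he.inj).1 hGS
  · rw [rankNat, ← hS.encard_eq_eRank, he.inj.encard_image,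
      Set.encard_coe_eq_coe_finsetCard] at hrk
    exact hrk

theorem hVector_single (he : Δ.IsEnum e) (hr : Δ.M.eRank = 4) (hx : Δ.Outer {x}) :
    hVector (Δ.Gam {x}) = (List.range 4).map fun j => if j < Δ.nb x then 1 else 0 := by
  classical
  have hrk := he.rankNat_gam hr hx
  rw [Set.ncard_singleton] at hrk
  have hk : ∀ k, fNumber (Δ.Gam {x}) k = (Δ.rowBits e x).faces k := by
    intro k
    rw [he.fNumber_gam hx, Quad.faces]
    congr 1
    refine Finset.filter_congr fun G _ => ?_
    simp only [Quad.avoids_iff, rowBits_get]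
    constructor
    · intro hG
      obtain ⟨H, hGH, hH, hc⟩ := he.exists_kept_superset hr hx hG
      rw [Set.ncard_singleton] at hc
      obtain ⟨i, rfl⟩ := Fin4.exists_eq_compl_singleton (by omega : H.card = 3)
      exact ⟨i, fun h => by simpa using hGH h, hH⟩
    · rintro ⟨i, hi, hK⟩
      exact hK.mono (fun k hk => by rw [Finset.mem_compl, Finset.mem_singleton]; rintro rfl; exact hi hk) subset_rfl
  rw [hVector_of_rankNat_three (by omega), he.nb_eq hr hx,
    ← Quad.hVector_faces (he.rowBits_nonzero hr hx)]
  simp only [hk]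

/-- All subsets of `B` are independent, so this is the binomial expansion of `(X + (1 - X)) ^ 4`. -/
theorem hPoly_empty (he : Δ.IsEnum e) (hr : Δ.M.eRank = 4) : hPoly (Δ.Gam ∅) = 1 := by
  classical
  have h0 : Δ.Outer ∅ := by simp [Outer]
  have hrk := he.rankNat_gam hr h0
  rw [Set.ncard_empty, zero_add] at hrk
  have hk : ∀ k, fNumber (Δ.Gam ∅) k = Nat.choose 4 k := by
    intro k
    rw [he.fNumber_gam h0, Finset.filter_true_of_mem, Finset.card_powersetCard, Finset.card_univ,
      Fintype.card_fin]
    exact fun G _ => he.kept_univ.mono (Finset.subset_univ _) subset_rfl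
  simp only [hPoly, hrk, hk, Finset.sum_range_succ, Finset.sum_range_zero]
  simp [Nat.choose]
  ring

/-- The monomials of the output with support `I` and degree `|I| + j`. -/
theorem ncard_of_eq_image {β : Type*} [DecidableEq β] {F : Set (α →₀ ℕ)} (S : Finset β) (d : β → ℕ)
    (f : β → α →₀ ℕ) (hf : Set.InjOn f S) (hd : ∀ b ∈ S, (f b).degree = d b) (k : ℕ)
    (hF : ∀ m, (m ∈ F ∧ (m.support : Set α) = I) ↔ ∃ b ∈ S, m = f b) :
    {m : α →₀ ℕ | m ∈ F ∧ (m.support : Set α) = I ∧ m.degree = k}.ncard =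
      (S.filter fun b => d b = k).card := by
  classical
  rw [← Finset.card_image_of_injOn (hf.mono (Finset.coe_subset.2 (Finset.filter_subset _ S))),
    ← Set.ncard_coe_finset]
  congr 1
  ext m
  simp only [Set.mem_ofPred_eq, ← and_assoc, hF, Finset.coe_image, Set.mem_image, Finset.mem_coe,
    Finset.mem_filter]
  constructor
  · rintro ⟨⟨b, hb, rfl⟩, hk⟩
    exact ⟨b, ⟨hb, by rw [← hd b hb, hk]⟩, rfl⟩
  · rintro ⟨b, ⟨hb, hk⟩, rfl⟩
    exact ⟨⟨b, hb, rfl⟩, by rw [hd b hb, hk]⟩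

end IsEnum

/-! ### Sorting outer sets -/

theorem exists_sorted_two (hI : Δ.Outer I) (hc : I.ncard = 2) :
    ∃ x y, I = {x, y} ∧ Δ.prec x y := by
  obtain ⟨x, y, hxy, rfl⟩ := Set.ncard_eq_two.1 hc
  rcases prec_total hI.pair_left hI.pair_right hxy with h | h
  · exact ⟨x, y, rfl, h⟩
  · exact ⟨y, x, Set.pair_comm x y, h⟩

theorem exists_sorted_three (hI : Δ.Outer I) (hc : I.ncard = 3) :
    ∃ x y z, I = {x, y, z} ∧ Δ.prec x y ∧ Δ.prec y z := by
  obtain ⟨z, J, hz, rfl, hJ⟩ := (Set.ncard_eq_succ hI.finite).1 hc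
  obtain ⟨x, y, rfl, hxy⟩ := exists_sorted_two (hI.subset (Set.subset_insert _ _)) hJ
  have hzo : Δ.Outer {z} := hI.subset (by simp)
  have hzx : z ≠ x := fun h => hz (Or.inl h)
  have hzy : z ≠ y := fun h => hz (Or.inr h)
  rcases prec_total hzo hI.yz.pair_left hzx with h1 | h1
  · exact ⟨z, x, y, rfl, h1, hxy⟩
  rcases prec_total hzo hI.yz.pair_right hzy with h2 | h2
  · exact ⟨x, z, y, Set.insert_comm _ _ _, h1, h2⟩
  · exact ⟨x, y, z, by ext; simp; tauto, hxy, h2⟩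

theorem exists_sorted_four (hI : Δ.Outer I) (hc : I.ncard = 4) :
    ∃ w x y z, I = {w, x, y, z} ∧ Δ.prec w x ∧ Δ.prec x y ∧ Δ.prec y z := by
  obtain ⟨w, J, hw, rfl, hJ⟩ := (Set.ncard_eq_succ hI.finite).1 hc
  have hJo := hI.subset (Set.subset_insert w J)
  obtain ⟨x, y, z, rfl, hxy, hyz⟩ := exists_sorted_three hJo hJ
  have hwo : Δ.Outer {w} := hI.subset (by simp)
  rcases prec_total hwo hJo.xy.pair_left (fun h => hw (Or.inl h)) with h1 | h1
  · exact ⟨w, x, y, z, rfl, h1, hxy, hyz⟩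
  rcases prec_total hwo hJo.yz.pair_left (fun h => hw (Or.inr (Or.inl h))) with h2 | h2
  · exact ⟨x, w, y, z, by ext; simp; tauto, h1, h2, hyz⟩
  rcases prec_total hwo hJo.yz.pair_right (fun h => hw (Or.inr (Or.inr h))) with h3 | h3
  · exact ⟨x, y, w, z, by ext; simp; tauto, hxy, h2, h3⟩
  · exact ⟨x, y, z, w, by ext; simp; tauto, hxy, hyz, h3⟩

theorem sorted_two_unique {x' y' : α} (h : ({x', y'} : Set α) = {x, y}) (hp : Δ.prec x y)
    (hp' : Δ.prec x' y') : x' = x ∧ y' = y := by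
  rcases Set.pair_eq_pair_iff.1 h with h | ⟨rfl, rfl⟩
  · exact h
  · exact absurd hp hp'.asymm

/-- The least and the greatest element are determined by the set, and then so is the middle one. -/
theorem sorted_three_unique {x' y' z' : α} (h : ({x', y', z'} : Set α) = {x, y, z})
    (hxy : Δ.prec x y) (hyz : Δ.prec y z) (hxy' : Δ.prec x' y') (hyz' : Δ.prec y' z') :
    x' = x ∧ y' = y ∧ z' = z := by
  have key : ∀ {x y z x' y' z'}, ({x', y', z'} : Set α) ⊆ {x, y, z} → Δ.prec x y → Δ.prec y z →
      Δ.prec x' y' → Δ.prec y' z' → x' = x ∨ Δ.prec x x' := by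
    intro x y z x' y' z' h hxy hyz _ _
    rcases h (Or.inl rfl) with h | h | h
    · exact Or.inl h
    · exact Or.inr (h ▸ hxy)
    · exact Or.inr (h ▸ prec_trans hxy hyz)
  have key' : ∀ {x y z x' y' z'}, ({x', y', z'} : Set α) ⊆ {x, y, z} → Δ.prec x y → Δ.prec y z →
      Δ.prec x' y' → Δ.prec y' z' → z' = z ∨ Δ.prec z' z := by
    intro x y z x' y' z' h hxy hyz _ _
    rcases h (Or.inr (Or.inr rfl)) with h | h | h
    · exact Or.inr (h ▸ prec_trans hxy hyz)
    · exact Or.inr (h ▸ hyz)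
    · exact Or.inl h
  have hx : x' = x := by
    rcases key h.subset hxy hyz hxy' hyz' with h1 | h1
    · exact h1
    · rcases key h.superset hxy' hyz' hxy hyz with h2 | h2
      exacts [h2.symm, absurd h1 h2.asymm]
  have hz : z' = z := by
    rcases key' h.subset hxy hyz hxy' hyz' with h1 | h1
    · exact h1
    · rcases key' h.superset hxy' hyz' hxy hyz with h2 | h2
      exacts [h2.symm, absurd h1 h2.asymm]
  subst hx hz
  refine ⟨rfl, ?_, rfl⟩
  rcases h.subset (Or.inr (Or.inl rfl)) with h | h | h
  exacts [absurd h hxy'.ne.symm, h, absurd h hyz'.ne]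

end BasedMatroid

namespace BasedMatroid

variable {α : Type u} {Δ : BasedMatroid α} {e : Fin 4 → α} {w x y z : α} {I : Set α}

/-! ### Counting monomials by their support -/

theorem ncard_sorted_three (hxy : Δ.prec x y) (hyz : Δ.prec y z) :
    ({x, y, z} : Set α).ncard = 3 :=
  Set.ncard_eq_three.2 ⟨x, y, z, hxy.ne, (prec_trans hxy hyz).ne, hyz.ne, rfl⟩

theorem ncard_sorted_four (hwx : Δ.prec w x) (hxy : Δ.prec x y) (hyz : Δ.prec y z) :
    ({w, x, y, z} : Set α).ncard = 4 := by
  rw [Set.ncard_insert_of_notMem, ncard_sorted_three hxy hyz]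
  simp [hwx.ne, (prec_trans hwx hxy).ne, (prec_trans (prec_trans hwx hxy) hyz).ne]

namespace IsEnum

/-- The monomials of the output, sorted by the cardinality of the support. -/
theorem output_cases_ncard (he : Δ.IsEnum e) (hr : Δ.M.eRank = 4) : ∀ m ∈ rankFourOutput α Δ,
    ((m.support : Set α).ncard = 0 ∧ m = 0) ∨
    ((m.support : Set α).ncard = 1 ∧ ∃ x t, (m.support : Set α) = {x} ∧ 1 ≤ t ∧ t ≤ Δ.nb x ∧
      m = Finsupp.single x t) ∨
    ((m.support : Set α).ncard = 2 ∧ ∃ x y a b, (m.support : Set α) = {x, y} ∧ Δ.prec x y ∧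
      (a, b) ∈ Δ.pairExps x y ∧ m = Finsupp.single x a + Finsupp.single y b) ∨
    ((m.support : Set α).ncard = 3 ∧ ∃ x y z a b c, (m.support : Set α) = {x, y, z} ∧
      Δ.prec x y ∧ Δ.prec y z ∧ (a, b, c) ∈ Δ.tripleExps x y z ∧
      m = Finsupp.single x a + Finsupp.single y b + Finsupp.single z c) ∨
    ((m.support : Set α).ncard = 4 ∧ m.degree = 4 ∧ ∀ i ∈ m.support, m i = 1) := by
  refine output_cases ?_ (fun x hx t ht ht' => ?_) (fun x y h hxy a b hab => ?_)
    (fun x y z h hxy hyz a b c habc => ?_) (fun w x y z h hwx hxy hyz => ?_)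
  · exact Or.inl (by simp)
  · rw [coe_support_single ht, Set.ncard_singleton]
    exact Or.inr (Or.inl ⟨rfl, x, t, rfl, ht, ht', rfl⟩)
  · obtain ⟨ha, hb⟩ := (he.pairGood' hr h hxy).pos hab
    rw [coe_support_pair ha hb, Set.ncard_pair hxy.ne]
    exact Or.inr (Or.inr (Or.inl ⟨rfl, x, y, a, b, rfl, hxy, hab, rfl⟩))
  · obtain ⟨ha, hb, hc⟩ := (he.tripleGood' hr h hxy hyz).pos habc
    rw [coe_support_triple ha hb hc, ncard_sorted_three hxy hyz]
    exact Or.inr (Or.inr (Or.inr (Or.inl ⟨rfl, x, y, z, a, b, c, rfl, hxy, hyz, habc, rfl⟩)))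
  · refine Or.inr (Or.inr (Or.inr (Or.inr ⟨?_, by simp, fun i hi => ?_⟩)))
    · rw [coe_support_quad, ncard_sorted_four hwx hxy hyz]
    · rw [← Finset.mem_coe, coe_support_quad] at hi
      have hwy := prec_trans hwx hxy
      have hxz := prec_trans hxy hyz
      have hwz := prec_trans hwx hxz
      rcases hi with rfl | rfl | rfl | rfl <;>
        simp [hwx.ne, hwx.ne.symm, hxy.ne, hxy.ne.symm, hyz.ne, hyz.ne.symm,
          hwy.ne, hwy.ne.symm, hxz.ne, hxz.ne.symm, hwz.ne, hwz.ne.symm]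

theorem ncard_support_empty (he : Δ.IsEnum e) (hr : Δ.M.eRank = 4) (j : ℕ) :
    ({m : α →₀ ℕ | m ∈ rankFourOutput α Δ ∧ (m.support : Set α) = ∅ ∧ m.degree = j}.ncard : ℤ) =
      hNumber (Δ.Gam ∅) j := by
  rw [ncard_of_eq_image {()} (fun _ => 0) (fun _ => 0) (by simp) (by simp), hNumber,
    he.hPoly_empty hr, Polynomial.coeff_one]
  · by_cases hj : j = 0
    · subst hj; simp
    · simp [hj, Ne.symm hj]
  · intro m
    constructor
    · rintro ⟨-, h⟩
      exact ⟨(), by simp, by simpa using h⟩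
    · rintro ⟨-, -, rfl⟩
      exact ⟨zero_mem, by simp⟩

theorem ncard_support_singleton (he : Δ.IsEnum e) (hr : Δ.M.eRank = 4) (hx : Δ.Outer {x}) (j : ℕ) :
    ({m : α →₀ ℕ | m ∈ rankFourOutput α Δ ∧ (m.support : Set α) = {x} ∧
      m.degree = 1 + j}.ncard : ℤ) = hNumber (Δ.Gam {x}) j := by
  rw [ncard_of_eq_image (Finset.Icc 1 (Δ.nb x)) id (Finsupp.single x)
    (Finsupp.single_injective x).injOn (by simp), hNumber_eq_getD, he.hVector_single hr hx]
  · have hnb : Δ.nb x ≤ 4 := by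
      rw [he.nb_eq hr hx, ← he.card_span_singleton]
      exact (Finset.card_le_univ _).trans (by simp)
    simp only [id, Finset.filter_eq', Finset.mem_Icc]
    by_cases hj : j < Δ.nb x
    · rw [if_pos (by omega), List.getD_eq_getElem _ _ (by simp; omega)]
      simp [hj]
    · rw [if_neg (by omega)]
      by_cases hj' : j < 4
      · rw [List.getD_eq_getElem _ _ (by simpa using hj')]
        simp [hj]
      · rw [List.getD_eq_default _ _ (by simpa using hj')]
        simp
  · intro m
    constructor
    · rintro ⟨hm, hs⟩
      rcases he.output_cases_ncard hr _ hm with ⟨hc, -⟩ | ⟨-, x', t, hx', ht, ht', rfl⟩ |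
        ⟨hc, -⟩ | ⟨hc, -⟩ | ⟨hc, -⟩
      case inr.inl =>
        obtain rfl := Set.singleton_injective (hs.symm.trans hx')
        exact ⟨t, Finset.mem_Icc.2 ⟨ht, ht'⟩, rfl⟩
      all_goals rw [hs, Set.ncard_singleton] at hc; omega
    · rintro ⟨t, ht, rfl⟩
      rw [Finset.mem_Icc] at ht
      exact ⟨single_mem hx ht.1 ht.2, coe_support_single ht.1⟩

theorem ncard_support_pair (he : Δ.IsEnum e) (hr : Δ.M.eRank = 4) (h : Δ.Outer {x, y})
    (hxy : Δ.prec x y) (j : ℕ) :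
    ({m : α →₀ ℕ | m ∈ rankFourOutput α Δ ∧ (m.support : Set α) = {x, y} ∧
      m.degree = 2 + j}.ncard : ℤ) = hNumber (Δ.Gam {x, y}) j := by
  rw [ncard_of_eq_image (Δ.pairExps x y).toFinset (fun e => e.1 + e.2)
    (fun e => Finsupp.single x e.1 + Finsupp.single y e.2), hNumber_eq_getD]
  · exact pairExponents_card (he.pairGood hr h hxy).2 _ _
  · intro a _ b _ hab
    have h1 := DFunLike.congr_fun hab x
    have h2 := DFunLike.congr_fun hab y
    simp [hxy.ne, hxy.ne.symm] at h1 h2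
    exact Prod.ext h1 h2
  · intro b _
    simp
  · intro m
    constructor
    · rintro ⟨hm, hs⟩
      rcases he.output_cases_ncard hr _ hm with ⟨hc, -⟩ | ⟨hc, -⟩ |
        ⟨-, x', y', a, b, hs', hxy', hab, rfl⟩ | ⟨hc, -⟩ | ⟨hc, -⟩
      case inr.inr.inl =>
        obtain ⟨rfl, rfl⟩ := sorted_two_unique (hs'.symm.trans hs) hxy hxy'
        exact ⟨(a, b), List.mem_toFinset.2 hab, rfl⟩
      all_goals rw [hs, Set.ncard_pair hxy.ne] at hc; omega
    · rintro ⟨⟨a, b⟩, hab, rfl⟩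
      rw [List.mem_toFinset] at hab
      obtain ⟨ha, hb⟩ := (he.pairGood' hr h hxy).pos hab
      exact ⟨pair_mem h hxy hab, coe_support_pair ha hb⟩

theorem ncard_support_triple (he : Δ.IsEnum e) (hr : Δ.M.eRank = 4) (h : Δ.Outer {x, y, z})
    (hxy : Δ.prec x y) (hyz : Δ.prec y z) (j : ℕ) :
    ({m : α →₀ ℕ | m ∈ rankFourOutput α Δ ∧ (m.support : Set α) = {x, y, z} ∧
      m.degree = 3 + j}.ncard : ℤ) = hNumber (Δ.Gam {x, y, z}) j := by
  rw [ncard_of_eq_image (Δ.tripleExps x y z).toFinset (fun e => e.1 + e.2.1 + e.2.2)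
    (fun e => Finsupp.single x e.1 + Finsupp.single y e.2.1 + Finsupp.single z e.2.2),
    hNumber_eq_getD]
  · exact tripleExponents_card (he.tripleGood hr h hxy hyz).2 _ _ _ _ _ _ _
  · intro a _ b _ hab
    have hxz := prec_trans hxy hyz
    have h1 := DFunLike.congr_fun hab x
    have h2 := DFunLike.congr_fun hab y
    have h3 := DFunLike.congr_fun hab z
    simp [hxy.ne, hxy.ne.symm, hyz.ne, hyz.ne.symm, hxz.ne, hxz.ne.symm]
      at h1 h2 h3
    exact Prod.ext h1 (Prod.ext h2 h3)
  · intro b _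
    simp
  · intro m
    constructor
    · rintro ⟨hm, hs⟩
      rcases he.output_cases_ncard hr _ hm with ⟨hc, -⟩ | ⟨hc, -⟩ | ⟨hc, -⟩ |
        ⟨-, x', y', z', a, b, c, hs', hxy', hyz', habc, rfl⟩ | ⟨hc, -⟩
      case inr.inr.inr.inl =>
        obtain ⟨rfl, rfl, rfl⟩ := sorted_three_unique (hs'.symm.trans hs) hxy hyz hxy' hyz'
        exact ⟨(a, b, c), List.mem_toFinset.2 habc, rfl⟩
      all_goals rw [hs, ncard_sorted_three hxy hyz] at hc; omega
    · rintro ⟨⟨a, b, c⟩, habc, rfl⟩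
      rw [List.mem_toFinset] at habc
      obtain ⟨ha, hb, hc⟩ := (he.tripleGood' hr h hxy hyz).pos habc
      exact ⟨triple_mem h hxy hyz habc, coe_support_triple ha hb hc⟩

theorem ncard_support_quad (he : Δ.IsEnum e) (hr : Δ.M.eRank = 4) (h : Δ.Outer {w, x, y, z})
    (hwx : Δ.prec w x) (hxy : Δ.prec x y) (hyz : Δ.prec y z) (j : ℕ) :
    ({m : α →₀ ℕ | m ∈ rankFourOutput α Δ ∧ (m.support : Set α) = {w, x, y, z} ∧
      m.degree = 4 + j}.ncard : ℤ) = hNumber (Δ.Gam {w, x, y, z}) j := by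
  have hc4 := ncard_sorted_four hwx hxy hyz
  have hrk := he.rankNat_gam hr h
  rw [hc4] at hrk
  rw [ncard_of_eq_image {()} (fun _ => 4) (fun _ => Finsupp.single w 1 + Finsupp.single x 1 +
    Finsupp.single y 1 + Finsupp.single z 1) (by simp) (by simp), hNumber_eq_getD,
    hVector_of_rankNat_zero (by omega), he.fNumber_gam_zero h]
  · by_cases hj : j = 0
    · subst hj; simp
    · rw [List.getD_eq_default _ _ (by simp; omega), Finset.filter_eq_empty_iff.2 (by simp [hj])]
      rfl
  · intro m
    constructor
    · rintro ⟨hm, hs⟩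
      refine ⟨(), by simp, ?_⟩
      rcases he.output_cases_ncard hr _ hm with ⟨hc, -⟩ | ⟨hc, -⟩ | ⟨hc, -⟩ | ⟨hc, -⟩ | ⟨-, -, h1⟩
      case inr.inr.inr.inr =>
        -- Both monomials have all exponents equal to `1` on the same support, so they agree.
        have hq := he.output_cases_ncard hr _ (quad_mem h hwx hxy hyz)
        rw [coe_support_quad, hc4] at hq
        obtain ⟨-, -, h2⟩ := ((((hq.resolve_left (by omega)).resolve_left (by omega)).resolve_left
          (by omega)).resolve_left (by omega))
        have hss : m.support = (Finsupp.single w 1 + Finsupp.single x 1 + Finsupp.single y 1 +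
            Finsupp.single z 1).support := by
          rw [← Finset.coe_inj, hs, coe_support_quad]
        ext i
        by_cases hi : i ∈ m.support
        · rw [h1 i hi, h2 i (hss ▸ hi)]
        · rw [Finsupp.notMem_support_iff.1 hi, Finsupp.notMem_support_iff.1 (hss ▸ hi)]
      all_goals rw [hs, hc4] at hc; omega
    · rintro ⟨-, -, rfl⟩
      exact ⟨quad_mem h hwx hxy hyz, coe_support_quad⟩

theorem ncard_support (he : Δ.IsEnum e) (hr : Δ.M.eRank = 4) (hI : Δ.Outer I) (j : ℕ) :
    ({m : α →₀ ℕ | m ∈ rankFourOutput α Δ ∧ (m.support : Set α) = I ∧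
      m.degree = I.ncard + j}.ncard : ℤ) = hNumber (Δ.Gam I) j := by
  have hle := he.card_le hr hI hI.kept_empty
  rw [Finset.card_empty, add_zero] at hle
  obtain hc | hc | hc | hc | hc : I.ncard = 0 ∨ I.ncard = 1 ∨ I.ncard = 2 ∨ I.ncard = 3 ∨
    I.ncard = 4 := by omega
  · rw [hc, zero_add]
    obtain rfl := (Set.ncard_eq_zero hI.finite).1 hc
    exact he.ncard_support_empty hr j
  · rw [hc]
    obtain ⟨x, rfl⟩ := Set.ncard_eq_one.1 hc
    exact he.ncard_support_singleton hr hI j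
  · rw [hc]
    obtain ⟨x, y, rfl, hxy⟩ := exists_sorted_two hI hc
    exact he.ncard_support_pair hr hI hxy j
  · rw [hc]
    obtain ⟨x, y, z, rfl, hxy, hyz⟩ := exists_sorted_three hI hc
    exact he.ncard_support_triple hr hI hxy hyz j
  · rw [hc]
    obtain ⟨w, x, y, z, rfl, hwx, hxy, hyz⟩ := exists_sorted_four hI hc
    exact he.ncard_support_quad hr hI hwx hxy hyz j

end IsEnum

/-! ### Restriction -/

section Restrict

variable {hI : I ⊆ Δ.M.E} {X : Set α}

theorem restrictTo_outer_iff :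
    (Δ.restrictTo I hI).Outer X ↔ Δ.Outer X ∧ X ⊆ I := by
  simp only [Outer, restrictTo, Matroid.restrict_indep_iff]
  constructor
  · rintro ⟨⟨h1, h2⟩, h3⟩
    exact ⟨⟨h1, h3⟩, fun x hx => (h2 hx).resolve_left fun hB => Set.disjoint_left.1 h3 hx hB⟩
  · rintro ⟨⟨h1, h2⟩, h3⟩
    exact ⟨⟨h1, h3.trans Set.subset_union_right⟩, h2⟩

/-- `Γ_X` sees only subsets of `B ∪ X`, and these survive the restriction. All data that the
algorithm consults for the support `X` are therefore unchanged. -/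
theorem restrictTo_gam (hX : (Δ.restrictTo I hI).Outer X) :
    (Δ.restrictTo I hI).Gam X = Δ.Gam X := by
  obtain ⟨hX', hXI⟩ := restrictTo_outer_iff.1 hX
  refine Matroid.ext_indep rfl fun G _ => ?_
  rw [gam_indep_iff _ hX, gam_indep_iff _ hX']
  simp only [restrictTo, Matroid.restrict_indep_iff]
  constructor
  · rintro ⟨h1, h2, -⟩
    exact ⟨h1, h2⟩
  · rintro ⟨h1, h2⟩
    exact ⟨h1, h2, Set.union_subset_union h1 hXI⟩

theorem restrictTo_nb (hX : (Δ.restrictTo I hI).Outer {x}) :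
    (Δ.restrictTo I hI).nb x = Δ.nb x := by
  rw [nb, nb, restrictTo_gam hX]

theorem restrictTo_prec (hx : (Δ.restrictTo I hI).Outer {x})
    (hy : (Δ.restrictTo I hI).Outer {y}) : (Δ.restrictTo I hI).prec x y ↔ Δ.prec x y := by
  have hxI : x ∈ I := (restrictTo_outer_iff.1 hx).2 rfl
  have hyI : y ∈ I := (restrictTo_outer_iff.1 hy).2 rfl
  rw [prec, prec, restrictTo_nb hx, restrictTo_nb hy]
  simp [restrictTo, hxI, hyI]

theorem restrictTo_pairExps (h : (Δ.restrictTo I hI).Outer {x, y}) :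
    (Δ.restrictTo I hI).pairExps x y = Δ.pairExps x y := by
  rw [pairExps, pairExps, restrictTo_gam h, restrictTo_nb h.pair_left]

theorem restrictTo_tripleExps (h : (Δ.restrictTo I hI).Outer {x, y, z}) :
    (Δ.restrictTo I hI).tripleExps x y z = Δ.tripleExps x y z := by
  rw [tripleExps, tripleExps, restrictTo_gam h, restrictTo_gam h.xy,
    restrictTo_gam h.xz, restrictTo_gam h.yz, restrictTo_nb h.xy.pair_left,
    restrictTo_nb h.yz.pair_left, restrictTo_nb h.yz.pair_right]

theorem IsEnum.output_restrictTo (he : Δ.IsEnum e) (hr : Δ.M.eRank = 4) :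
    {m : α →₀ ℕ | m ∈ rankFourOutput α Δ ∧ (m.support : Set α) ⊆ I} =
      rankFourOutput α (Δ.restrictTo I hI) := by
  ext m
  constructor
  · rintro ⟨hm, hs⟩
    revert hs
    revert m
    refine output_cases ?_ (fun x hx t ht ht' => ?_) (fun x y h hxy a b hab => ?_)
      (fun x y z h hxy hyz a b c habc => ?_) (fun w x y z h hwx hxy hyz => ?_)
    · exact fun _ => zero_mem
    · rw [coe_support_single ht]
      intro hs
      have ho : (Δ.restrictTo I hI).Outer {x} := restrictTo_outer_iff.2 ⟨hx, hs⟩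
      exact single_mem ho ht (by rwa [restrictTo_nb ho])
    · obtain ⟨ha, hb⟩ := (he.pairGood' hr h hxy).pos hab
      rw [coe_support_pair ha hb]
      intro hs
      have ho : (Δ.restrictTo I hI).Outer {x, y} := restrictTo_outer_iff.2 ⟨h, hs⟩
      exact pair_mem ho ((restrictTo_prec ho.pair_left ho.pair_right).2 hxy)
        (by rwa [restrictTo_pairExps ho])
    · obtain ⟨ha, hb, hc⟩ := (he.tripleGood' hr h hxy hyz).pos habc
      rw [coe_support_triple ha hb hc]
      intro hs
      have ho : (Δ.restrictTo I hI).Outer {x, y, z} := restrictTo_outer_iff.2 ⟨h, hs⟩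
      exact triple_mem ho ((restrictTo_prec ho.xy.pair_left ho.xy.pair_right).2 hxy)
        ((restrictTo_prec ho.yz.pair_left ho.yz.pair_right).2 hyz)
        (by rwa [restrictTo_tripleExps ho])
    · rw [coe_support_quad]
      intro hs
      have ho : (Δ.restrictTo I hI).Outer {w, x, y, z} := restrictTo_outer_iff.2 ⟨h, hs⟩
      have o : ∀ v ∈ ({w, x, y, z} : Set α), (Δ.restrictTo I hI).Outer {v} := fun v hv =>
        ho.subset (Set.singleton_subset_iff.2 hv)
      exact quad_mem ho ((restrictTo_prec (o _ (by simp)) (o _ (by simp))).2 hwx)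
        ((restrictTo_prec (o _ (by simp)) (o _ (by simp))).2 hxy)
        ((restrictTo_prec (o _ (by simp)) (o _ (by simp))).2 hyz)
  · revert m
    refine output_cases ?_ (fun x hx t ht ht' => ?_) (fun x y ho hxy a b hab => ?_)
      (fun x y z ho hxy hyz a b c habc => ?_) (fun w x y z ho hwx hxy hyz => ?_)
    · exact ⟨zero_mem, by simp⟩
    · obtain ⟨hx', hxI⟩ := restrictTo_outer_iff.1 hx
      exact ⟨single_mem hx' ht (by rwa [restrictTo_nb hx] at ht'),
        by rwa [coe_support_single ht]⟩
    · obtain ⟨h, hs⟩ := restrictTo_outer_iff.1 ho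
      rw [restrictTo_prec ho.pair_left ho.pair_right] at hxy
      rw [restrictTo_pairExps ho] at hab
      obtain ⟨ha, hb⟩ := (he.pairGood' hr h hxy).pos hab
      exact ⟨pair_mem h hxy hab, by rwa [coe_support_pair ha hb]⟩
    · obtain ⟨h, hs⟩ := restrictTo_outer_iff.1 ho
      rw [restrictTo_prec ho.xy.pair_left ho.xy.pair_right] at hxy
      rw [restrictTo_prec ho.yz.pair_left ho.yz.pair_right] at hyz
      rw [restrictTo_tripleExps ho] at habc
      obtain ⟨ha, hb, hc⟩ := (he.tripleGood' hr h hxy hyz).pos habc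
      exact ⟨triple_mem h hxy hyz habc, by rwa [coe_support_triple ha hb hc]⟩
    · obtain ⟨h, hs⟩ := restrictTo_outer_iff.1 ho
      have o : ∀ v ∈ ({w, x, y, z} : Set α), (Δ.restrictTo I hI).Outer {v} := fun v hv =>
        ho.subset (Set.singleton_subset_iff.2 hv)
      rw [restrictTo_prec (o _ (by simp)) (o _ (by simp))] at hwx hxy hyz
      exact ⟨quad_mem h hwx hxy hyz, by rwa [coe_support_quad]⟩

end Restrict

end BasedMatroid

/-! ### Isomorphisms -/

namespace BasedMatroid

variable {α β : Type u} {Δ : BasedMatroid α} {Δ' : BasedMatroid β} {f : α → β} {e : Fin 4 → α}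
  {w x y z : α} {X : Set α} {G : Finset (Fin 4)}

namespace IsIso

theorem isEnum (h : Δ.IsIso Δ' f) (he : Δ.IsEnum e) : Δ'.IsEnum (f ∘ e) where
  inj i j hij := he.inj (h.bijOn.injOn (Δ.isBase.subset_ground (he.mem i))
    (Δ.isBase.subset_ground (he.mem j)) hij)
  range := by rw [Set.range_comp, he.range, h.image_base]

theorem eRank_eq (h : Δ.IsIso Δ' f) : Δ'.M.eRank = Δ.M.eRank := by
  rw [← Δ.isBase.encard_eq_eRank, ← Δ'.isBase.encard_eq_eRank, ← h.image_base,
    (h.bijOn.injOn.mono Δ.isBase.subset_ground).encard_image]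

theorem outer_image_iff (h : Δ.IsIso Δ' f) (hX : X ⊆ Δ.M.E) :
    Δ'.Outer (f '' X) ↔ Δ.Outer X := by
  rw [Outer, Outer, ← h.indep_iff X hX, ← h.image_base, Set.disjoint_iff_inter_eq_empty,
    Set.disjoint_iff_inter_eq_empty, ← h.bijOn.injOn.image_inter hX Δ.isBase.subset_ground,
    Set.image_eq_empty]

theorem kept_image_iff (h : Δ.IsIso Δ' f) (he : Δ.IsEnum e) (hX : X ⊆ Δ.M.E) :
    Δ'.Kept (f ∘ e) G (f '' X) ↔ Δ.Kept e G X := by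
  rw [Kept, Kept, Set.image_comp, ← Set.image_union, ← h.indep_iff]
  exact Set.union_subset hX ((he.image_subset G).trans Δ.isBase.subset_ground)

/-- With the enumeration of `B` transported along `f`, both sides count the same subsets of `Fin 4`.
-/
theorem fNumber_gam (h : Δ.IsIso Δ' f) (he : Δ.IsEnum e) (hX : Δ.Outer X) (k : ℕ) :
    fNumber (Δ'.Gam (f '' X)) k = fNumber (Δ.Gam X) k := by
  classical
  have hXE := hX.1.subset_ground
  rw [(h.isEnum he).fNumber_gam ((h.outer_image_iff hXE).2 hX), he.fNumber_gam hX]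
  simp only [h.kept_image_iff he hXE]

theorem rankNat_gam (h : Δ.IsIso Δ' f) (he : Δ.IsEnum e) (hr : Δ.M.eRank = 4) (hX : Δ.Outer X) :
    rankNat (Δ'.Gam (f '' X)) = rankNat (Δ.Gam X) := by
  have hXE := hX.1.subset_ground
  have h1 := he.rankNat_gam hr hX
  have h2 := (h.isEnum he).rankNat_gam (h.eRank_eq.trans hr) ((h.outer_image_iff hXE).2 hX)
  rw [(h.bijOn.injOn.mono hXE).ncard_image] at h2
  omega

theorem hVector_gam (h : Δ.IsIso Δ' f) (he : Δ.IsEnum e) (hr : Δ.M.eRank = 4) (hX : Δ.Outer X) :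
    hVector (Δ'.Gam (f '' X)) = hVector (Δ.Gam X) := by
  unfold hVector hNumber hPoly
  simp only [h.rankNat_gam he hr hX, h.fNumber_gam he hX]

theorem nb_eq (h : Δ.IsIso Δ' f) (he : Δ.IsEnum e) (hr : Δ.M.eRank = 4) (hx : Δ.Outer {x}) :
    Δ'.nb (f x) = Δ.nb x := by
  have hx' := (h.outer_image_iff hx.1.subset_ground).2 hx
  have hf := h.fNumber_gam he hx 3
  rw [Set.image_singleton] at hx' hf
  rw [(h.isEnum he).nb_eq_fNumber (h.eRank_eq.trans hr) hx', he.nb_eq_fNumber hr hx, hf]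

theorem prec_iff (h : Δ.IsIso Δ' f) (he : Δ.IsEnum e) (hr : Δ.M.eRank = 4) (hx : Δ.Outer {x})
    (hy : Δ.Outer {y}) : Δ'.prec (f x) (f y) ↔ Δ.prec x y := by
  rw [prec, prec, h.nb_eq he hr hx, h.nb_eq he hr hy,
    h.lt_iff x (hx.subset_diff rfl) y (hy.subset_diff rfl)]

theorem hVector_pair (h : Δ.IsIso Δ' f) (he : Δ.IsEnum e) (hr : Δ.M.eRank = 4)
    (ho : Δ.Outer {x, y}) : hVector (Δ'.Gam {f x, f y}) = hVector (Δ.Gam {x, y}) := by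
  rw [← h.hVector_gam he hr ho, Set.image_pair]

theorem pairExps_eq (h : Δ.IsIso Δ' f) (he : Δ.IsEnum e) (hr : Δ.M.eRank = 4)
    (ho : Δ.Outer {x, y}) : Δ'.pairExps (f x) (f y) = Δ.pairExps x y := by
  rw [pairExps, pairExps, h.hVector_pair he hr ho, h.nb_eq he hr ho.pair_left]

theorem tripleExps_eq (h : Δ.IsIso Δ' f) (he : Δ.IsEnum e) (hr : Δ.M.eRank = 4)
    (ho : Δ.Outer {x, y, z}) : Δ'.tripleExps (f x) (f y) (f z) = Δ.tripleExps x y z := by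
  have h3 := h.hVector_gam he hr ho
  rw [Set.image_insert_eq, Set.image_pair] at h3
  rw [tripleExps, tripleExps, h3, h.hVector_pair he hr ho.xy, h.hVector_pair he hr ho.xz,
    h.hVector_pair he hr ho.yz, h.nb_eq he hr ho.xy.pair_left, h.nb_eq he hr ho.yz.pair_left,
    h.nb_eq he hr ho.yz.pair_right]

theorem exists_preimage (h : Δ.IsIso Δ' f) {Y : Set β} (hY : Δ'.Outer Y) {b : β} (hb : b ∈ Y) :
    ∃ a ∈ Δ.M.E, f a = b :=
  h.bijOn.surjOn (hY.1.subset_ground hb)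

theorem output_eq (h : Δ.IsIso Δ' f) (he : Δ.IsEnum e) (hr : Δ.M.eRank = 4) :
    rankFourOutput β Δ' = Finsupp.mapDomain f '' rankFourOutput α Δ := by
  apply Set.Subset.antisymm
  · refine output_cases ?_ (fun x hx t ht ht' => ?_) (fun x y ho hxy a b hab => ?_)
      (fun x y z ho hxy hyz a b c habc => ?_) (fun w x y z ho hwx hxy hyz => ?_)
    · exact ⟨0, zero_mem, Finsupp.mapDomain_zero⟩
    · obtain ⟨x, hxE, rfl⟩ := h.exists_preimage hx rfl
      rw [← Set.image_singleton, h.outer_image_iff (by simpa using hxE)] at hx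
      rw [h.nb_eq he hr hx] at ht'
      exact ⟨_, single_mem hx ht ht', Finsupp.mapDomain_single⟩
    · obtain ⟨x, hxE, rfl⟩ := h.exists_preimage ho (Or.inl rfl)
      obtain ⟨y, hyE, rfl⟩ := h.exists_preimage ho (Or.inr rfl)
      rw [← Set.image_pair, h.outer_image_iff (by simp [Set.insert_subset_iff, *])] at ho
      rw [h.prec_iff he hr ho.pair_left ho.pair_right] at hxy
      rw [h.pairExps_eq he hr ho] at hab
      exact ⟨_, pair_mem ho hxy hab, by
        simp only [Finsupp.mapDomain_add, Finsupp.mapDomain_single]⟩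
    · obtain ⟨x, hxE, rfl⟩ := h.exists_preimage ho (Or.inl rfl)
      obtain ⟨y, hyE, rfl⟩ := h.exists_preimage ho (Or.inr (Or.inl rfl))
      obtain ⟨z, hzE, rfl⟩ := h.exists_preimage ho (Or.inr (Or.inr rfl))
      rw [← Set.image_pair, ← Set.image_insert_eq,
        h.outer_image_iff (by simp [Set.insert_subset_iff, *])] at ho
      rw [h.prec_iff he hr ho.xy.pair_left ho.xy.pair_right] at hxy
      rw [h.prec_iff he hr ho.yz.pair_left ho.yz.pair_right] at hyz
      rw [h.tripleExps_eq he hr ho] at habc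
      exact ⟨_, triple_mem ho hxy hyz habc, by
        simp only [Finsupp.mapDomain_add, Finsupp.mapDomain_single]⟩
    · obtain ⟨w, hwE, rfl⟩ := h.exists_preimage ho (Or.inl rfl)
      obtain ⟨x, hxE, rfl⟩ := h.exists_preimage ho (Or.inr (Or.inl rfl))
      obtain ⟨y, hyE, rfl⟩ := h.exists_preimage ho (Or.inr (Or.inr (Or.inl rfl)))
      obtain ⟨z, hzE, rfl⟩ := h.exists_preimage ho (Or.inr (Or.inr (Or.inr rfl)))
      rw [← Set.image_pair, ← Set.image_insert_eq, ← Set.image_insert_eq,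
        h.outer_image_iff (by simp [Set.insert_subset_iff, *])] at ho
      have o : ∀ v ∈ ({w, x, y, z} : Set α), Δ.Outer {v} := fun v hv =>
        ho.subset (Set.singleton_subset_iff.2 hv)
      rw [h.prec_iff he hr (o _ (by simp)) (o _ (by simp))] at hwx hxy hyz
      exact ⟨_, quad_mem ho hwx hxy hyz, by
        simp only [Finsupp.mapDomain_add, Finsupp.mapDomain_single]⟩
  · rw [Set.image_subset_iff]
    refine output_cases ?_ (fun x hx t ht ht' => ?_) (fun x y ho hxy a b hab => ?_)
      (fun x y z ho hxy hyz a b c habc => ?_) (fun w x y z ho hwx hxy hyz => ?_) <;>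
      simp only [Set.mem_preimage, Finsupp.mapDomain_add, Finsupp.mapDomain_single,
        Finsupp.mapDomain_zero]
    · exact zero_mem
    · rw [← h.nb_eq he hr hx] at ht'
      rw [← h.outer_image_iff hx.1.subset_ground, Set.image_singleton] at hx
      exact single_mem hx ht ht'
    · rw [← h.prec_iff he hr ho.pair_left ho.pair_right] at hxy
      rw [← h.pairExps_eq he hr ho] at hab
      rw [← h.outer_image_iff ho.1.subset_ground, Set.image_pair] at ho
      exact pair_mem ho hxy hab
    · rw [← h.prec_iff he hr ho.xy.pair_left ho.xy.pair_right] at hxy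
      rw [← h.prec_iff he hr ho.yz.pair_left ho.yz.pair_right] at hyz
      rw [← h.tripleExps_eq he hr ho] at habc
      rw [← h.outer_image_iff ho.1.subset_ground, Set.image_insert_eq, Set.image_pair] at ho
      exact triple_mem ho hxy hyz habc
    · have o : ∀ v ∈ ({w, x, y, z} : Set α), Δ.Outer {v} := fun v hv =>
        ho.subset (Set.singleton_subset_iff.2 hv)
      rw [← h.prec_iff he hr (o _ (by simp)) (o _ (by simp))] at hwx hxy hyz
      rw [← h.outer_image_iff ho.1.subset_ground, Set.image_insert_eq, Set.image_insert_eq,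
        Set.image_pair] at ho
      exact quad_mem ho hwx hxy hyz

end IsIso

end BasedMatroid

/-! ### Counting all monomials of the output -/

open Polynomial in
/-- The `h`-polynomial as a sum over the independent sets. -/
theorem hPoly_eq_sum {α : Type u} {N : Matroid α} {ι : Type*} (S : Finset ι) (c : ι → ℕ)
    (hf : ∀ i, fNumber N i = (S.filter fun s => c s = i).card) (hc : ∀ s ∈ S, c s ≤ rankNat N) :
    hPoly N = ∑ s ∈ S, X ^ c s * (1 - X) ^ (rankNat N - c s) := by
  rw [hPoly, ← Finset.sum_fiberwise_of_maps_to (g := c) (t := Finset.range (rankNat N + 1))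
    (fun s hs => Finset.mem_range_succ_iff.2 (hc s hs))]
  refine Finset.sum_congr rfl fun i _ => ?_
  rw [Finset.sum_congr rfl (g := fun _ => X ^ i * (1 - X) ^ (rankNat N - i))
    (fun s hs => by rw [(Finset.mem_filter.1 hs).2]), Finset.sum_const, hf, nsmul_eq_mul, mul_assoc]
  simp

namespace BasedMatroid

variable {α : Type u} {Δ : BasedMatroid α} {e : Fin 4 → α} {I : Set α}

theorem finite_outer (Δ : BasedMatroid α) : {I | Δ.Outer I}.Finite :=
  Δ.finite.finite_subsets.subset fun _ hI => hI.1.subset_ground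

namespace IsEnum

open scoped Classical in
/-- The pairs of an outer set and a set of base elements whose union is independent. -/
noncomputable def keptPairs (_ : Δ.IsEnum e) : Finset (Set α × Finset (Fin 4)) :=
  (Δ.finite_outer.toFinset ×ˢ Finset.univ).filter fun p => Δ.Kept e p.2 p.1

theorem mem_keptPairs (he : Δ.IsEnum e) {p : Set α × Finset (Fin 4)} :
    p ∈ he.keptPairs ↔ Δ.Outer p.1 ∧ Δ.Kept e p.2 p.1 := by
  simp [keptPairs]

theorem union_image_inj (he : Δ.IsEnum e) {I J : Set α} {G H : Finset (Fin 4)}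
    (hI : Disjoint I Δ.B) (hJ : Disjoint J Δ.B) (h : I ∪ e '' G = J ∪ e '' H) :
    I = J ∧ G = H := by
  have h1 : ∀ {I : Set α} {G : Finset (Fin 4)}, Disjoint I Δ.B → (I ∪ e '' G) \ Δ.B = I :=
    fun {I G} hI => by
      rw [Set.union_sdiff_distrib, Set.sdiff_eq_empty.2 (he.image_subset G), Set.union_empty,
        hI.sdiff_eq_left]
  have h2 : ∀ {I : Set α} {G : Finset (Fin 4)}, Disjoint I Δ.B → (I ∪ e '' G) ∩ Δ.B = e '' G :=
    fun {I G} hI => by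
      rw [Set.union_inter_distrib_right, hI.inter_eq, Set.empty_union,
        Set.inter_eq_left.2 (he.image_subset G)]
  constructor
  · rw [← h1 hI (G := G), h, h1 hJ]
  · refine Finset.coe_injective (Set.image_injective.2 he.inj ?_)
    rw [← h2 hI (G := G), h, h2 hJ]

theorem ncard_union (he : Δ.IsEnum e) (hI : Δ.Outer I) (G : Finset (Fin 4)) :
    (I ∪ e '' G).ncard = I.ncard + G.card := by
  have h := he.encard_union hI.2 G
  rw [← hI.finite.cast_ncard_eq, ← (hI.finite.union (G.finite_toSet.image e)).cast_ncard_eq] at h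
  exact_mod_cast h

/-- Independent sets `A` correspond bijectively to the pairs formed by `A \ B` and the indices of `A
∩ B`. -/
theorem fNumber_eq (he : Δ.IsEnum e) (k : ℕ) :
    fNumber Δ.M k = (he.keptPairs.filter fun p => p.1.ncard + p.2.card = k).card := by
  rw [fNumber, ← Set.ncard_coe_finset,
    ← Set.InjOn.ncard_image (f := fun p : Set α × Finset (Fin 4) => p.1 ∪ e '' p.2)]
  · congr 1
    ext A
    constructor
    · rintro ⟨hA, hk⟩
      obtain ⟨G, hG⟩ := he.eq_image (Set.inter_subset_right (s := A) (t := Δ.B))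
      have hu : A \ Δ.B ∪ e '' G = A := by rw [← hG, Set.sdiff_union_inter]
      have ho : Δ.Outer (A \ Δ.B) := ⟨hA.subset Set.sdiff_subset, Set.disjoint_sdiff_left⟩
      refine ⟨(A \ Δ.B, G), ?_, hu⟩
      simp only [Finset.coe_filter, Set.mem_ofPred_eq, he.mem_keptPairs]
      exact ⟨⟨ho, by rwa [Kept, hu]⟩, by rw [← he.ncard_union ho, hu, hk]⟩
    · rintro ⟨⟨I, G⟩, hp, rfl⟩
      simp only [Finset.coe_filter, Set.mem_ofPred_eq, he.mem_keptPairs] at hp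
      exact ⟨hp.1.2, by rw [he.ncard_union hp.1.1, hp.2]⟩
  · rintro ⟨I, G⟩ hp ⟨J, H⟩ hq h
    simp only [Finset.coe_filter, Set.mem_ofPred_eq, he.mem_keptPairs] at hp hq
    obtain ⟨rfl, rfl⟩ := he.union_image_inj hp.1.1.2 hq.1.1.2 h
    rfl

/-- The `h`-polynomial is a sum of shifted `h`-polynomials of the matroids `Γ_I`. -/
theorem hPoly_eq (he : Δ.IsEnum e) (hr : Δ.M.eRank = 4) :
    hPoly Δ.M = ∑ I ∈ Δ.finite_outer.toFinset, Polynomial.X ^ I.ncard * hPoly (Δ.Gam I) := by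
  classical
  have hrk : rankNat Δ.M = 4 := by rw [rankNat, hr]; rfl
  rw [hPoly_eq_sum he.keptPairs (fun p => p.1.ncard + p.2.card) he.fNumber_eq, keptPairs,
    Finset.sum_filter, Finset.sum_product]
  · refine Finset.sum_congr rfl fun I hI => ?_
    have hI : Δ.Outer I := by simpa using hI
    have hrI := he.rankNat_gam hr hI
    rw [← Finset.sum_filter, hPoly_eq_sum (Finset.univ.filter fun G => Δ.Kept e G I) Finset.card,
      Finset.mul_sum]
    · refine Finset.sum_congr rfl fun G _ => ?_
      -- As the rank of `Γ_I` is `4 - |I|`, the powers of `1 - X` on both sides agree and only `X ^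
      -- |I|` splits off.
      have h4 : rankNat Δ.M - (I.ncard + G.card) = rankNat (Δ.Gam I) - G.card := by omega
      rw [pow_add, mul_assoc, h4]
    · intro k
      rw [he.fNumber_gam hI, Finset.filter_filter]
      congr 1
      ext G
      simp [and_comm]
    · intro G hG
      have := he.card_le hr hI (Finset.mem_filter.1 hG).2
      omega
  · intro p hp
    rw [he.mem_keptPairs] at hp
    rw [hrk]
    exact he.card_le hr hp.1 hp.2

/-- Both sides are sums over outer sets `I`: the monomials are sorted by their support, and the
`h`-polynomial is split by `hPoly_eq`. -/
theorem fVectorEntry_output (he : Δ.IsEnum e) (hr : Δ.M.eRank = 4) (j : ℕ) :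
    (fVectorEntry (rankFourOutput α Δ) j : ℤ) = hNumber Δ.M j := by
  classical
  have hfin : {m : α →₀ ℕ | m ∈ rankFourOutput α Δ ∧ m.degree = j}.Finite :=
    (he.output_finite hr).subset fun _ h => h.1
  rw [hNumber, he.hPoly_eq hr, Polynomial.finsetSum_coeff, fVectorEntry,
    Set.ncard_eq_toFinset_card _ hfin,
    Finset.card_eq_sum_card_fiberwise (f := fun m : α →₀ ℕ => (m.support : Set α))
      (t := Δ.finite_outer.toFinset), Nat.cast_sum]
  · refine Finset.sum_congr rfl fun I hI => ?_
    have hI : Δ.Outer I := by simpa using hI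
    have hset : ((hfin.toFinset.filter fun m => (m.support : Set α) = I) : Set (α →₀ ℕ)) =
        {m | m ∈ rankFourOutput α Δ ∧ (m.support : Set α) = I ∧ m.degree = j} := by
      ext m
      simp only [Finset.coe_filter, Set.Finite.mem_toFinset, Set.mem_ofPred_eq]
      tauto
    rw [Polynomial.coeff_X_pow_mul', ← Set.ncard_coe_finset, hset]
    split_ifs with hj
    · obtain ⟨k, rfl⟩ := Nat.exists_eq_add_of_le hj
      rw [he.ncard_support hr hI, Nat.add_sub_cancel_left, hNumber]
    -- If `j < |I|`, the coefficient is `0`, and a monomial has degree at least the size of its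
    -- support.
    · rw [Nat.cast_eq_zero, Set.ncard_eq_zero (hfin.subset fun m hm => ⟨hm.1, hm.2.2⟩),
        Set.eq_empty_iff_forall_notMem]
      rintro m ⟨-, rfl, rfl⟩
      refine hj ?_
      rw [Set.ncard_coe_finset, Finset.card_eq_sum_ones, Finsupp.degree]
      exact Finset.sum_le_sum fun i hi => Nat.one_le_iff_ne_zero.2 (Finsupp.mem_support_iff.1 hi)
  · intro m hm
    simpa using he.output_support hr m (by simpa using (hfin.mem_toFinset.1 hm).1)

end IsEnum

end BasedMatroid

/-! ### Pure order ideals in finitely many variables -/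

/-- Renaming variables along `g` preserves degree and divisibility in both directions and reaches
every monomial of `O`, so the preimage of `O` is a copy of it in `n` variables. -/
theorem isPureOSequence_of_support_subset {α : Type u} {n : ℕ} {O : Set (α →₀ ℕ)} {g : Fin n → α}
    (hg : Function.Injective g) (hO : IsPureOrderIdeal O)
    (hs : ∀ m ∈ O, (m.support : Set α) ⊆ Set.range g) :
    IsPureOSequence fun j => (fVectorEntry O j : ℤ) := by
  have hex : ∀ m ∈ O, ∃ m', Finsupp.mapDomain g m' = m := fun m hm =>
    ⟨m.comapDomain g hg.injOn, Finsupp.mapDomain_comapDomain g hg m (hs m hm)⟩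
  refine ⟨n, Finsupp.mapDomain g ⁻¹' O, ⟨?_, ?_, ?_, ?_⟩, fun j => ?_⟩
  · exact hO.finite.preimage (Finsupp.mapDomain_injective hg).injOn
  · obtain ⟨m, hm⟩ := hO.nonempty
    obtain ⟨m', rfl⟩ := hex m hm
    exact ⟨m', hm⟩
  · exact fun m hm m' h => hO.lower _ hm _ (Finsupp.mapDomain_mono h)
  · obtain ⟨d, hd⟩ := hO.pure
    refine ⟨d, fun m hm => ?_⟩
    rw [← Finsupp.degree_mapDomain g]
    refine hd _ ⟨hm.1, fun m' hm' h => ?_⟩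
    obtain ⟨m', rfl⟩ := hex m' hm'
    exact Finsupp.mapDomain_mono (hm.2 hm' ((Finsupp.mapDomain_le_mapDomain_iff_le hg _ _).1 h))
  · refine Nat.cast_inj.2 ?_
    unfold fVectorEntry
    rw [← Set.ncard_image_of_injective _ (Finsupp.mapDomain_injective (M := ℕ) hg)]
    congr 1
    ext m
    constructor
    · rintro ⟨m, ⟨hm, hd⟩, rfl⟩
      exact ⟨hm, by rwa [Finsupp.degree_mapDomain]⟩
    · rintro ⟨hm, hd⟩
      obtain ⟨m', rfl⟩ := hex m hm
      rw [Finsupp.degree_mapDomain] at hd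
      exact ⟨m', ⟨hm, hd⟩, rfl⟩

/-- Every finite matroid underlies a based matroid. -/
theorem exists_basedMatroid {α : Type u} (M : Matroid α) (hM : M.E.Finite) :
    ∃ Δ : BasedMatroid α, Δ.M = M := by
  obtain ⟨B, hB⟩ := M.exists_isBase
  exact ⟨{
    M := M
    finite := hM
    B := B
    isBase := hB
    lt := fun x y => (x ∈ M.E \ B ∧ y ∈ M.E \ B) ∧ WellOrderingRel x y
    lt_mem := fun _ _ h => h.1
    lt_irrefl := fun x h => irrefl_of WellOrderingRel x h.2
    lt_trans := fun _ _ _ h h' => ⟨⟨h.1.1, h'.1.2⟩, trans_of WellOrderingRel h.2 h'.2⟩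
    lt_total := fun x hx y hy hxy =>
      ((trichotomous_of WellOrderingRel x y).imp (fun h => ⟨⟨hx, hy⟩, h⟩)
        (fun h => ⟨⟨hy, hx⟩, h.resolve_left hxy⟩)) }, rfl⟩

theorem isPureOSequence_hNumber {α : Type u} {M : Matroid α} (hM : M.E.Finite) (hr : M.eRank = 4) :
    IsPureOSequence (hNumber M) := by
  obtain ⟨Δ, rfl⟩ := exists_basedMatroid M hM
  obtain ⟨e, he⟩ := Δ.exists_isEnum hr
  have : Finite Δ.M.E := hM
  obtain ⟨n, ⟨f⟩⟩ := Finite.exists_equiv_fin Δ.M.E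
  rw [show hNumber Δ.M = fun j => (fVectorEntry (rankFourOutput α Δ) j : ℤ) from
    funext fun j => (he.fVectorEntry_output hr j).symm]
  refine isPureOSequence_of_support_subset (g := fun i => (f.symm i : α))
    (Subtype.val_injective.comp f.symm.injective) (he.output_isPureOrderIdeal hr) fun m hm x hx => ?_
  exact ⟨f ⟨x, (he.output_support hr m hm).1.subset_ground hx⟩, by simp⟩

theorem mainTheorem5 :
    SolvesStrongStanley.{u} 4 rankFourOutput.{u} ∧
    (∀ (α : Type u) (Δ : BasedMatroid α), Δ.M.eRank = 4 →
      ∀ j : ℕ, (fVectorEntry (rankFourOutput α Δ) j : ℤ) = hNumber Δ.M j) ∧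
    (∀ (α : Type u) (M : Matroid α), M.E.Finite → M.eRank = 4 →
      IsPureOSequence (hNumber M)) := by
  refine ⟨⟨fun α Δ hr => ?_, fun α Δ hr => ?_, fun α Δ hr => ?_, fun α Δ hr => ?_,
    fun α Δ hr => ?_, fun α β Δ Δ' f hr h => ?_⟩, fun α Δ hr => ?_,
    fun α M hM hr => isPureOSequence_hNumber hM hr⟩ <;>
    obtain ⟨e, he⟩ := Δ.exists_isEnum hr
  · exact he.output_isPureOrderIdeal hr
  · exact fun m hm => (he.output_support hr m hm).subset_diff
  · exact he.output_support hr
  · exact fun I hI => he.ncard_support hr hI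
  · exact fun I _ => he.output_restrictTo hr
  · exact h.output_eq he hr
  · exact he.fVectorEntry_output hr
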